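/- Fix a function $w\in C^\infty(\mathbb R)$ with $w\ge 0$, $\operatorname{supp}w\subset[\tfrac12,2]$ and $w(s)=1-w(s/2)$ for $s\in[1,2]$. For $n\in\mathbb Z$ let $W_n$ be the Schwartz function on $\mathbb R^2$ with $\int W_n(x)e^{-i(x,t)}\,dx=w(\|t\|_2/2^n)$, and for a tempered distribution $f$ on $\mathbb R^2$ put $f_n=f*W_n$ and $$\|f\|_{B^1_{\infty,1}}=\sum_{n\in\mathbb Z}2^n\|f_n\|_{L^\infty(\mathbb R^2)} .$$ The class $B^1_{\infty,1}(\mathbb R^2)$ consists of the tempered distributions $f$ such that $\|f\|_{B^1_{\infty,1}}<\infty$ and $\partial f/\partial x_j=\sum_{n\in\mathbb Z}\partial f_n/\partial x_j$ for $j=1,2$, with convergence in the weak-$*$ topology of $\mathscr S'(\mathbb R^2)$; its elements are identified with continuous complex-valued functions. For finite rank self-adjoint operators $A$, $B$ on a complex Hilbert space with spectral expansions $A=\sum_j\lambda_jP_j$, $B=\sum_k\mu_kQ_k$ (the eigenvalue $0$ included), put $f(A,B)=\sum_{j,k}f(\lambda_j,\mu_k)P_jQ_k$. Let $\|\cdot\|_{S_p}$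 be the Schatten--von Neumann norm, $S_\infty$ being equipped with the operator norm, and let $1/\infty=0$. (a) There is a constant $C$, depending only on $w$, such that for all $p\in[2,\infty]$, all integers $N\ge0$, all self-adjoint operators $A_1,B_1,A_2,B_2$ of rank at most $N$ on a complex Hilbert space (with $0^0=1$), and all $f\in B^1_{\infty,1}(\mathbb R^2)$, $$\|f(A_1,B_1)-f(A_2,B_2)\|_{S_p}\le C\,N^{1/2-1/p}\,\|f\|_{B^1_{\infty,1}}\max\{\|A_1-A_2\|_{S_p},\|B_1-B_2\|_{S_p}\}.$$ (b) The estimate is sharp: there is a constant $c>0$, depending only on $w$, such that for all $p\in[2,\infty]$ and all $N\ge1$ there are a function $f\in B^1_{\infty,1}(\mathbb R^2)$ with $\|f\|_{B^1_{\infty,1}}\le1$ and self-adjoint operators $A_1\ne A_2$ and $B$ on $\mathbb C^N$ (hence of rank at most $N$) with $$\|f(A_1,B)-f(A_2,B)\|_{S_p}\ge c\,N^{1/2-1/p}\,\|A_1-A_2\|_{S_p}.$$ -/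

import Mathlib

open scoped ENNReal NNReal SchwartzMap ContDiff FourierTransform LineDeriv
open MeasureTheory

noncomputable section

/-- Euclidean space `ℝ^d`. -/
abbrev Rn (d : ℕ) : Type := EuclideanSpace ℝ (Fin d)

/-! ### Homogeneous Besov classes -/

/-- The generating functions of the dyadic decomposition: smooth `w ≥ 0` on `ℝ`, supported in
`[1/2, 2]`, with `w s = 1 - w (s / 2)` on `[1, 2]`. -/
structure IsDyadicWindow (w : ℝ → ℝ) : Prop where
  smooth : ContDiff ℝ ∞ w
  nonneg : ∀ s, 0 ≤ w s
  support_subset : Function.support w ⊆ Set.Icc (1 / 2) 2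
  partition : ∀ s ∈ Set.Icc (1 : ℝ) 2, w s = 1 - w (s / 2)

/-- The symbol `t ↦ w (‖t‖ / 2 ^ n)` written in the frequency variable `ξ = t / (2 * π)`, since
Mathlib's Fourier transform has the kernel `exp (-2 * π * i * ⟪x, ξ⟫)` and the kernel meant here is
`exp (-i * ⟪x, t⟫)`. -/
def dyadicSymbol (d : ℕ) (w : ℝ → ℝ) (n : ℤ) (ξ : Rn d) : ℂ :=
  ((w (2 * Real.pi * ‖ξ‖ / 2 ^ n) : ℝ) : ℂ)

theorem dyadicSymbol_contDiff (d : ℕ) {w : ℝ → ℝ} (hw : IsDyadicWindow w) (n : ℤ) :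
    ContDiff ℝ ∞ (dyadicSymbol d w n) := by
  rw [contDiff_iff_contDiffAt]
  intro x
  by_cases hx : x = 0
  · subst hx
    have h0 : ∀ᶠ y in nhds (0 : Rn d), 2 * Real.pi * ‖y‖ / 2 ^ n < 1 / 2 := by
      have hc : Continuous fun y : Rn d => 2 * Real.pi * ‖y‖ / 2 ^ n := by fun_prop
      exact hc.continuousAt.eventually_lt continuousAt_const (by simp)
    refine (contDiffAt_const (c := (0 : ℂ))).congr_of_eventuallyEq ?_
    filter_upwards [h0] with y hy
    have : w (2 * Real.pi * ‖y‖ / 2 ^ n) = 0 := by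
      by_contra h
      exact absurd (hw.support_subset h).1 (not_le.mpr hy)
    simp [dyadicSymbol, this]
  · have h1 : ContDiffAt ℝ ∞ (fun y : Rn d => 2 * Real.pi * ‖y‖ / 2 ^ n) x :=
      (contDiffAt_const.mul (contDiffAt_norm ℝ hx)).div_const _
    exact Complex.ofRealCLM.contDiff.contDiffAt.comp x (hw.smooth.contDiffAt.comp x h1)

theorem dyadicSymbol_hasCompactSupport (d : ℕ) {w : ℝ → ℝ} (hw : IsDyadicWindow w) (n : ℤ) :
    HasCompactSupport (dyadicSymbol d w n) := by
  refine HasCompactSupport.intro (isCompact_closedBall (0 : Rn d) (2 * 2 ^ n)) ?_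
  intro x hx
  have h2 : (0 : ℝ) < 2 ^ n := by positivity
  have hx' : 2 * 2 ^ n < ‖x‖ := by simpa using hx
  have : w (2 * Real.pi * ‖x‖ / 2 ^ n) = 0 := by
    by_contra h
    have := (hw.support_subset h).2
    rw [div_le_iff₀ h2] at this
    nlinarith [Real.pi_gt_three, norm_nonneg x]
  simp [dyadicSymbol, this]

/-- The Schwartz function `W_n` whose Fourier transform is the `n`-th dyadic symbol. -/
def dyadicKernel (d : ℕ) {w : ℝ → ℝ} (hw : IsDyadicWindow w) (n : ℤ) : 𝓢(Rn d, ℂ) :=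
  𝓕⁻ ((dyadicSymbol_hasCompactSupport d hw n).toSchwartzMap (dyadicSymbol_contDiff d hw n))

/-- The convolution `F * φ` of a tempered distribution and a Schwartz function, the function
`x ↦ ⟨F, φ (x - ·)⟩`. -/
def distConv {d : ℕ} (F : 𝓢'(Rn d, ℂ)) (φ : 𝓢(Rn d, ℂ)) (x : Rn d) : ℂ :=
  F ((SchwartzMap.compCLMOfContinuousLinearEquiv ℂ (ContinuousLinearEquiv.neg ℝ) φ).compSubConstCLM
    ℂ x)

/-- The Littlewood--Paley piece `F_n = F * W_n`. -/
def dyadicPiece {d : ℕ} {w : ℝ → ℝ} (hw : IsDyadicWindow w) (F : 𝓢'(Rn d, ℂ)) (n : ℤ) :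
    Rn d → ℂ :=
  distConv F (dyadicKernel d hw n)

/-- `‖F‖_{B^1_{∞,1}} = ∑_{n ∈ ℤ} 2 ^ n ‖F_n‖_{L^∞}`, possibly infinite. -/
def besovNorm {d : ℕ} {w : ℝ → ℝ} (hw : IsDyadicWindow w) (F : 𝓢'(Rn d, ℂ)) : ℝ≥0∞ :=
  ∑' n : ℤ, (2 : ℝ≥0∞) ^ n * eLpNorm (dyadicPiece hw F n) ⊤ volume

/-- The modified homogeneous Besov class `B^1_{∞,1}(ℝ^d)`: the norm is finite and
`∂F/∂x_j = ∑_n ∂F_n/∂x_j` in the weak-* topology of the tempered distributions. -/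
structure MemBesov {d : ℕ} {w : ℝ → ℝ} (hw : IsDyadicWindow w) (F : 𝓢'(Rn d, ℂ)) : Prop where
  norm_ne_top : besovNorm hw F ≠ ⊤
  hasSum_deriv : ∀ (j : Fin d) (φ : 𝓢(Rn d, ℂ)),
    HasSum
      (fun n : ℤ => -∫ x, dyadicPiece hw F n x * (∂_{(EuclideanSpace.single j 1 : Rn d)} φ) x)
      ((∂_{(EuclideanSpace.single j 1 : Rn d)} F) φ)

/-- The tempered distribution `F` is the continuous function `f`. -/
structure IsContinuousFunction {d : ℕ} (F : 𝓢'(Rn d, ℂ)) (f : Rn d → ℂ) : Prop where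
  continuous : Continuous f
  integrable : ∀ φ : 𝓢(Rn d, ℂ), Integrable (fun x => f x * φ x)
  apply_eq : ∀ φ : 𝓢(Rn d, ℂ), F φ = ∫ x, f x * φ x

/-! ### Operators -/

section Operators

variable {H : Type*} [NormedAddCommGroup H] [InnerProductSpace ℂ H]

/-- `T` has rank at most `n`. -/
def RankLE (T : H →L[ℂ] H) (n : ℕ) : Prop :=
  LinearMap.rank (T : H →ₗ[ℂ] H) ≤ (n : Cardinal)

/-- The singular values `s_0 ≥ s_1 ≥ …` of a bounded operator on a Hilbert space: `s_n` is the
distance to the operators of rank at most `n`. -/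
def singularValue (T : H →L[ℂ] H) (n : ℕ) : ℝ≥0∞ :=
  ⨅ (R : H →L[ℂ] H) (_ : RankLE R n), ‖T - R‖ₑ

/-- The Schatten--von Neumann norm `‖T‖_{S_p}`, possibly infinite; `S_∞` has the operator norm. -/
def schattenNorm (p : ℝ≥0∞) (T : H →L[ℂ] H) : ℝ≥0∞ :=
  if p = ⊤ then ‖T‖ₑ else (∑' n : ℕ, singularValue T n ^ p.toReal) ^ (1 / p.toReal)

variable [CompleteSpace H]

/-- The spectral projection `E_A({a})` of a self-adjoint operator with finite spectrum: the
orthogonal projection onto `ker (A - a)`. -/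
def spectralProj (A : H →L[ℂ] H) (a : ℝ) : H →L[ℂ] H :=
  (A - (a : ℂ) • (1 : H →L[ℂ] H)).ker.starProjection

/-- `f(A, B) = ∑ f(a, b) E_A({a}) E_B({b})` for self-adjoint `A`, `B` with finite spectra. The terms
with `a` or `b` not an eigenvalue vanish, so that the sum is finite. -/
def pairFunction (f : Rn 2 → ℂ) (A B : H →L[ℂ] H) : H →L[ℂ] H :=
  ∑ᶠ ab : ℝ × ℝ, f !₂[ab.1, ab.2] • (spectralProj A ab.1 * spectralProj B ab.2)

end Operators

end

/-! Upper bound. In the Hilbert-Schmidt norm the estimate holds with no power of `N`, one argument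
at a time. Since `‖·‖_{S_p} ≤ ‖·‖_{S_2}` for `p ≥ 2` and `A₁ - A₂`, `B₁ - B₂` have rank at most
`2N`, Hölder's inequality for singular values then costs only `(2N)^{1/2-1/p}`.

For the `S_2` estimate let `e`, `g`, `h` be eigenbases of `A₁`, `A₂`, `B` with eigenvalues `α`, `γ`,
`β`. The entries of `f(A₁,B) - f(A₂,B)` are `∑_m (f(α_i,β_k) - f(γ_m,β_k)) ⟨e_i,g_m⟩⟨g_m,h_k⟩`. For
a Littlewood-Paley piece `f_n` the divided difference in the first variable is band-limited in `γ`,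
hence reproduced by convolution with a Schwartz kernel, and it decays like `1/|γ-α|`, hence is
square integrable. So it equals `∫ b(α_i,β_k,t) a(γ_m,t) dt` with `L²` bounds whose product is a
multiple of `2^n ‖f_n‖_∞` (`exists_hasDividedFactor`). Cauchy-Schwarz in `t` and unitarity of
`⟨g_m,h_k⟩` finish the estimate for one piece (`sum_norm_sq_integral_factor_le`). The pieces are
summed by `hasSum_dyadicPiece_sub`: `f` is the sum of its pieces up to constants, and constants
cancel in differences.

Lower bound. Translates of `W_0` placed on a sparse grid give functions in the Besov unit ball whose
increments `f(a_i,b_k) - f(a_i+δ,b_k)` are close to `θ_{ik} z` for arbitrary `|θ_{ik}| ≤ 1`, with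
`δ` and `z` independent of `N` (`exists_besov_increments`). Take `A₁` diagonal, `A₂ = A₁ + δ`, `B`
diagonal in the discrete Fourier basis, and let `θ` cancel the phases of the Fourier matrix. All
entries of the difference are then close to `z/√N`, so its norm is of order `√N`, while `‖A₁ -
A₂‖_{S_p}` is at most `N^{1/p} δ`. -/

noncomputable section

/-! ### Schatten norms of operators of finite rank -/

section Schatten

variable {H : Type*} [NormedAddCommGroup H] [InnerProductSpace ℂ H]

theorem RankLE.eq_zero {T : H →L[ℂ] H} (hT : RankLE T 0) : T = 0 := by
  have h : LinearMap.rank (T : H →ₗ[ℂ] H) = 0 := by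
    simpa [RankLE] using hT
  rw [LinearMap.rank, Submodule.rank_eq_zero, LinearMap.range_eq_bot] at h
  ext x
  simpa using congrArg (fun g : H →ₗ[ℂ] H => g x) h

theorem RankLE.sub {S T : H →L[ℂ] H} {m n : ℕ} (hS : RankLE S m) (hT : RankLE T n) :
    RankLE (S - T) (m + n) := by
  have h : ((S - T : H →L[ℂ] H) : H →ₗ[ℂ] H) = (S : H →ₗ[ℂ] H) + (-(T : H →ₗ[ℂ] H)) := by
    ext x; simp [sub_eq_add_neg]
  have hr : LinearMap.rank (-(T : H →ₗ[ℂ] H)) = LinearMap.rank (T : H →ₗ[ℂ] H) := by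
    unfold LinearMap.rank
    rw [LinearMap.range_neg]
  unfold RankLE
  rw [h]
  refine (LinearMap.rank_add_le _ _).trans ?_
  rw [hr]
  push_cast
  exact add_le_add hS hT

theorem RankLE.finite_range {T : H →L[ℂ] H} {n : ℕ} (hT : RankLE T n) :
    Module.Finite ℂ (LinearMap.range (T : H →ₗ[ℂ] H)) := by
  rw [← Module.rank_lt_aleph0_iff]
  exact lt_of_le_of_lt hT (Cardinal.natCast_lt_aleph0)

theorem singularValue_le_sub {T R : H →L[ℂ] H} {n : ℕ} (hR : RankLE R n) :
    singularValue T n ≤ ‖T - R‖ₑ :=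
  iInf₂_le R hR

theorem singularValue_eq_zero {T : H →L[ℂ] H} {m n : ℕ} (hT : RankLE T m) (hmn : m ≤ n) :
    singularValue T n = 0 := by
  have : RankLE T n := le_trans hT (by exact_mod_cast hmn)
  have h := singularValue_le_sub (T := T) this
  rw [sub_self, ← ofReal_norm, norm_zero, ENNReal.ofReal_zero] at h
  exact le_antisymm h bot_le

theorem rankLE_zero (n : ℕ) : RankLE (0 : H →L[ℂ] H) n := by
  simp [RankLE]

theorem singularValue_le_enorm (T : H →L[ℂ] H) (n : ℕ) : singularValue T n ≤ ‖T‖ₑ := by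
  simpa using singularValue_le_sub (T := T) (rankLE_zero n)

theorem singularValue_zero_index (T : H →L[ℂ] H) : singularValue T 0 = ‖T‖ₑ := by
  refine le_antisymm (singularValue_le_enorm T 0) (le_iInf₂ fun R hR => ?_)
  simp [hR.eq_zero]

theorem enorm_le_schattenNorm {p : ℝ≥0∞} (hp : 2 ≤ p) (T : H →L[ℂ] H) :
    ‖T‖ₑ ≤ schattenNorm p T := by
  unfold schattenNorm
  split_ifs with h
  · exact le_rfl
  · have hp0 : 0 < p.toReal := ENNReal.toReal_pos (by rintro rfl; simp at hp) h
    rw [← ENNReal.rpow_le_rpow_iff hp0, ← ENNReal.rpow_mul, one_div_mul_cancel hp0.ne',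
      ENNReal.rpow_one, ← singularValue_zero_index]
    exact ENNReal.le_tsum 0

theorem schattenNorm_le_rank_mul_enorm {p : ℝ≥0∞} (hp : 2 ≤ p) {T : H →L[ℂ] H} {n : ℕ}
    (hT : RankLE T n) : schattenNorm p T ≤ (n : ℝ≥0∞) ^ (1 / p.toReal) * ‖T‖ₑ := by
  unfold schattenNorm
  split_ifs with h
  -- Here `⊤.toReal = 0` and `1 / 0 = 0`, so the power of `n` is `1`, also for `n = 0`.
  · simp [h]
  · have hp0 : 0 < p.toReal := ENNReal.toReal_pos (by rintro rfl; simp at hp) h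
    rw [← ENNReal.rpow_le_rpow_iff hp0, ← ENNReal.rpow_mul, one_div_mul_cancel hp0.ne',
      ENNReal.rpow_one, ENNReal.mul_rpow_of_nonneg _ _ hp0.le, ← ENNReal.rpow_mul,
      one_div_mul_cancel hp0.ne', ENNReal.rpow_one,
      tsum_eq_sum (s := Finset.range n) fun k hk => by
        rw [singularValue_eq_zero hT (by simpa using hk), ENNReal.zero_rpow_of_pos hp0]]
    calc ∑ k ∈ Finset.range n, singularValue T k ^ p.toReal
        ≤ ∑ _k ∈ Finset.range n, ‖T‖ₑ ^ p.toReal :=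
          Finset.sum_le_sum fun k _ => ENNReal.rpow_le_rpow (singularValue_le_enorm T k) hp0.le
      _ = n * ‖T‖ₑ ^ p.toReal := by simp

theorem two_le_toReal {p : ℝ≥0∞} (hp : 2 ≤ p) (h : p ≠ ⊤) : 2 ≤ p.toReal := by
  simpa using ENNReal.toReal_mono h hp

theorem schattenNorm_two (T : H →L[ℂ] H) :
    schattenNorm 2 T = (∑' n : ℕ, singularValue T n ^ (2 : ℝ)) ^ (1 / 2 : ℝ) := by
  simp [schattenNorm]

/-- The inclusion of `ℓ²` in `ℓ^p`: every singular value is at most the `ℓ²` norm, so `p - 2` of the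
`p` factors are replaced by that norm. -/
theorem schattenNorm_le_schattenNorm_two {p : ℝ≥0∞} (hp : 2 ≤ p) (T : H →L[ℂ] H) :
    schattenNorm p T ≤ schattenNorm 2 T := by
  by_cases h : p = ⊤
  · have := enorm_le_schattenNorm le_rfl T
    simpa [schattenNorm, h] using this
  · have hp2 := two_le_toReal hp h
    have hp0 : 0 < p.toReal := by linarith
    rw [schattenNorm_two, schattenNorm, if_neg h]
    set S := ∑' n : ℕ, singularValue T n ^ (2 : ℝ) with hS
    rw [← ENNReal.rpow_le_rpow_iff hp0, ← ENNReal.rpow_mul, one_div_mul_cancel hp0.ne',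
      ENNReal.rpow_one, ← ENNReal.rpow_mul]
    have h1 : ∀ n, singularValue T n ≤ S ^ (1 / 2 : ℝ) := fun n => by
      rw [← ENNReal.rpow_le_rpow_iff (show (0 : ℝ) < 2 by norm_num), ← ENNReal.rpow_mul]
      norm_num
      rw [hS]
      simpa using ENNReal.le_tsum (f := fun n => singularValue T n ^ (2 : ℝ)) n
    calc ∑' n, singularValue T n ^ p.toReal
        = ∑' n, singularValue T n ^ (2 : ℝ) * singularValue T n ^ (p.toReal - 2) := by
          refine tsum_congr fun n => ?_
          rw [← ENNReal.rpow_add_of_nonneg _ _ (by norm_num) (by linarith)]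
          congr 1; ring
      _ ≤ ∑' n, singularValue T n ^ (2 : ℝ) * (S ^ (1 / 2 : ℝ)) ^ (p.toReal - 2) := by
          refine ENNReal.tsum_le_tsum fun n => mul_le_mul_right ?_ _
          exact ENNReal.rpow_le_rpow (h1 n) (by linarith)
      _ = S ^ (1 / 2 * p.toReal) := by
          rw [ENNReal.tsum_mul_right, ← hS, ← ENNReal.rpow_mul]
          nth_rw 1 [← ENNReal.rpow_one S]
          rw [← ENNReal.rpow_add_of_nonneg _ _ (by norm_num) (by linarith)]
          congr 1; ring

/-- Hölder's inequality with exponent `p / 2` for the squares of the at most `n` nonzero singular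
values. This is the only source of the power of `N` in the upper bound. -/
theorem schattenNorm_two_le_rank_mul {p : ℝ≥0∞} (hp : 2 ≤ p) {T : H →L[ℂ] H} {n : ℕ}
    (hT : RankLE T n) :
    schattenNorm 2 T ≤ (n : ℝ≥0∞) ^ ((1 : ℝ) / 2 - 1 / p.toReal) * schattenNorm p T := by
  by_cases h : p = ⊤
  · have := schattenNorm_le_rank_mul_enorm le_rfl hT
    simpa [schattenNorm, h] using this
  · have hp2 := two_le_toReal hp h
    have hp0 : 0 < p.toReal := by linarith
    have hsum : ∀ q : ℝ, 0 < q → ∑' k, singularValue T k ^ q =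
        ∑ k ∈ Finset.range n, singularValue T k ^ q := fun q hq =>
      tsum_eq_sum fun k hk => by
        rw [singularValue_eq_zero hT (by simpa using hk), ENNReal.zero_rpow_of_pos hq]
    rw [schattenNorm_two, schattenNorm, if_neg h, hsum _ two_pos, hsum _ hp0]
    have key := ENNReal.rpow_sum_le_const_mul_sum_rpow (Finset.range n)
      (fun k => singularValue T k ^ (2 : ℝ)) (p := p.toReal / 2) (by linarith)
    have key2 := ENNReal.rpow_le_rpow key (show 0 ≤ 1 / p.toReal by positivity)
    rw [ENNReal.mul_rpow_of_nonneg _ _ (by positivity), ← ENNReal.rpow_mul, ← ENNReal.rpow_mul,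
      Finset.card_range] at key2
    convert key2 using 2
    · field_simp
    · congr 1; field_simp
    · refine congrArg (· ^ (1 / p.toReal)) (Finset.sum_congr rfl fun k _ => ?_)
      rw [← ENNReal.rpow_mul]
      congr 1; ring

end Schatten

/-! ### Singular value decomposition and the Hilbert-Schmidt norm. -/

section SingularBasis

variable {H : Type*} [NormedAddCommGroup H] [InnerProductSpace ℂ H]

theorem norm_sum_smul_sq_of_orthogonal {ι : Type*} [DecidableEq ι] (s : Finset ι) (y : ι → H)
    (l : ι → ℝ) (hy : ∀ i j, inner ℂ (y i) (y j) = if i = j then (l i : ℂ) else 0) (c : ι → ℂ) :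
    ‖∑ i ∈ s, c i • y i‖ ^ 2 = ∑ i ∈ s, ‖c i‖ ^ 2 * l i := by
  have h : ((‖∑ i ∈ s, c i • y i‖ ^ 2 : ℝ) : ℂ) = ((∑ i ∈ s, ‖c i‖ ^ 2 * l i : ℝ) : ℂ) := by
    push_cast
    have := inner_self_eq_norm_sq_to_K (𝕜 := ℂ) (∑ i ∈ s, c i • y i)
    simp only [Complex.coe_algebraMap] at this
    rw [← this, sum_inner]
    refine Finset.sum_congr rfl fun i hi => ?_
    simp only [inner_sum, inner_smul_left, inner_smul_right, hy]
    simp only [mul_ite, mul_zero, Finset.sum_ite_eq, hi, if_true]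
    rw [← Complex.conj_mul']
    ring
  exact_mod_cast h

variable {K : Submodule ℂ H} [FiniteDimensional ℂ K]

/-- An operator vanishing on the orthogonal complement of a finite dimensional subspace maps some
orthonormal basis of that subspace to orthogonal vectors of decreasing length. -/
theorem exists_singularBasis [CompleteSpace H] (T : H →L[ℂ] H) :
    ∃ (v : OrthonormalBasis (Fin (Module.finrank ℂ K)) ℂ K)
      (l : Fin (Module.finrank ℂ K) → ℝ), Antitone l ∧
      ∀ i j, inner ℂ (T (v i)) (T (v j)) = if i = j then (l i : ℂ) else 0 := by
  let S : K →L[ℂ] H := T ∘L K.subtypeL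
  -- The basis consists of eigenvectors of `S* S`, and the decreasing eigenvalues are the squared
  -- lengths of the images.
  let Q : K →L[ℂ] K := S.adjoint ∘L S
  have hQ : (Q : K →ₗ[ℂ] K).IsSymmetric := by
    intro x y
    simp only [Q, ContinuousLinearMap.coe_coe, ContinuousLinearMap.comp_apply]
    rw [ContinuousLinearMap.adjoint_inner_left, ContinuousLinearMap.adjoint_inner_right]
  refine ⟨hQ.eigenvectorBasis rfl, hQ.eigenvalues rfl, hQ.eigenvalues_antitone rfl, fun i j => ?_⟩
  have h1 : inner ℂ (T (hQ.eigenvectorBasis rfl i)) (T (hQ.eigenvectorBasis rfl j)) =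
      inner ℂ (hQ.eigenvectorBasis rfl i) (Q (hQ.eigenvectorBasis rfl j)) := by
    simp only [Q, ContinuousLinearMap.comp_apply]
    rw [ContinuousLinearMap.adjoint_inner_right]
    rfl
  rw [h1]
  have h2 := hQ.apply_eigenvectorBasis rfl j
  simp only [ContinuousLinearMap.coe_coe] at h2
  rw [h2, inner_smul_right, orthonormal_iff_ite.1 (hQ.eigenvectorBasis rfl).orthonormal i j]
  split_ifs with h
  · subst h; simp
  · simp

theorem apply_eq_sum_of_orthogonal {T : H →L[ℂ] H} (hT : ∀ x ∈ Kᗮ, T x = 0) {ι : Type*}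
    [Fintype ι] (b : OrthonormalBasis ι ℂ K) (x : H) :
    T x = ∑ i, inner ℂ (b i : H) x • T (b i) := by
  have h1 : T x = T (K.starProjection x) := by
    have := hT _ (K.sub_starProjection_mem_orthogonal x)
    rw [map_sub, sub_eq_zero] at this
    exact this
  rw [h1, Submodule.starProjection_apply]
  conv_lhs => rw [← b.sum_repr (K.orthogonalProjectionOnto x)]
  simp only [Submodule.coe_sum, Submodule.coe_smul, map_sum, map_smul, b.repr_apply_apply]
  refine Finset.sum_congr rfl fun i _ => ?_
  congr 1
  rw [Submodule.coe_inner, ← Submodule.starProjection_apply,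
    ← Submodule.inner_starProjection_left_eq_right,
    Submodule.starProjection_eq_self_iff.2 (b i).2]

theorem rankLE_sum_rankOne {m : ℕ} (n : ℕ) (y : Fin m → H) (v : Fin m → H) :
    RankLE (∑ i ∈ Finset.univ.filter (fun i : Fin m => (i : ℕ) < n),
      (innerSL ℂ (v i)).smulRight (y i)) n := by
  classical
  set s := Finset.univ.filter (fun i : Fin m => (i : ℕ) < n) with hs
  have hcard : s.card ≤ n := by
    have : s.card ≤ (Finset.range n).card :=
      Finset.card_le_card_of_injOn (fun i => (i : ℕ)) (by intro i hi; simpa [hs] using hi)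
        (Fin.val_injective.injOn)
    simpa using this
  unfold RankLE LinearMap.rank
  have hle : LinearMap.range ((∑ i ∈ s, (innerSL ℂ (v i)).smulRight (y i) : H →L[ℂ] H) : H →ₗ[ℂ] H)
      ≤ Submodule.span ℂ ((s.image y : Finset H) : Set H) := by
    rintro _ ⟨x, rfl⟩
    simp only [ContinuousLinearMap.coe_coe, sum_apply]
    refine Submodule.sum_mem _ fun i hi => ?_
    simp only [ContinuousLinearMap.smulRight_apply]
    refine Submodule.smul_mem _ _ (Submodule.subset_span ?_)
    exact Finset.mem_coe.2 (Finset.mem_image_of_mem y hi)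
  refine (Submodule.rank_mono hle).trans ((rank_span_finset_le _).trans ?_)
  exact_mod_cast Finset.card_image_le.trans hcard

theorem exists_ne_zero_combination {R : H →L[ℂ] H} {n : ℕ} (hR : RankLE R n)
    {ι : Type*} [Fintype ι] (hι : n < Fintype.card ι) (v : ι → H) :
    ∃ c : ι → ℂ, c ≠ 0 ∧ R (∑ i, c i • v i) = 0 := by
  have := hR.finite_range
  let f : (ι → ℂ) →ₗ[ℂ] LinearMap.range (R : H →ₗ[ℂ] H) :=
    (R : H →ₗ[ℂ] H).rangeRestrict ∘ₗ Fintype.linearCombination ℂ v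
  have hdim : Module.finrank ℂ (LinearMap.range (R : H →ₗ[ℂ] H)) < Module.finrank ℂ (ι → ℂ) := by
    rw [Module.finrank_fintype_fun_eq_card]
    refine lt_of_le_of_lt ?_ hι
    exact Module.finrank_le_of_rank_le hR
  obtain ⟨c, hc, hc0⟩ := (Submodule.ne_bot_iff _).1
    (LinearMap.ker_ne_bot_of_finrank_lt (f := f) hdim)
  refine ⟨c, hc0, ?_⟩
  have := congrArg Subtype.val (LinearMap.mem_ker.1 hc)
  simpa [f, Fintype.linearCombination_apply] using this

/-- Truncating the expansion of `T` after `n` terms leaves an error of norm at most `‖T (v n)‖`.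
Conversely an operator of rank at most `n` kills a nonzero combination of `v 0, …, v n`, and `T`
stretches every such combination by at least `‖T (v n)‖`. -/
theorem singularValue_eq_of_orthogonal {T : H →L[ℂ] H} (hT : ∀ x ∈ Kᗮ, T x = 0) {m : ℕ}
    (v : OrthonormalBasis (Fin m) ℂ K) {l : Fin m → ℝ} (hl : Antitone l)
    (hv : ∀ i j, inner ℂ (T (v i)) (T (v j)) = if i = j then (l i : ℂ) else 0) (n : Fin m) :
    singularValue T n = ENNReal.ofReal ‖T (v n)‖ := by
  have hl' : ∀ i, ‖T (v i)‖ ^ 2 = l i := fun i => by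
    have := norm_sum_smul_sq_of_orthogonal {i} (fun i => T (v i)) l hv 1
    simpa using this
  have hvo : Orthonormal ℂ (fun i => (v i : H)) :=
    v.orthonormal.comp_linearIsometry K.subtypeₗᵢ
  apply le_antisymm
  · let R : H →L[ℂ] H := ∑ i ∈ Finset.univ.filter (fun i : Fin m => (i : ℕ) < n),
      (innerSL ℂ (v i : H)).smulRight (T (v i))
    have hR : RankLE R n := rankLE_sum_rankOne n _ _
    refine (singularValue_le_sub hR).trans ?_
    rw [← ofReal_norm]
    refine ENNReal.ofReal_le_ofReal (ContinuousLinearMap.opNorm_le_bound _ (norm_nonneg _) ?_)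
    intro x
    have hx : (T - R) x = ∑ i ∈ Finset.univ.filter (fun i : Fin m => ¬ (i : ℕ) < n),
        inner ℂ (v i : H) x • T (v i) := by
      rw [sub_apply, apply_eq_sum_of_orthogonal hT v x,
        ← Finset.sum_filter_add_sum_filter_not Finset.univ (fun i : Fin m => (i : ℕ) < n)]
      simp [R]
    rw [hx, ← pow_le_pow_iff_left₀ (norm_nonneg _) (by positivity) two_ne_zero,
      norm_sum_smul_sq_of_orthogonal _ (fun i => T (v i)) l hv, mul_pow, hl' n]
    calc ∑ i ∈ Finset.univ.filter (fun i : Fin m => ¬ (i : ℕ) < n),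
          ‖inner ℂ (v i : H) x‖ ^ 2 * l i
        ≤ ∑ i ∈ Finset.univ.filter (fun i : Fin m => ¬ (i : ℕ) < n),
          ‖inner ℂ (v i : H) x‖ ^ 2 * l n := by
          refine Finset.sum_le_sum fun i hi => ?_
          have : n ≤ i := by simpa using hi
          exact mul_le_mul_of_nonneg_left (hl this) (by positivity)
      _ = l n * ∑ i ∈ Finset.univ.filter (fun i : Fin m => ¬ (i : ℕ) < n),
          ‖inner ℂ (v i : H) x‖ ^ 2 := by rw [← Finset.sum_mul, mul_comm]
      _ ≤ l n * ‖x‖ ^ 2 :=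
          mul_le_mul_of_nonneg_left (hvo.sum_inner_products_le x) (hl' n ▸ by positivity)
  · refine le_iInf₂ fun R hR => ?_
    let ι : Fin (n + 1) → Fin m := Fin.castLE n.2
    have hι : Function.Injective ι := Fin.castLE_injective _
    obtain ⟨c, hc, hcR⟩ := exists_ne_zero_combination hR (ι := Fin (n + 1)) (by simp)
      (fun i => (v (ι i) : H))
    set u := ∑ i, c i • (v (ι i) : H) with hu
    have hu2 : ‖u‖ ^ 2 = ∑ i, ‖c i‖ ^ 2 := by
      have := norm_sum_smul_sq_of_orthogonal Finset.univ (fun i => (v (ι i) : H)) 1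
        (fun i j => by
          rw [orthonormal_iff_ite.1 hvo (ι i) (ι j)]
          simp [hι.eq_iff]) c
      simpa using this
    have hTu : ‖T u‖ ^ 2 = ∑ i, ‖c i‖ ^ 2 * l (ι i) := by
      rw [hu, map_sum]
      simp only [map_smul]
      exact norm_sum_smul_sq_of_orthogonal Finset.univ (fun i => T (v (ι i))) (fun i => l (ι i))
        (fun i j => by rw [hv]; simp [hι.eq_iff]) c
    have hupos : 0 < ‖u‖ := by
      obtain ⟨i, hi⟩ := Function.ne_iff.1 hc
      have : 0 < ∑ i, ‖c i‖ ^ 2 :=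
        Finset.sum_pos' (fun i _ => by positivity)
          ⟨i, Finset.mem_univ _, pow_pos (norm_pos_iff.2 hi) 2⟩
      rw [← hu2] at this
      exact (norm_nonneg u).lt_of_ne' fun h => by simp [h] at this
    have hle : ‖T (v n)‖ * ‖u‖ ≤ ‖T u‖ := by
      rw [← pow_le_pow_iff_left₀ (by positivity) (norm_nonneg _) two_ne_zero, mul_pow, hl' n, hu2,
        hTu, Finset.mul_sum]
      refine Finset.sum_le_sum fun i _ => ?_
      rw [mul_comm]
      refine mul_le_mul_of_nonneg_left (hl ?_) (by positivity)
      exact Fin.le_def.2 (Nat.lt_succ_iff.1 i.2)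
    rw [← ofReal_norm]
    refine ENNReal.ofReal_le_ofReal ?_
    have h3 : ‖T u‖ ≤ ‖T - R‖ * ‖u‖ := by
      have := (T - R).le_opNorm u
      rwa [sub_apply, hcR, sub_zero] at this
    exact le_of_mul_le_mul_right (hle.trans h3) hupos

/-- The trace makes the sum of squares independent of the basis, so that the singular basis may be
exchanged for an eigenbasis. -/
theorem sum_norm_sq_apply_eq_trace [CompleteSpace H] (T : H →L[ℂ] H) {ι : Type*} [Fintype ι]
    (b : OrthonormalBasis ι ℂ K) :
    ((∑ i, ‖T (b i)‖ ^ 2 : ℝ) : ℂ) = LinearMap.trace ℂ K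
      (((T ∘L K.subtypeL).adjoint ∘L (T ∘L K.subtypeL) : K →L[ℂ] K) : K →ₗ[ℂ] K) := by
  rw [LinearMap.trace_eq_sum_inner _ b]
  rw [Complex.ofReal_sum]
  refine Finset.sum_congr rfl fun i _ => ?_
  rw [Complex.ofReal_pow, ContinuousLinearMap.coe_coe, ContinuousLinearMap.comp_apply,
    ContinuousLinearMap.adjoint_inner_right, inner_self_eq_norm_sq_to_K]
  rfl

theorem sum_norm_sq_apply_eq [CompleteSpace H] (T : H →L[ℂ] H) {ι κ : Type*} [Fintype ι]
    [Fintype κ] (b : OrthonormalBasis ι ℂ K) (v : OrthonormalBasis κ ℂ K) :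
    ∑ i, ‖T (b i)‖ ^ 2 = ∑ j, ‖T (v j)‖ ^ 2 := by
  have := (sum_norm_sq_apply_eq_trace T b).trans (sum_norm_sq_apply_eq_trace T v).symm
  exact_mod_cast this

/-- The Hilbert-Schmidt norm. -/
theorem schattenNorm_two_eq [CompleteSpace H] {T : H →L[ℂ] H}
    (hT : ∀ x ∈ Kᗮ, T x = 0) {ι : Type*} [Fintype ι] (b : OrthonormalBasis ι ℂ K) :
    schattenNorm 2 T = ENNReal.ofReal √(∑ i, ‖T (b i)‖ ^ 2) := by
  obtain ⟨v, l, hl, hv⟩ := exists_singularBasis (K := K) T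
  have hrank : RankLE T (Module.finrank ℂ K) := by
    have := rankLE_sum_rankOne (Module.finrank ℂ K) (fun i => T (v i)) (fun i => (v i : H))
    convert this using 1
    ext x
    rw [apply_eq_sum_of_orthogonal hT v x]
    simp
  rw [schattenNorm_two, tsum_eq_sum (s := Finset.range (Module.finrank ℂ K)) fun k hk => by
    rw [singularValue_eq_zero hrank (by simpa using hk), ENNReal.zero_rpow_of_pos two_pos],
    Finset.sum_range, sum_norm_sq_apply_eq T b v, Real.sqrt_eq_rpow,
    ← ENNReal.ofReal_rpow_of_nonneg (by positivity) (by norm_num),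
    ENNReal.ofReal_sum_of_nonneg fun _ _ => by positivity]
  congr 1
  refine Finset.sum_congr rfl fun i _ => ?_
  rw [singularValue_eq_of_orthogonal hT v hl hv i,
    ENNReal.ofReal_rpow_of_nonneg (norm_nonneg _) (by norm_num)]
  norm_num

end SingularBasis

/-! ### Functions of two noncommuting operators and their matrix entries. -/

section PairFunction

variable {H : Type*} [NormedAddCommGroup H] [InnerProductSpace ℂ H]

theorem mem_ker_sub_smul {A : H →L[ℂ] H} {a : ℝ} {u : H} :
    u ∈ (A - (a : ℂ) • (1 : H →L[ℂ] H)).ker ↔ A u = (a : ℂ) • u := by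
  rw [LinearMap.mem_ker]
  simp [sub_eq_zero]

variable {K : Submodule ℂ H}

theorem sum_inner_mul_inner_coe {ι : Type*} [Fintype ι] (g : OrthonormalBasis ι ℂ K) {x : H}
    (hx : x ∈ K) (y : H) :
    ∑ i, inner ℂ x (g i : H) * inner ℂ (g i : H) y = inner ℂ x y := by
  have h := congrArg (fun z : K => inner ℂ (z : H) y) (g.sum_repr ⟨x, hx⟩)
  simp only [Submodule.coe_sum, Submodule.coe_smul, sum_inner, inner_smul_left,
    g.repr_apply_apply, Submodule.coe_inner, inner_conj_symm] at h
  exact h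

theorem sum_norm_inner_sq_coe {ι : Type*} [Fintype ι] (g : OrthonormalBasis ι ℂ K) {x : H}
    (hx : x ∈ K) : ∑ i, ‖inner ℂ (g i : H) x‖ ^ 2 = ‖x‖ ^ 2 := by
  have := g.sum_sq_norm_inner_right ⟨x, hx⟩
  simpa [Submodule.coe_inner] using this

variable [CompleteSpace H]

theorem spectralProj_apply_of_eigen {A : H →L[ℂ] H} {a : ℝ} {u : H} (hu : A u = (a : ℂ) • u) :
    spectralProj A a u = u :=
  Submodule.starProjection_eq_self_iff.2 (mem_ker_sub_smul.2 hu)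

theorem spectralProj_apply_of_ne {A : H →L[ℂ] H} (hA : IsSelfAdjoint A) {a b : ℝ} {u : H}
    (hu : A u = (a : ℂ) • u) (hab : b ≠ a) : spectralProj A b u = 0 := by
  refine (Submodule.starProjection_apply_eq_zero_iff _).2 ((Submodule.mem_orthogonal _ _).2 ?_)
  intro v hv
  rw [mem_ker_sub_smul] at hv
  have h1 : inner ℂ (A v) u = inner ℂ v (A u) := by
    rw [← ContinuousLinearMap.adjoint_inner_right, hA.adjoint_eq]
  rw [hv, hu, inner_smul_left, inner_smul_right, Complex.conj_ofReal] at h1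
  have h2 : ((b : ℂ) - a) * inner ℂ v u = 0 := by rw [sub_mul, h1, sub_self]
  refine (mul_eq_zero.1 h2).resolve_left (sub_ne_zero.2 ?_)
  exact_mod_cast hab

theorem spectralProj_inner {A : H →L[ℂ] H} (a : ℝ) (u v : H) :
    inner ℂ u (spectralProj A a v) = inner ℂ (spectralProj A a u) v :=
  (Submodule.inner_starProjection_left_eq_right _ u v).symm

/-- Eigenvectors for nonzero eigenvalues lie in the range of `A`, which is finite dimensional. -/
theorem finite_spectralProj_ne_zero {A : H →L[ℂ] H} {n : ℕ} (hA : RankLE A n) :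
    {a : ℝ | spectralProj A a ≠ 0}.Finite := by
  have hfin := hA.finite_range
  let A' : Module.End ℂ (LinearMap.range (A : H →ₗ[ℂ] H)) :=
    (A : H →ₗ[ℂ] H).restrict fun x _ => LinearMap.mem_range_self _ x
  have h1 : {z : ℂ | A'.HasEigenvalue z}.Finite := Module.End.finite_hasEigenvalue A'
  refine ((h1.preimage (Complex.ofReal_injective.injOn)).union (Set.finite_singleton 0)).subset ?_
  intro a ha
  by_cases h0 : a = 0
  · exact Or.inr h0
  refine Or.inl ?_
  have hker : (A - (a : ℂ) • (1 : H →L[ℂ] H)).ker ≠ ⊥ := by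
    intro h
    refine ha ?_
    unfold spectralProj
    ext x
    have : (A - (a : ℂ) • (1 : H →L[ℂ] H)).ker.starProjection x ∈
      (A - (a : ℂ) • (1 : H →L[ℂ] H)).ker := Submodule.starProjection_apply_mem _ x
    exact (Submodule.eq_bot_iff _).1 h _ this
  obtain ⟨v, hv, hv0⟩ := (Submodule.ne_bot_iff _).1 hker
  rw [mem_ker_sub_smul] at hv
  have ha0 : (a : ℂ) ≠ 0 := by exact_mod_cast h0
  have hvr : v ∈ LinearMap.range (A : H →ₗ[ℂ] H) :=
    ⟨(a : ℂ)⁻¹ • v, by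
      rw [map_smul, ContinuousLinearMap.coe_coe, hv, smul_smul, inv_mul_cancel₀ ha0, one_smul]⟩
  refine Module.End.hasEigenvalue_of_hasEigenvector (x := ⟨v, hvr⟩) ?_
  rw [Module.End.hasEigenvector_iff, Module.End.mem_eigenspace_iff]
  refine ⟨Subtype.ext ?_, fun h => hv0 (congrArg Subtype.val h)⟩
  simpa [A'] using hv

/-- The points `a` and `b` are put into the index sets so that the sums can be collapsed onto them
without checking that they are eigenvalues. -/
theorem pairFunction_eq_sum (f : Rn 2 → ℂ) {A B : H →L[ℂ] H} {m n : ℕ} (hA : RankLE A m)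
    (hB : RankLE B n) (a b : ℝ) : ∃ s t : Finset ℝ, a ∈ s ∧ b ∈ t ∧
      pairFunction f A B =
        ∑ x ∈ s, ∑ y ∈ t, f !₂[x, y] • (spectralProj A x * spectralProj B y) := by
  classical
  refine ⟨insert a (finite_spectralProj_ne_zero hA).toFinset,
    insert b (finite_spectralProj_ne_zero hB).toFinset, Finset.mem_insert_self _ _,
    Finset.mem_insert_self _ _, ?_⟩
  rw [← Finset.sum_product', pairFunction]
  refine finsum_eq_sum_of_support_subset _ ?_
  rintro ⟨x, y⟩ hxy
  have hx : spectralProj A x ≠ 0 := fun h => hxy (by simp [h])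
  have hy : spectralProj B y ≠ 0 := fun h => hxy (by simp [h])
  simp [hx, hy]

theorem pairFunction_apply_of_eigen (f : Rn 2 → ℂ) {A B : H →L[ℂ] H} {m n : ℕ} (hA : RankLE A m)
    (hB : RankLE B n) (hA' : IsSelfAdjoint A) (hB' : IsSelfAdjoint B) {a b : ℝ} {v : H}
    (hva : A v = (a : ℂ) • v) (hvb : B v = (b : ℂ) • v) :
    pairFunction f A B v = f !₂[a, b] • v := by
  obtain ⟨s, t, ha, hb, h⟩ := pairFunction_eq_sum f hA hB a b
  rw [h]
  simp only [sum_apply, smul_apply, mul_apply_eq_comp]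
  rw [Finset.sum_eq_single_of_mem a ha, Finset.sum_eq_single_of_mem b hb]
  · rw [spectralProj_apply_of_eigen hvb, spectralProj_apply_of_eigen hva]
  · intro y _ hy
    rw [spectralProj_apply_of_ne hB' hvb hy, map_zero, smul_zero]
  · intro x _ hx
    refine Finset.sum_eq_zero fun y _ => ?_
    by_cases hy : y = b
    · rw [hy, spectralProj_apply_of_eigen hvb, spectralProj_apply_of_ne hA' hva hx, smul_zero]
    · rw [spectralProj_apply_of_ne hB' hvb hy, map_zero, smul_zero]

/-- Between an eigenbasis of `A` and one of `B`, passing to `f(A, B)` is a Schur product with the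
values of `f`. Both bounds of the theorem are read off from this. -/
theorem inner_pairFunction (f : Rn 2 → ℂ) {A B : H →L[ℂ] H} {m n : ℕ} (hA : RankLE A m)
    (hB : RankLE B n) (hA' : IsSelfAdjoint A) (hB' : IsSelfAdjoint B) {a b : ℝ} {u v : H}
    (hu : A u = (a : ℂ) • u) (hv : B v = (b : ℂ) • v) :
    inner ℂ u (pairFunction f A B v) = f !₂[a, b] * inner ℂ u v := by
  obtain ⟨s, t, ha, hb, h⟩ := pairFunction_eq_sum f hA hB a b
  rw [h]
  simp only [sum_apply, smul_apply, mul_apply_eq_comp, inner_sum, inner_smul_right,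
    spectralProj_inner (A := A)]
  rw [Finset.sum_eq_single_of_mem a ha, Finset.sum_eq_single_of_mem b hb]
  · rw [spectralProj_apply_of_eigen hv, spectralProj_apply_of_eigen hu]
  · intro y _ hy
    rw [spectralProj_apply_of_ne hB' hv hy, inner_zero_right, mul_zero]
  · intro x _ hx
    refine Finset.sum_eq_zero fun y _ => ?_
    rw [spectralProj_apply_of_ne hA' hu hx, inner_zero_left, mul_zero]

theorem exists_eigenbasis [FiniteDimensional ℂ K] {A : H →L[ℂ] H}
    (hA : IsSelfAdjoint A) (hK : ∀ x, A x ∈ K) :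
    ∃ (e : OrthonormalBasis (Fin (Module.finrank ℂ K)) ℂ K) (a : Fin (Module.finrank ℂ K) → ℝ),
      ∀ i, A (e i) = (a i : ℂ) • (e i : H) := by
  let A' : K →ₗ[ℂ] K := (A : H →ₗ[ℂ] H).restrict fun x _ => hK x
  have hA' : A'.IsSymmetric := by
    intro x y
    change inner ℂ (A x) (y : H) = inner ℂ (x : H) (A y)
    rw [← ContinuousLinearMap.adjoint_inner_right, hA.adjoint_eq]
  refine ⟨hA'.eigenvectorBasis rfl, hA'.eigenvalues rfl, fun i => ?_⟩
  exact congrArg Subtype.val (hA'.apply_eigenvectorBasis rfl i)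

theorem apply_eq_zero_of_mem_orthogonal {A : H →L[ℂ] H} (hA : IsSelfAdjoint A)
    (hK : ∀ x, A x ∈ K) {v : H} (hv : v ∈ Kᗮ) : A v = 0 := by
  rw [← inner_self_eq_zero (𝕜 := ℂ), ← ContinuousLinearMap.adjoint_inner_right, hA.adjoint_eq]
  exact Submodule.inner_left_of_mem_orthogonal (hK _) hv

/-- Both operators vanish on `Kᗮ`. The scalar `f(0, 0)` is the same for all pairs and cancels in
differences, which reduces everything to `K`. -/
theorem pairFunction_apply_of_mem_orthogonal (f : Rn 2 → ℂ) {A B : H →L[ℂ] H} {m n : ℕ}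
    (hA : RankLE A m) (hB : RankLE B n) (hA' : IsSelfAdjoint A) (hB' : IsSelfAdjoint B)
    (hAK : ∀ x, A x ∈ K) (hBK : ∀ x, B x ∈ K) {v : H} (hv : v ∈ Kᗮ) :
    pairFunction f A B v = f !₂[0, 0] • v :=
  pairFunction_apply_of_eigen f hA hB hA' hB'
    (by simp [apply_eq_zero_of_mem_orthogonal hA' hAK hv])
    (by simp [apply_eq_zero_of_mem_orthogonal hB' hBK hv])

theorem pairFunction_apply_mem [FiniteDimensional ℂ K] (f : Rn 2 → ℂ) {A B : H →L[ℂ] H} {m n : ℕ}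
    (hA : RankLE A m) (hB : RankLE B n) (hA' : IsSelfAdjoint A) (hB' : IsSelfAdjoint B)
    (hAK : ∀ x, A x ∈ K) {b : ℝ} {v : H} (hvb : B v = (b : ℂ) • v) (hv : v ∈ K) :
    pairFunction f A B v ∈ K := by
  rw [← Submodule.orthogonal_orthogonal K, Submodule.mem_orthogonal]
  intro u hu
  rw [inner_pairFunction f hA hB hA' hB' (a := 0)
    (by simp [apply_eq_zero_of_mem_orthogonal hA' hAK hu]) hvb,
    Submodule.inner_left_of_mem_orthogonal hv hu, mul_zero]

end PairFunction

/-! ### Hilbert-Schmidt estimates for Schur multipliers that factor through `L²`. -/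

section Schur

theorem norm_integral_mul_sq_le {α : Type*} [MeasurableSpace α] {μ : Measure α} {f g : α → ℂ}
    (hf : MemLp f 2 μ) (hg : MemLp g 2 μ) :
    ‖∫ t, f t * g t ∂μ‖ ^ 2 ≤ (∫ t, ‖f t‖ ^ 2 ∂μ) * ∫ t, ‖g t‖ ^ 2 ∂μ := by
  have hpq : (2 : ℝ).HolderConjugate 2 := by constructor <;> norm_num
  have h := integral_mul_norm_le_Lp_mul_Lq hpq (μ := μ) (f := f) (g := g) (by simpa using hf)
    (by simpa using hg)
  have h1 : ‖∫ t, f t * g t ∂μ‖ ≤ ∫ t, ‖f t‖ * ‖g t‖ ∂μ := by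
    refine (norm_integral_le_integral_norm _).trans_eq ?_
    simp
  have h2 := h1.trans h
  simp only [Real.rpow_two, ← Real.sqrt_eq_rpow] at h2
  calc ‖∫ t, f t * g t ∂μ‖ ^ 2 ≤ (√(∫ t, ‖f t‖ ^ 2 ∂μ) * √(∫ t, ‖g t‖ ^ 2 ∂μ)) ^ 2 := by gcongr
    _ = _ := by
      rw [mul_pow, Real.sq_sqrt (integral_nonneg fun _ => by positivity),
        Real.sq_sqrt (integral_nonneg fun _ => by positivity)]

variable {ι κ ν : Type*} [Fintype ι] [Fintype κ] [Fintype ν]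

/-- A Schur multiplier type estimate for arrays whose symbol factors through `L²`. -/
theorem sum_norm_sq_integral_factor_le {α : Type*} [MeasurableSpace α] {μ : Measure α}
    (X : ι → ν → ℂ) (G : ν → κ → ℂ)
    (hG : ∀ c : ν → ℂ, ∑ k, ‖∑ m, c m * G m k‖ ^ 2 = ∑ m, ‖c m‖ ^ 2)
    (a : ν → α → ℂ) (b : ι → κ → α → ℂ) (ha : ∀ m, MemLp (a m) 2 μ)
    (hb : ∀ i k, MemLp (b i k) 2 μ) {Ma Mb : ℝ} (hMa : ∀ m, ∫ t, ‖a m t‖ ^ 2 ∂μ ≤ Ma)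
    (hMb : ∀ i k, ∫ t, ‖b i k t‖ ^ 2 ∂μ ≤ Mb) (hMb0 : 0 ≤ Mb) :
    ∑ i, ∑ k, ‖∑ m, (∫ t, b i k t * a m t ∂μ) * X i m * G m k‖ ^ 2 ≤
      Mb * Ma * ∑ i, ∑ m, ‖X i m‖ ^ 2 := by
  -- Cauchy-Schwarz in `t` is applied for fixed `i`, `k` with the whole sum over `m` kept in one
  -- factor. This is why `b` may depend on `k` as well as on `i`.
  let φ : ι → κ → α → ℂ := fun i k t => ∑ m, a m t * X i m * G m k
  have hφ : ∀ i k, MemLp (φ i k) 2 μ := fun i k =>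
    memLp_finsetSum _ fun m _ => ((ha m).mul_const _).mul_const _
  have h1 : ∀ i k, ∑ m, (∫ t, b i k t * a m t ∂μ) * X i m * G m k = ∫ t, b i k t * φ i k t ∂μ := by
    intro i k
    simp only [φ, Finset.mul_sum]
    rw [integral_finsetSum]
    · refine Finset.sum_congr rfl fun m _ => ?_
      rw [mul_assoc, ← integral_mul_const]
      congr 1; ext t; ring
    · intro m _
      exact (hb i k).integrable_mul (((ha m).mul_const _).mul_const _)
  have hsq : ∀ i k, Integrable (fun t => ‖φ i k t‖ ^ 2) μ := fun i k => (hφ i k).integrable_norm_pow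
    two_ne_zero
  have hsqa : ∀ m, Integrable (fun t => ‖a m t‖ ^ 2) μ := fun m => (ha m).integrable_norm_pow
    two_ne_zero
  calc ∑ i, ∑ k, ‖∑ m, (∫ t, b i k t * a m t ∂μ) * X i m * G m k‖ ^ 2
      ≤ ∑ i, ∑ k, Mb * ∫ t, ‖φ i k t‖ ^ 2 ∂μ := by
        refine Finset.sum_le_sum fun i _ => Finset.sum_le_sum fun k _ => ?_
        rw [h1]
        exact (norm_integral_mul_sq_le (hb i k) (hφ i k)).trans
          (mul_le_mul_of_nonneg_right (hMb i k) (integral_nonneg fun _ => by positivity))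
    _ = Mb * ∑ i, ∫ t, ∑ k, ‖φ i k t‖ ^ 2 ∂μ := by
        rw [Finset.mul_sum]
        refine Finset.sum_congr rfl fun i _ => ?_
        rw [← Finset.mul_sum, integral_finsetSum _ fun k _ => hsq i k]
    _ = Mb * ∑ i, ∑ m, (∫ t, ‖a m t‖ ^ 2 ∂μ) * ‖X i m‖ ^ 2 := by
        congr 1
        refine Finset.sum_congr rfl fun i _ => ?_
        -- For fixed `i` and `t` the isometry `hG` removes the sum over `k`.
        simp only [φ, hG, norm_mul, mul_pow]
        rw [integral_finsetSum _ fun m _ => (hsqa m).mul_const _]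
        simp only [integral_mul_const]
    _ ≤ Mb * ∑ i, ∑ m, Ma * ‖X i m‖ ^ 2 := by
        gcongr with i _ m _
        exact hMa m
    _ = _ := by simp only [← Finset.mul_sum, mul_assoc]

/-- `f(x₁, y) - f(x₂, y) = (x₁ - x₂) ∫ b(x₁, y, t) a(x₂, t) dt` with `L²` bounds on `a`, `b`; the
function `F` below stands for `f` in either order of its arguments. -/
def HasDividedFactor (F : ℝ → ℝ → ℂ) (M : ℝ) : Prop :=
  ∃ (a : ℝ → ℝ → ℂ) (b : ℝ → ℝ → ℝ → ℂ), (∀ x, MemLp (a x) 2) ∧ (∀ x y, MemLp (b x y) 2) ∧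
    (∀ x, ∫ t, ‖a x t‖ ^ 2 ≤ 1) ∧ (∀ x y, ∫ t, ‖b x y t‖ ^ 2 ≤ M ^ 2) ∧
    ∀ x₁ x₂ y, F x₁ y - F x₂ y = (x₁ - x₂) * ∫ t, b x₁ y t * a x₂ t

/-- In the application `Y` is the transition matrix between the eigenbases of two operators and `X`
is the matrix of their difference; the factor `α i - γ m` of the divided difference turns `Y` into
`X`. -/
theorem HasDividedFactor.sum_norm_sq_le {F : ℝ → ℝ → ℂ} {M : ℝ} (hF : HasDividedFactor F M)
    (α : ι → ℝ) (γ : ν → ℝ) (β : κ → ℝ) (X Y : ι → ν → ℂ)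
    (hXY : ∀ i m, X i m = (α i - γ m) * Y i m) (G : ν → κ → ℂ)
    (hG : ∀ c : ν → ℂ, ∑ k, ‖∑ m, c m * G m k‖ ^ 2 = ∑ m, ‖c m‖ ^ 2) :
    ∑ i, ∑ k, ‖∑ m, (F (α i) (β k) - F (γ m) (β k)) * Y i m * G m k‖ ^ 2 ≤
      M ^ 2 * ∑ i, ∑ m, ‖X i m‖ ^ 2 := by
  obtain ⟨a, b, ha, hb, hMa, hMb, h⟩ := hF
  have := sum_norm_sq_integral_factor_le X G hG (fun m => a (γ m)) (fun i k => b (α i) (β k))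
    (fun m => ha _) (fun i k => hb _ _) (fun m => hMa _) (fun i k => hMb _ _) (by positivity)
  rw [mul_one] at this
  refine le_of_eq_of_le ?_ this
  refine Finset.sum_congr rfl fun i _ => Finset.sum_congr rfl fun k _ => ?_
  congr 2
  refine Finset.sum_congr rfl fun m _ => ?_
  rw [h, hXY]; ring

/-- The triangle inequality in the Euclidean space of matrices. There are finitely many entries, so
entrywise convergence suffices. -/
theorem sqrt_sum_norm_sq_le_of_hasSum {τ : Type*} {F : ℝ → ℝ → ℂ} (Fn : τ → ℝ → ℝ → ℂ) (Mn : τ → ℝ)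
    (hM0 : ∀ n, 0 ≤ Mn n) (hM : Summable Mn) (hFn : ∀ n, HasDividedFactor (Fn n) (Mn n))
    (hF : ∀ x₁ x₂ y, HasSum (fun n => Fn n x₁ y - Fn n x₂ y) (F x₁ y - F x₂ y))
    (α : ι → ℝ) (γ : ν → ℝ) (β : κ → ℝ) (X Y : ι → ν → ℂ)
    (hXY : ∀ i m, X i m = (α i - γ m) * Y i m) (G : ν → κ → ℂ)
    (hG : ∀ c : ν → ℂ, ∑ k, ‖∑ m, c m * G m k‖ ^ 2 = ∑ m, ‖c m‖ ^ 2) :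
    √(∑ i, ∑ k, ‖∑ m, (F (α i) (β k) - F (γ m) (β k)) * Y i m * G m k‖ ^ 2) ≤
      (∑' n, Mn n) * √(∑ i, ∑ m, ‖X i m‖ ^ 2) := by
  let V : (ℝ → ℝ → ℂ) → EuclideanSpace ℂ (ι × κ) := fun F =>
    WithLp.toLp 2 fun ik => ∑ m, (F (α ik.1) (β ik.2) - F (γ m) (β ik.2)) * Y ik.1 m * G m ik.2
  have hV : ∀ F : ℝ → ℝ → ℂ, ‖V F‖ =
      √(∑ i, ∑ k, ‖∑ m, (F (α i) (β k) - F (γ m) (β k)) * Y i m * G m k‖ ^ 2) := fun F => by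
    rw [EuclideanSpace.norm_eq, Fintype.sum_prod_type]
  have hs : HasSum (fun n => V (Fn n)) (V F) := by
    have h2 : HasSum (fun n => WithLp.ofLp (V (Fn n))) (WithLp.ofLp (V F)) := by
      rw [Pi.hasSum]
      intro ik
      exact hasSum_sum fun m _ => ((hF _ _ _).mul_right _).mul_right _
    have := h2.mapL ((EuclideanSpace.equiv (ι × κ) ℂ).symm :
      (ι × κ → ℂ) →L[ℂ] EuclideanSpace ℂ (ι × κ))
    exact this
  rw [← hV, ← hs.tsum_eq, ← tsum_mul_right]
  refine tsum_of_norm_bounded (hM.mul_right _).hasSum fun n => ?_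
  rw [hV, ← Real.sqrt_sq (hM0 n), ← Real.sqrt_mul (sq_nonneg _)]
  exact Real.sqrt_le_sqrt ((hFn n).sum_norm_sq_le α γ β X Y hXY G hG)

end Schur

/-! ### Divided differences of band-limited functions on the line. -/

section Reproducing

theorem integrable_prod_of_bound {α β : Type*} [MeasurableSpace α] [MeasurableSpace β]
    {μ : Measure α} {ν : Measure β} [IsFiniteMeasure μ] [SFinite ν] {f : α × β → ℂ}
    (hf : StronglyMeasurable f) (h1 : ∀ x, Integrable (fun y => f (x, y)) ν) {C : ℝ}
    (h2 : ∀ x, ∫ y, ‖f (x, y)‖ ∂ν ≤ C) : Integrable f (μ.prod ν) := by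
  rw [integrable_prod_iff hf.aestronglyMeasurable]
  refine ⟨Filter.Eventually.of_forall h1, ?_⟩
  refine (integrable_const C).mono' ?_ (Filter.Eventually.of_forall fun x => ?_)
  · exact (hf.norm.integral_prod_right (ν := ν)).aestronglyMeasurable
  · rw [Real.norm_of_nonneg (integral_nonneg fun _ => norm_nonneg _)]
    exact h2 x

variable (K : 𝓢(ℝ, ℂ))

/-- `g` and its contractions are reproduced by convolution with `K`. -/
structure IsReproduced (g : ℝ → ℂ) (M : ℝ) : Prop where
  measurable : Measurable g
  bound : ∀ s, ‖g s‖ ≤ M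
  integral_eq : ∀ θ ∈ Set.Icc (0 : ℝ) 1, ∀ c s, ∫ r, g (c + θ * (s - r)) * K r = g (c + θ * s)

/-- The derivative of a reproduced function. -/
def reproducedDeriv (g : ℝ → ℂ) (u : ℝ) : ℂ := ∫ t, g (u - t) * deriv K t

/-- The divided difference of a reproduced function. -/
def reproducedDivDiff (g : ℝ → ℂ) (x s : ℝ) : ℂ :=
  ∫ θ in (0 : ℝ)..1, reproducedDeriv K g (x + θ * (s - x))

theorem integrable_deriv_schwartz : Integrable (deriv K) :=
  (SchwartzMap.derivCLM ℂ ℂ K).integrable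

theorem continuous_deriv_schwartz : Continuous (deriv K) :=
  (SchwartzMap.derivCLM ℂ ℂ K).continuous

namespace IsReproduced

variable {K} {g : ℝ → ℂ} {M : ℝ}

theorem stronglyMeasurable_deriv (hg : IsReproduced K g M) :
    StronglyMeasurable (reproducedDeriv K g) := by
  have h : StronglyMeasurable fun p : ℝ × ℝ => g (p.1 - p.2) * deriv K p.2 :=
    ((hg.measurable.comp (measurable_fst.sub measurable_snd)).mul
      ((continuous_deriv_schwartz K).measurable.comp measurable_snd)).stronglyMeasurable
  exact h.integral_prod_right

theorem norm_deriv_le (hg : IsReproduced K g M) (u : ℝ) :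
    ‖reproducedDeriv K g u‖ ≤ M * ∫ t, ‖deriv K t‖ := by
  rw [← integral_const_mul]
  refine norm_integral_le_of_norm_le ((integrable_deriv_schwartz K).norm.const_mul M)
    (Filter.Eventually.of_forall fun t => ?_)
  rw [norm_mul]
  exact mul_le_mul_of_nonneg_right (hg.bound _) (norm_nonneg _)

theorem eq_integral (hg : IsReproduced K g M) (s : ℝ) : g s = ∫ t, g t * K (s - t) := by
  have h := hg.integral_eq 1 ⟨zero_le_one, le_rfl⟩ 0 s
  simp only [one_mul, zero_add] at h
  rw [← h, ← integral_sub_left_eq_self _ volume s]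
  simp

/-- Since `g = g * K`, the function `g * K'` is its derivative: the fundamental theorem of calculus
is applied to `K` and the integrals are interchanged. -/
theorem sub_eq_integral_deriv (hg : IsReproduced K g M) (x s : ℝ) :
    g s - g x = ∫ u in x..s, reproducedDeriv K g u := by
  have hm : StronglyMeasurable fun p : ℝ × ℝ => g p.2 * deriv K (p.1 - p.2) :=
    ((hg.measurable.comp measurable_snd).mul
      ((continuous_deriv_schwartz K).measurable.comp
        (measurable_fst.sub measurable_snd))).stronglyMeasurable
  have hK' : ∀ u, Integrable fun t => deriv K (u - t) := fun u =>
    (integrable_deriv_schwartz K).comp_sub_left u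
  have hi : ∀ u, Integrable fun t => g t * deriv K (u - t) := fun u =>
    (hK' u).bdd_mul hg.measurable.aestronglyMeasurable (Filter.Eventually.of_forall hg.bound)
  have hb : ∀ u, ∫ t, ‖g t * deriv K (u - t)‖ ≤ M * ∫ t, ‖deriv K t‖ := by
    intro u
    rw [← integral_sub_left_eq_self (fun t => ‖deriv K t‖) volume u, ← integral_const_mul]
    refine integral_mono (hi u).norm ((hK' u).norm.const_mul M) fun t => ?_
    rw [norm_mul]
    exact mul_le_mul_of_nonneg_right (hg.bound _) (norm_nonneg _)
  have hKi : ∀ s, Integrable fun t => g t * K (s - t) := fun s =>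
    (K.integrable.comp_sub_left s).bdd_mul hg.measurable.aestronglyMeasurable
      (Filter.Eventually.of_forall hg.bound)
  calc g s - g x = ∫ t, (g t * K (s - t) - g t * K (x - t)) := by
        rw [integral_sub (hKi s) (hKi x), ← hg.eq_integral, ← hg.eq_integral]
    _ = ∫ t, ∫ u in x..s, g t * deriv K (u - t) := by
        congr 1; ext t
        rw [intervalIntegral.integral_const_mul, ← mul_sub]
        congr 1
        rw [intervalIntegral.integral_comp_sub_right (fun u => deriv K u) t]
        rw [intervalIntegral.integral_deriv_eq_sub (fun y _ => K.differentiableAt)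
          ((continuous_deriv_schwartz K).intervalIntegrable _ _)]
    _ = ∫ u in x..s, ∫ t, g t * deriv K (u - t) := by
        rw [intervalIntegral_integral_swap]
        have : IsFiniteMeasure (volume.restrict (Set.uIoc x s)) := by
          unfold Set.uIoc; infer_instance
        exact integrable_prod_of_bound hm hi hb
    _ = ∫ u in x..s, reproducedDeriv K g u := by
        congr 1; ext u
        rw [reproducedDeriv, ← integral_sub_left_eq_self _ volume u]
        simp

theorem integral_deriv_mul (hg : IsReproduced K g M) {θ : ℝ} (hθ : θ ∈ Set.Icc (0 : ℝ) 1)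
    (c s : ℝ) :
    ∫ r, reproducedDeriv K g (c + θ * (s - r)) * K r = reproducedDeriv K g (c + θ * s) := by
  have hint : Integrable (fun p : ℝ × ℝ => g (c + θ * (s - p.1) - p.2) * (K p.1 * deriv K p.2))
      (volume.prod volume) := by
    refine (K.integrable.mul_prod (integrable_deriv_schwartz K)).bdd_mul (c := M) ?_
      (Filter.Eventually.of_forall fun p => hg.bound _)
    exact (hg.measurable.comp (by fun_prop)).aestronglyMeasurable
  calc ∫ r, reproducedDeriv K g (c + θ * (s - r)) * K r
      = ∫ r, ∫ t, g (c + θ * (s - r) - t) * (K r * deriv K t) := by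
        congr 1; ext r
        rw [reproducedDeriv, ← integral_mul_const]
        congr 1; ext t; ring
    _ = ∫ t, ∫ r, g (c + θ * (s - r) - t) * (K r * deriv K t) := integral_integral_swap hint
    _ = ∫ t, g (c + θ * s - t) * deriv K t := by
        congr 1; ext t
        have h := hg.integral_eq θ hθ (c - t) s
        rw [show c + θ * s - t = c - t + θ * s by ring, ← h, ← integral_mul_const]
        congr 1; ext r
        rw [show c + θ * (s - r) - t = c - t + θ * (s - r) by ring]; ring

theorem sub_mul_divDiff (hg : IsReproduced K g M) (x s : ℝ) :
    (s - x : ℂ) * reproducedDivDiff K g x s = g s - g x := by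
  rw [hg.sub_eq_integral_deriv, reproducedDivDiff]
  have h := intervalIntegral.smul_integral_comp_add_mul (a := 0) (b := 1)
    (reproducedDeriv K g) (s - x) x
  have h2 : ∀ θ : ℝ, x + (s - x) * θ = x + θ * (s - x) := fun θ => by ring
  simp only [h2] at h
  rw [show x + 0 * (s - x) = x by ring, show x + 1 * (s - x) = s by ring] at h
  rw [← h, Complex.real_smul]
  push_cast
  rfl

theorem norm_divDiff_le (hg : IsReproduced K g M) (x s : ℝ) :
    ‖reproducedDivDiff K g x s‖ ≤ M * ∫ t, ‖deriv K t‖ := by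
  have := intervalIntegral.norm_integral_le_of_norm_le_const (a := (0 : ℝ)) (b := 1)
    (f := fun θ => reproducedDeriv K g (x + θ * (s - x))) fun θ _ => hg.norm_deriv_le _
  simpa [reproducedDivDiff] using this

theorem stronglyMeasurable_divDiff (hg : IsReproduced K g M) (x : ℝ) :
    StronglyMeasurable (reproducedDivDiff K g x) := by
  have h : StronglyMeasurable fun p : ℝ × ℝ => reproducedDeriv K g (x + p.2 * (p.1 - x)) :=
    (hg.stronglyMeasurable_deriv.measurable.comp (by fun_prop)).stronglyMeasurable
  have := h.integral_prod_right' (ν := volume.restrict (Set.Ioc (0 : ℝ) 1))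
  unfold reproducedDivDiff
  simpa only [intervalIntegral.integral_of_le zero_le_one] using this

/-- For fixed `θ` the map `s ↦ g'(x + θ (s - x))` is a contraction of `g'` and is still reproduced
by `K`; averaging over `θ` preserves this. This is the reason for the parameter `θ` in
`IsReproduced`. -/
theorem divDiff_eq_integral (hg : IsReproduced K g M) (x s : ℝ) :
    reproducedDivDiff K g x s = ∫ t, reproducedDivDiff K g x t * K (s - t) := by
  have : IsFiniteMeasure (volume.restrict (Set.uIoc (0 : ℝ) 1)) := by
    unfold Set.uIoc; infer_instance
  have hint : Integrable (fun p : ℝ × ℝ => reproducedDeriv K g (x + p.1 * (s - p.2 - x)) * K p.2)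
      ((volume.restrict (Set.uIoc 0 1)).prod volume) := by
    refine (K.integrable.comp_snd _).bdd_mul (c := M * ∫ t, ‖deriv K t‖) ?_
      (Filter.Eventually.of_forall fun p => hg.norm_deriv_le _)
    exact (hg.stronglyMeasurable_deriv.measurable.comp (by fun_prop)).aestronglyMeasurable
  symm
  calc ∫ t, reproducedDivDiff K g x t * K (s - t)
      = ∫ r, reproducedDivDiff K g x (s - r) * K r := by
        rw [← integral_sub_left_eq_self _ volume s]; simp
    _ = ∫ r, ∫ θ in (0 : ℝ)..1, reproducedDeriv K g (x + θ * (s - r - x)) * K r := by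
        congr 1; ext r
        rw [reproducedDivDiff, ← intervalIntegral.integral_mul_const]
    _ = ∫ θ in (0 : ℝ)..1, ∫ r, reproducedDeriv K g (x + θ * (s - r - x)) * K r :=
        (intervalIntegral_integral_swap hint).symm
    _ = reproducedDivDiff K g x s := by
        refine intervalIntegral.integral_congr fun θ hθ => ?_
        rw [Set.uIcc_of_le zero_le_one] at hθ
        have h := hg.integral_deriv_mul hθ (x - θ * x) s
        rw [show x + θ * (s - x) = x - θ * x + θ * s by ring]
        rw [← h]
        congr 1; ext r
        rw [show x + θ * (s - r - x) = x - θ * x + θ * (s - r) by ring]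

/-- The sum of two squared bounds: `M ∫ ‖K'‖` for the quotient itself, and `2 * M` for the quotient
times `|s - x|`. Together they give square integrability in `s`. -/
theorem norm_divDiff_sq_le (hg : IsReproduced K g M) (x s : ℝ) :
    ‖reproducedDivDiff K g x s‖ ^ 2 ≤
      M ^ 2 * ((∫ t, ‖deriv K t‖) ^ 2 + 4) * (1 + (s - x) ^ 2)⁻¹ := by
  rw [← div_eq_mul_inv, le_div_iff₀ (by positivity)]
  have h1 := hg.norm_divDiff_le x s
  have h2 : |s - x| * ‖reproducedDivDiff K g x s‖ ≤ 2 * M := by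
    have := congrArg norm (hg.sub_mul_divDiff x s)
    rw [norm_mul, ← Complex.ofReal_sub, Complex.norm_real, Real.norm_eq_abs] at this
    rw [this]
    refine (norm_sub_le _ _).trans ?_
    linarith [hg.bound s, hg.bound x]
  have h3 := pow_le_pow_left₀ (norm_nonneg _) h1 2
  have h4 := pow_le_pow_left₀ (by positivity) h2 2
  rw [mul_pow, sq_abs] at h4
  rw [mul_pow] at h3 h4
  linarith

theorem integrable_bound (x C : ℝ) : Integrable fun s : ℝ => C * (1 + (s - x) ^ 2)⁻¹ :=
  (integrable_inv_one_add_sq.comp_sub_right x).const_mul _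

theorem memLp_divDiff (hg : IsReproduced K g M) (x : ℝ) : MemLp (reproducedDivDiff K g x) 2 := by
  rw [memLp_two_iff_integrable_sq_norm (hg.stronglyMeasurable_divDiff x).aestronglyMeasurable]
  refine (integrable_bound x (M ^ 2 * ((∫ t, ‖deriv K t‖) ^ 2 + 4))).mono'
    ((hg.stronglyMeasurable_divDiff x).norm.pow 2).aestronglyMeasurable
    (Filter.Eventually.of_forall fun s => ?_)
  rw [Real.norm_of_nonneg (by positivity)]
  exact hg.norm_divDiff_sq_le x s

theorem integral_norm_divDiff_sq_le (hg : IsReproduced K g M) (x : ℝ) :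
    ∫ s, ‖reproducedDivDiff K g x s‖ ^ 2 ≤
      M ^ 2 * (((∫ t, ‖deriv K t‖) ^ 2 + 4) * Real.pi) := by
  have h := integral_mono ((memLp_two_iff_integrable_sq_norm
    (hg.stronglyMeasurable_divDiff x).aestronglyMeasurable).1 (hg.memLp_divDiff x))
    (integrable_bound x (M ^ 2 * ((∫ t, ‖deriv K t‖) ^ 2 + 4))) (hg.norm_divDiff_sq_le x)
  rw [integral_const_mul, integral_sub_right_eq_self (fun s : ℝ => (1 + s ^ 2)⁻¹),
    integral_univ_inv_one_add_sq] at h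
  linarith

end IsReproduced

/-- Functions reproduced at scale `1 / σ` in the first variable have factorable divided
differences. -/
theorem exists_hasDividedFactor : ∃ C : ℝ, 0 ≤ C ∧ ∀ (F : ℝ → ℝ → ℂ) (σ M : ℝ), 0 < σ →
    (∀ y, IsReproduced K (fun s => F (s / σ) y) M) → HasDividedFactor F (C * (σ * M)) := by
  -- The summand `1` keeps the normalising factor `(√κ)⁻¹` meaningful when `K = 0`.
  set κ := (∫ t, ‖K t‖ ^ 2) + 1 with hκ
  have hκ0 : 0 < κ := by positivity
  set D := ((∫ t, ‖deriv K t‖) ^ 2 + 4) * Real.pi with hD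
  have hD0 : 0 ≤ D := by positivity
  refine ⟨√κ * √D, by positivity, fun F σ M hσ hF => ?_⟩
  have hK2 : MemLp K 2 := K.memLp 2
  -- The factorisation is `divDiff_eq_integral` in the variable `σ x`: the kernel is one factor, the
  -- divided difference at `t` the other. Rescaling produces the factor `σ`.
  refine ⟨fun x t => ((√κ)⁻¹ : ℂ) * K (σ * x - t),
    fun x y t => ((√κ * σ : ℝ) : ℂ) * reproducedDivDiff K (fun s => F (s / σ) y) (σ * x) t,
    fun x => ?_, fun x y => ((hF y).memLp_divDiff _).const_mul _, fun x => ?_, fun x y => ?_,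
    fun x₁ x₂ y => ?_⟩
  · exact ((hK2.comp_measurePreserving (Measure.measurePreserving_sub_left volume (σ * x)))).const_mul
      (((√κ)⁻¹ : ℂ))
  · simp only [norm_mul, mul_pow, integral_const_mul]
    rw [integral_sub_left_eq_self (fun t => ‖K t‖ ^ 2) volume (σ * x)]
    have : ‖((√κ)⁻¹ : ℂ)‖ ^ 2 = κ⁻¹ := by
      rw [norm_inv, Complex.norm_real, inv_pow, Real.norm_of_nonneg (Real.sqrt_nonneg _),
        Real.sq_sqrt hκ0.le]
    rw [this, inv_mul_le_iff₀ hκ0, mul_one]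
    linarith
  · simp only [norm_mul, mul_pow, integral_const_mul, Complex.norm_real, Real.norm_eq_abs, sq_abs]
    have := (hF y).integral_norm_divDiff_sq_le (σ * x)
    rw [Real.sq_sqrt hκ0.le, Real.sq_sqrt hD0]
    calc κ * σ ^ 2 * _ ≤ κ * σ ^ 2 * (M ^ 2 * D) := by gcongr
      _ = _ := by ring
  · have h1 := (hF y).sub_mul_divDiff (σ * x₁) (σ * x₂)
    rw [(hF y).divDiff_eq_integral (σ * x₁) (σ * x₂)] at h1
    have h2 : ∀ x : ℝ, σ * x / σ = x := fun x => by field_simp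
    simp only [h2] at h1
    have h3 : F x₁ y - F x₂ y = -(F x₂ y - F x₁ y) := by ring
    rw [h3, ← h1, ← neg_mul]
    have h4 : ∀ t, ((√κ * σ : ℝ) : ℂ) * reproducedDivDiff K (fun s => F (s / σ) y) (σ * x₁) t *
        (((√κ)⁻¹ : ℂ) * K (σ * x₂ - t)) = (σ : ℂ) *
        (reproducedDivDiff K (fun s => F (s / σ) y) (σ * x₁) t * K (σ * x₂ - t)) := fun t => by
      have : (√κ : ℂ) ≠ 0 := by exact_mod_cast (Real.sqrt_pos.2 hκ0).ne'
      push_cast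
      field_simp
    simp only [h4, integral_const_mul]
    push_cast
    ring

/-- Cauchy-Schwarz gives a Lipschitz bound, used for the convergence of the Littlewood-Paley series.
-/
theorem HasDividedFactor.norm_sub_le {F : ℝ → ℝ → ℂ} {M : ℝ} (hM : 0 ≤ M)
    (hF : HasDividedFactor F M) (x₁ x₂ y : ℝ) : ‖F x₁ y - F x₂ y‖ ≤ M * |x₁ - x₂| := by
  obtain ⟨a, b, ha, hb, hMa, hMb, h⟩ := hF
  rw [h, norm_mul, ← Complex.ofReal_sub, Complex.norm_real, Real.norm_eq_abs, mul_comm]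
  refine mul_le_mul_of_nonneg_right ?_ (abs_nonneg _)
  rw [← pow_le_pow_iff_left₀ (norm_nonneg _) hM two_ne_zero]
  refine (norm_integral_mul_sq_le (hb _ _) (ha _)).trans ?_
  calc _ ≤ M ^ 2 * 1 := mul_le_mul (hMb _ _) (hMa _) (integral_nonneg fun _ => by positivity)
        (by positivity)
    _ = M ^ 2 := mul_one _

end Reproducing

/-! ### Polynomial bounds for a tempered distribution on cut off translates. -/

section Exchange

variable {E : Type*} [NormedAddCommGroup E] [NormedSpace ℝ E]

theorem exists_one_add_norm_pow_mul_iteratedFDeriv_le (η : 𝓢(E, ℂ)) (k l : ℕ) :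
    ∃ C : ℝ, 0 ≤ C ∧ ∀ x, (1 + ‖x‖) ^ k * ‖iteratedFDeriv ℝ l η x‖ ≤ C :=
  ⟨_, by positivity, fun x => SchwartzMap.one_add_le_sup_seminorm_apply (𝕜 := ℝ) (m := (k, l))
    le_rfl le_rfl η x⟩

theorem norm_iteratedFDeriv_comp_smul_le (χ : 𝓢(E, ℂ)) {c : ℝ} (hc : |c| ≤ 1) (j : ℕ) (z : E) :
    ‖iteratedFDeriv ℝ j (fun z => χ (c • z)) z‖ ≤ SchwartzMap.seminorm ℝ 0 j χ := by
  have h := (c • ContinuousLinearMap.id ℝ E).iteratedFDeriv_comp_right (i := j) (χ.smooth ⊤) z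
    (by exact_mod_cast le_top)
  have h2 : (fun z => χ (c • z)) = χ ∘ (c • ContinuousLinearMap.id ℝ E) := by ext z; simp
  rw [h2, h]
  refine (ContinuousMultilinearMap.norm_compContinuousLinearMap_le _ _).trans ?_
  have h3 : ‖c • ContinuousLinearMap.id ℝ E‖ ≤ 1 := by
    rw [norm_smul, Real.norm_eq_abs]
    exact mul_le_one₀ hc (norm_nonneg _) ContinuousLinearMap.norm_id_le
  calc _ ≤ SchwartzMap.seminorm ℝ 0 j χ * 1 := by
        refine mul_le_mul (SchwartzMap.norm_iteratedFDeriv_le_seminorm ℝ χ j _) ?_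
          (by positivity) (apply_nonneg _ _)
        exact Finset.prod_le_one (fun _ _ => norm_nonneg _) fun _ _ => h3
    _ = _ := mul_one _

/-- Cutting off the translates of a Schwartz function keeps the seminorms polynomially bounded,
uniformly in the size of the cutoff. -/
theorem exists_seminorm_cutoff_le (χ η : 𝓢(E, ℂ)) (k l : ℕ) :
    ∃ C : ℝ, 0 ≤ C ∧ ∀ (c : ℝ) (x : E) (ψ : 𝓢(E, ℂ)), |c| ≤ 1 →
      (∀ z, ψ z = χ (c • z) * η (z - x)) →
      SchwartzMap.seminorm ℂ k l ψ ≤ C * (1 + ‖x‖) ^ k := by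
  choose D hD0 hD using fun m => exists_one_add_norm_pow_mul_iteratedFDeriv_le η k m
  refine ⟨∑ i ∈ Finset.range (l + 1),
    (l.choose i : ℝ) * SchwartzMap.seminorm ℝ 0 i χ * D (l - i), ?_, fun c x ψ hc hψ => ?_⟩
  · exact Finset.sum_nonneg fun i _ => mul_nonneg (mul_nonneg (by positivity) (apply_nonneg _ _))
      (hD0 _)
  · refine SchwartzMap.seminorm_le_bound ℂ k l ψ (mul_nonneg (Finset.sum_nonneg fun i _ =>
      mul_nonneg (mul_nonneg (by positivity) (apply_nonneg _ _)) (hD0 _)) (by positivity)) ?_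
    intro z
    have hfun : (ψ : E → ℂ) = fun z => χ (c • z) * η (z - x) := funext hψ
    have h1 : ContDiff ℝ ∞ (fun z : E => χ (c • z)) := (χ.smooth ⊤).comp (contDiff_const_smul c)
    have h2 : ContDiff ℝ ∞ (fun z : E => η (z - x)) :=
      (η.smooth ⊤).comp (contDiff_id.sub contDiff_const)
    have h3 := norm_iteratedFDeriv_mul_le h1 h2 z (n := l) (by exact_mod_cast le_top)
    -- The weight at `z` is traded for one at `z - x`, where `η` decays, at the price of a power of
    -- `1 + ‖x‖`.
    have hz : ‖z‖ ^ k ≤ (1 + ‖x‖) ^ k * (1 + ‖z - x‖) ^ k := by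
      rw [← mul_pow]
      refine pow_le_pow_left₀ (norm_nonneg _) ?_ k
      have : ‖z‖ ≤ ‖z - x‖ + ‖x‖ := by simpa using norm_add_le (z - x) x
      nlinarith [norm_nonneg x, norm_nonneg (z - x)]
    rw [hfun]
    calc ‖z‖ ^ k * ‖iteratedFDeriv ℝ l (fun z => χ (c • z) * η (z - x)) z‖
        ≤ ((1 + ‖x‖) ^ k * (1 + ‖z - x‖) ^ k) * ∑ i ∈ Finset.range (l + 1), (l.choose i : ℝ) *
          ‖iteratedFDeriv ℝ i (fun z => χ (c • z)) z‖ *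
          ‖iteratedFDeriv ℝ (l - i) (fun z => η (z - x)) z‖ := by gcongr
      _ = (∑ i ∈ Finset.range (l + 1), (l.choose i : ℝ) *
          ‖iteratedFDeriv ℝ i (fun z => χ (c • z)) z‖ *
          ((1 + ‖z - x‖) ^ k * ‖iteratedFDeriv ℝ (l - i) η (z - x)‖)) * (1 + ‖x‖) ^ k := by
        rw [mul_assoc, mul_comm, Finset.mul_sum]
        congr 1
        refine Finset.sum_congr rfl fun i _ => ?_
        rw [iteratedFDeriv_comp_sub]
        ring
      _ ≤ _ := by
        gcongr with i _
        · exact norm_iteratedFDeriv_comp_smul_le χ hc i z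
        · exact hD _ _

/-- Continuity bounds `F` by finitely many Schwartz seminorms. The bound does not depend on the
cutoff scale `c`, so it serves as a majorant when the cutoff is removed. -/
theorem exists_norm_cutoff_le (F : 𝓢'(E, ℂ)) (χ η : 𝓢(E, ℂ)) :
    ∃ (C : ℝ) (k : ℕ), 0 ≤ C ∧ ∀ (c : ℝ) (x : E) (ψ : 𝓢(E, ℂ)), |c| ≤ 1 →
      (∀ z, ψ z = χ (c • z) * η (z - x)) → ‖F ψ‖ ≤ C * (1 + ‖x‖) ^ k := by
  let q : Seminorm ℂ 𝓢(E, ℂ) := (normSeminorm ℂ ℂ).comp (F : 𝓢(E, ℂ) →ₗ[ℂ] ℂ)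
  have hq : Continuous q := continuous_norm.comp F.cont
  obtain ⟨s, B, -, hB⟩ := Seminorm.bound_of_continuous (schwartz_withSeminorms ℂ E ℂ) q hq
  choose D hD0 hD using fun m : ℕ × ℕ => exists_seminorm_cutoff_le χ η m.1 m.2
  refine ⟨B * ∑ m ∈ s, D m, s.sup Prod.fst, ?_, fun c x ψ hc hψ => ?_⟩
  · exact mul_nonneg B.2 (Finset.sum_nonneg fun m _ => hD0 m)
  · have h1 : ‖F ψ‖ ≤ B * (s.sup (schwartzSeminormFamily ℂ E ℂ)) ψ := hB ψ
    have h2 : (s.sup (schwartzSeminormFamily ℂ E ℂ)) ψ ≤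
        ∑ m ∈ s, schwartzSeminormFamily ℂ E ℂ m ψ :=
      Seminorm.finset_sup_apply_le (Finset.sum_nonneg fun m _ => apply_nonneg _ _) fun m hm =>
        Finset.single_le_sum (f := fun m => schwartzSeminormFamily ℂ E ℂ m ψ)
          (fun m _ => apply_nonneg _ _) hm
    refine h1.trans ?_
    rw [mul_assoc, Finset.sum_mul]
    refine mul_le_mul_of_nonneg_left (h2.trans (Finset.sum_le_sum fun m hm => ?_)) B.2
    refine (hD m c x ψ hc hψ).trans (mul_le_mul_of_nonneg_left ?_ (hD0 m))
    exact pow_le_pow_right₀ (by linarith [norm_nonneg x]) (Finset.le_sup (f := Prod.fst) hm)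

theorem integrable_one_add_norm_pow_mul [MeasurableSpace E] [BorelSpace E]
    [FiniteDimensional ℝ E] (μ : Measure E) [μ.HasTemperateGrowth] (K : 𝓢(E, ℂ)) (k : ℕ) :
    Integrable (fun r => (1 + ‖r‖) ^ k * ‖K r‖) μ := by
  have hs : ∀ r : E, (1 + ‖r‖) ^ k * ‖K r‖ =
      ∑ m ∈ Finset.range (k + 1), (k.choose m : ℝ) * (‖r‖ ^ m * ‖K r‖) := by
    intro r
    rw [add_comm, add_pow, Finset.sum_mul]
    refine Finset.sum_congr rfl fun m _ => ?_
    simp only [one_pow, mul_one]; ring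
  simp only [hs]
  exact integrable_finsetSum _ fun m _ => (K.integrable_pow_mul μ m).const_mul _

theorem exists_schwartz_eq_one {E : Type*} [NormedAddCommGroup E] [InnerProductSpace ℝ E]
    [FiniteDimensional ℝ E] : ∃ χ : 𝓢(E, ℂ), ∀ x, ‖x‖ ≤ 1 → χ x = 1 := by
  let b : ContDiffBump (0 : E) := ⟨1, 2, one_pos, one_lt_two⟩
  have h1 : HasCompactSupport fun x => (b x : ℂ) :=
    b.hasCompactSupport.comp_left (g := Complex.ofReal) Complex.ofReal_zero
  have h2 : ContDiff ℝ ∞ fun x => (b x : ℂ) := Complex.ofRealCLM.contDiff.comp b.contDiff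
  refine ⟨h1.toSchwartzMap h2, fun x hx => ?_⟩
  have : (b x : ℂ) = 1 := by
    rw [b.one_of_mem_closedBall (by simpa [b] using hx), Complex.ofReal_one]
  exact this

end Exchange

/-! ### Reproducing formulas for convolutions with a tempered distribution. -/

section DistConv

variable {d : ℕ} {F : 𝓢'(Rn d, ℂ)} {f : Rn d → ℂ}

theorem distConv_eq_integral (hf : IsContinuousFunction F f) (φ : 𝓢(Rn d, ℂ)) (x : Rn d) :
    distConv F φ x = ∫ z, f z * φ (x - z) := by
  rw [distConv, hf.apply_eq]
  simp

/-- The convolution with the cut off function `f`. -/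
def cutoffConv (f : Rn d → ℂ) (χ φ : 𝓢(Rn d, ℂ)) (n : ℕ) (x : Rn d) : ℂ :=
  ∫ z, f z * (χ ((1 / ((n : ℝ) + 1)) • z) * φ (x - z))

theorem abs_one_div_nat_add_one_le (n : ℕ) : |1 / ((n : ℝ) + 1)| ≤ 1 := by
  rw [abs_of_pos (by positivity), div_le_one (by positivity)]
  linarith [n.cast_nonneg (α := ℝ)]

/-- Dilation of a Schwartz function. -/
def dilatedSchwartz (χ : 𝓢(Rn d, ℂ)) (n : ℕ) : 𝓢(Rn d, ℂ) :=
  SchwartzMap.compCLMOfContinuousLinearEquiv ℂ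
    (ContinuousLinearEquiv.smulLeft (Units.mk0 (1 / ((n : ℝ) + 1)) (by positivity))) χ

theorem dilatedSchwartz_apply (χ : 𝓢(Rn d, ℂ)) (n : ℕ) (z : Rn d) :
    dilatedSchwartz χ n z = χ ((1 / ((n : ℝ) + 1)) • z) := rfl

theorem exists_norm_cutoffConv_le (hf : IsContinuousFunction F f) (χ φ : 𝓢(Rn d, ℂ)) :
    ∃ (C : ℝ) (k : ℕ), 0 ≤ C ∧ ∀ n x, ‖cutoffConv f χ φ n x‖ ≤ C * (1 + ‖x‖) ^ k := by
  obtain ⟨C, k, hC, h⟩ := exists_norm_cutoff_le F χ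
    (SchwartzMap.compCLMOfContinuousLinearEquiv ℂ (ContinuousLinearEquiv.neg ℝ) φ)
  refine ⟨C, k, hC, fun n x => ?_⟩
  let ψ : 𝓢(Rn d, ℂ) := SchwartzMap.smulLeftCLM ℂ (dilatedSchwartz χ n)
    ((SchwartzMap.compCLMOfContinuousLinearEquiv ℂ (ContinuousLinearEquiv.neg ℝ) φ).compSubConstCLM
      ℂ x)
  have hψ : ∀ z, ψ z = χ ((1 / ((n : ℝ) + 1)) • z) * φ (x - z) := fun z => by
    rw [SchwartzMap.smulLeftCLM_apply_apply (SchwartzMap.hasTemperateGrowth _),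
      dilatedSchwartz_apply]
    simp
  have h2 := h (1 / ((n : ℝ) + 1)) x ψ (abs_one_div_nat_add_one_le n) fun z => by
    rw [hψ]; simp
  rw [hf.apply_eq] at h2
  simpa only [hψ, cutoffConv] using h2

theorem stronglyMeasurable_cutoffConv (hf : IsContinuousFunction F f) (χ φ : 𝓢(Rn d, ℂ)) (n : ℕ) :
    StronglyMeasurable (cutoffConv f χ φ n) := by
  have h : StronglyMeasurable fun p : Rn d × Rn d =>
      f p.2 * (χ ((1 / ((n : ℝ) + 1)) • p.2) * φ (p.1 - p.2)) := by
    have h1 := hf.continuous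
    have h2 := χ.continuous
    have h3 := φ.continuous
    refine Continuous.stronglyMeasurable ?_
    fun_prop
  exact h.integral_prod_right'

theorem tendsto_cutoffConv (hf : IsContinuousFunction F f) {χ : 𝓢(Rn d, ℂ)} (hχ : χ 0 = 1)
    (φ : 𝓢(Rn d, ℂ)) (x : Rn d) :
    Filter.Tendsto (fun n => cutoffConv f χ φ n x) Filter.atTop (nhds (distConv F φ x)) := by
  rw [distConv_eq_integral hf]
  have hint := hf.integrable ((SchwartzMap.compCLMOfContinuousLinearEquiv ℂ
    (ContinuousLinearEquiv.neg ℝ) φ).compSubConstCLM ℂ x)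
  simp only [SchwartzMap.compSubConstCLM_apply,
    SchwartzMap.compCLMOfContinuousLinearEquiv_apply, Function.comp_apply,
    ContinuousLinearEquiv.neg_apply, neg_sub] at hint
  refine tendsto_integral_of_dominated_convergence
    (fun z => SchwartzMap.seminorm ℝ 0 0 χ * ‖f z * φ (x - z)‖) (fun n => ?_)
    (hint.norm.const_mul _) (fun n => Filter.Eventually.of_forall fun z => ?_)
    (Filter.Eventually.of_forall fun z => ?_)
  · have h1 := hf.continuous
    have h2 := χ.continuous
    have h3 := φ.continuous
    refine Continuous.aestronglyMeasurable ?_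
    fun_prop
  · rw [mul_left_comm, norm_mul]
    exact mul_le_mul_of_nonneg_right (SchwartzMap.norm_le_seminorm ℝ χ _) (norm_nonneg _)
  · have h : Filter.Tendsto (fun n : ℕ => χ ((1 / ((n : ℝ) + 1)) • z)) Filter.atTop (nhds 1) := by
      rw [← hχ]
      refine (χ.continuous.tendsto 0).comp ?_
      simpa using (tendsto_one_div_add_atTop_nhds_zero_nat (𝕜 := ℝ)).smul_const z
    simpa using (h.mul_const (φ (x - z))).const_mul (f z)

theorem stronglyMeasurable_distConv (hf : IsContinuousFunction F f) (φ : 𝓢(Rn d, ℂ)) :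
    StronglyMeasurable (distConv F φ) := by
  obtain ⟨χ, hχ'⟩ := exists_schwartz_eq_one (E := Rn d)
  have hχ : χ 0 = 1 := hχ' 0 (by simp)
  exact stronglyMeasurable_of_tendsto Filter.atTop
    (fun n => stronglyMeasurable_cutoffConv hf χ φ n)
    (tendsto_pi_nhds.2 fun x => tendsto_cutoffConv hf hχ φ x)

variable {E : Type*} [NormedAddCommGroup E] [InnerProductSpace ℝ E] [FiniteDimensional ℝ E]
  [MeasurableSpace E] [BorelSpace E]

/-- The cutoff makes `f` times the dilated `χ` integrable, which is what Fubini's theorem needs. -/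
theorem integral_cutoffConv_mul (hf : IsContinuousFunction F f) (χ φ : 𝓢(Rn d, ℂ)) (K : 𝓢(E, ℂ))
    (L : E →L[ℝ] Rn d) (hφ : ∀ u, ∫ r, φ (u - L r) * K r = φ u) (n : ℕ) (x : Rn d) :
    ∫ r, cutoffConv f χ φ n (x - L r) * K r = cutoffConv f χ φ n x := by
  have hint : Integrable (fun p : E × Rn d => φ (x - L p.1 - p.2) *
      (K p.1 * (f p.2 * χ ((1 / ((n : ℝ) + 1)) • p.2)))) (volume.prod volume) := by
    refine (K.integrable.mul_prod (hf.integrable (dilatedSchwartz χ n))).bdd_mul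
      (c := SchwartzMap.seminorm ℝ 0 0 φ) ?_
      (Filter.Eventually.of_forall fun p => SchwartzMap.norm_le_seminorm ℝ φ _)
    have := φ.continuous
    refine Continuous.aestronglyMeasurable ?_
    fun_prop
  calc ∫ r, cutoffConv f χ φ n (x - L r) * K r
      = ∫ r, ∫ z, φ (x - L r - z) * (K r * (f z * χ ((1 / ((n : ℝ) + 1)) • z))) := by
        congr 1; ext r
        rw [cutoffConv, ← integral_mul_const]
        congr 1; ext z; ring
    _ = ∫ z, ∫ r, φ (x - L r - z) * (K r * (f z * χ ((1 / ((n : ℝ) + 1)) • z))) :=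
        integral_integral_swap hint
    _ = cutoffConv f χ φ n x := by
        unfold cutoffConv
        congr 1; ext z
        rw [← hφ (x - z), ← integral_const_mul, ← integral_const_mul]
        congr 1; ext r
        rw [sub_right_comm]; ring

/-- If `φ` is reproduced by averaging its translates, so is `F * φ`. -/
theorem integral_distConv_mul (hf : IsContinuousFunction F f) (φ : 𝓢(Rn d, ℂ)) (K : 𝓢(E, ℂ))
    (L : E →L[ℝ] Rn d) (hφ : ∀ u, ∫ r, φ (u - L r) * K r = φ u) (x : Rn d) :
    ∫ r, distConv F φ (x - L r) * K r = distConv F φ x := by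
  obtain ⟨χ, hχ'⟩ := exists_schwartz_eq_one (E := Rn d)
  have hχ : χ 0 = 1 := hχ' 0 (by simp)
  obtain ⟨C, k, hC, hb⟩ := exists_norm_cutoffConv_le hf χ φ
  -- The cutoff is removed by dominated convergence: polynomial growth, uniform in `n`, against the
  -- decay of `K`.
  have hlim : Filter.Tendsto (fun n => ∫ r, cutoffConv f χ φ n (x - L r) * K r) Filter.atTop
      (nhds (∫ r, distConv F φ (x - L r) * K r)) := by
    refine tendsto_integral_of_dominated_convergence
      (fun r => C * ((1 + ‖x‖) * (1 + ‖L‖)) ^ k * ((1 + ‖r‖) ^ k * ‖K r‖)) (fun n => ?_)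
      ((integrable_one_add_norm_pow_mul volume K k).const_mul _)
      (fun n => Filter.Eventually.of_forall fun r => ?_)
      (Filter.Eventually.of_forall fun r => (tendsto_cutoffConv hf hχ φ _).mul_const _)
    · refine AEStronglyMeasurable.mul ?_ K.continuous.aestronglyMeasurable
      exact ((stronglyMeasurable_cutoffConv hf χ φ n).comp_measurable
        (by fun_prop)).aestronglyMeasurable
    · rw [norm_mul]
      have h1 : 1 + ‖x - L r‖ ≤ (1 + ‖x‖) * (1 + ‖L‖) * (1 + ‖r‖) := by
        have h2 := norm_sub_le x (L r)
        have h3 := L.le_opNorm r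
        have h4 : 0 ≤ ‖x‖ * ‖L‖ := by positivity
        have h5 : 0 ≤ ‖x‖ * ‖r‖ := by positivity
        have h6 : 0 ≤ ‖x‖ * ‖L‖ * ‖r‖ := by positivity
        nlinarith [norm_nonneg x, norm_nonneg L, norm_nonneg r]
      calc ‖cutoffConv f χ φ n (x - L r)‖ * ‖K r‖
          ≤ C * ((1 + ‖x‖) * (1 + ‖L‖) * (1 + ‖r‖)) ^ k * ‖K r‖ := by
            refine mul_le_mul_of_nonneg_right ((hb n _).trans ?_) (norm_nonneg _)
            gcongr
        _ = _ := by rw [mul_pow _ (1 + ‖r‖)]; ring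
  simp only [integral_cutoffConv_mul hf χ φ K L hφ] at hlim
  exact tendsto_nhds_unique hlim (tendsto_cutoffConv hf hχ φ x)

end DistConv

/-! ### Littlewood-Paley pieces as band-limited functions. -/

section DyadicPiece

variable {d : ℕ} {E : Type*} [NormedAddCommGroup E] [InnerProductSpace ℝ E]
  [FiniteDimensional ℝ E] [MeasurableSpace E] [BorelSpace E]

theorem fourierInv_schwartz_apply (s : 𝓢(Rn d, ℂ)) (u : Rn d) :
    (𝓕⁻ s) u = ∫ ξ, Complex.exp ((2 * Real.pi * inner ℝ ξ u : ℝ) * Complex.I) * s ξ := by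
  rw [SchwartzMap.fourierInv_coe, Real.fourierInv_eq']
  rfl

theorem norm_exp_ofReal_mul_I_le (x : ℝ) : ‖Complex.exp (x * Complex.I)‖ ≤ 1 :=
  (Complex.norm_exp_ofReal_mul_I x).le

/-- Averaging translates multiplies the Fourier transform by that of the weight. -/
theorem integral_fourierInv_sub_mul (s : 𝓢(Rn d, ℂ)) (K : 𝓢(E, ℂ)) (L : E →L[ℝ] Rn d)
    (h : ∀ ξ, s ξ ≠ 0 → ∃ η : E, (𝓕 K) η = 1 ∧ ∀ r, inner ℝ ξ (L r) = inner ℝ r η) (u : Rn d) :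
    ∫ r, (𝓕⁻ s) (u - L r) * K r = (𝓕⁻ s) u := by
  have hint : Integrable (fun p : E × Rn d =>
      Complex.exp ((2 * Real.pi * inner ℝ p.2 (u - L p.1) : ℝ) * Complex.I) * (K p.1 * s p.2))
      (volume.prod volume) := by
    refine (K.integrable.mul_prod s.integrable).bdd_mul (c := 1) ?_
      (Filter.Eventually.of_forall fun p => norm_exp_ofReal_mul_I_le _)
    refine Continuous.aestronglyMeasurable ?_
    fun_prop
  calc ∫ r, (𝓕⁻ s) (u - L r) * K r
      = ∫ r, ∫ ξ, Complex.exp ((2 * Real.pi * inner ℝ ξ (u - L r) : ℝ) * Complex.I) *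
          (K r * s ξ) := by
        congr 1; ext r
        rw [fourierInv_schwartz_apply, ← integral_mul_const]
        congr 1; ext ξ; ring
    _ = ∫ ξ, ∫ r, Complex.exp ((2 * Real.pi * inner ℝ ξ (u - L r) : ℝ) * Complex.I) *
          (K r * s ξ) := integral_integral_swap hint
    _ = (𝓕⁻ s) u := by
        rw [fourierInv_schwartz_apply]
        congr 1; ext ξ
        by_cases hξ : s ξ = 0
        · simp [hξ]
        obtain ⟨η, hη, hL⟩ := h ξ hξ
        have h1 : ∫ r, Complex.exp ((-2 * Real.pi * inner ℝ r η : ℝ) * Complex.I) * K r = 1 := by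
          rw [← hη, SchwartzMap.fourier_coe, Real.fourier_eq']
          rfl
        rw [← mul_one (_ * s ξ), ← h1, ← integral_const_mul]
        congr 1; ext r
        rw [show (2 * Real.pi * inner ℝ ξ (u - L r) : ℝ) =
          2 * Real.pi * inner ℝ ξ u + -2 * Real.pi * inner ℝ r η by
            rw [inner_sub_right, hL]; ring, Complex.ofReal_add, add_mul, Complex.exp_add]
        ring

theorem exists_kernel : ∃ K : 𝓢(E, ℂ), ∀ ξ, ‖ξ‖ ≤ 1 → (𝓕 K) ξ = 1 := by
  obtain ⟨χ, hχ⟩ := exists_schwartz_eq_one (E := E)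
  exact ⟨𝓕⁻ χ, fun ξ hξ => by rw [FourierTransform.fourier_fourierInv_eq, hχ ξ hξ]⟩

/-- The support gives `2 * π * ‖ξ‖ ≤ 2 * 2 ^ n`, and the factor `π` is discarded. -/
theorem norm_le_of_dyadicSymbol_ne_zero {w : ℝ → ℝ} (hw : IsDyadicWindow w) {n : ℤ} {ξ : Rn d}
    (h : dyadicSymbol d w n ξ ≠ 0) : ‖ξ‖ ≤ 2 ^ n := by
  have h1 : w (2 * Real.pi * ‖ξ‖ / 2 ^ n) ≠ 0 := fun h0 => h (by simp [dyadicSymbol, h0])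
  have h2 := (hw.support_subset h1).2
  rw [div_le_iff₀ (by positivity)] at h2
  nlinarith [Real.pi_gt_three, norm_nonneg ξ]

variable {w : ℝ → ℝ} (hw : IsDyadicWindow w) {F : 𝓢'(Rn d, ℂ)} {f : Rn d → ℂ}

/-- The vector `η` is the image of the frequency `ξ` under the adjoint of `L`. The map `L` will be a
dilation of the whole space or the parametrisation of a line. -/
theorem integral_dyadicPiece_mul (hf : IsContinuousFunction F f) (n : ℤ) {K : 𝓢(E, ℂ)}
    (hK : ∀ ξ, ‖ξ‖ ≤ 1 → (𝓕 K) ξ = 1) (L : E →L[ℝ] Rn d)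
    (hL : ∀ ξ : Rn d, ‖ξ‖ ≤ 2 ^ n → ∃ η : E, ‖η‖ ≤ 1 ∧ ∀ r, inner ℝ ξ (L r) = inner ℝ r η)
    (x : Rn d) : ∫ r, dyadicPiece hw F n (x - L r) * K r = dyadicPiece hw F n x := by
  refine integral_distConv_mul hf _ K L (fun u => ?_) x
  refine integral_fourierInv_sub_mul _ K L (fun ξ hξ => ?_) u
  obtain ⟨η, hη, h⟩ := hL ξ (norm_le_of_dyadicSymbol_ne_zero hw hξ)
  exact ⟨η, hK η hη, h⟩

theorem quasiMeasurePreserving_sub_smul (x : Rn d) {c : ℝ} (hc : c ≠ 0) :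
    Measure.QuasiMeasurePreserving (fun r : Rn d => x - c • r) volume volume := by
  refine (Measure.measurePreserving_sub_left volume x).quasiMeasurePreserving.comp
    (g := fun r => x - r) (f := fun r : Rn d => c • r) ⟨by fun_prop, ?_⟩
  rw [Measure.map_addHaar_smul volume hc]
  exact Measure.smul_absolutelyContinuous

/-- A piece is an average of itself and averages ignore null sets, so the essential supremum
controls every value. Pointwise bounds are needed because eigenvalues are single points. -/
theorem norm_dyadicPiece_le (hf : IsContinuousFunction F f) (n : ℤ) {K : 𝓢(Rn d, ℂ)}
    (hK : ∀ ξ, ‖ξ‖ ≤ 1 → (𝓕 K) ξ = 1) (hfin : eLpNorm (dyadicPiece hw F n) ⊤ volume ≠ ⊤)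
    (x : Rn d) : ‖dyadicPiece hw F n x‖ ≤
      (eLpNorm (dyadicPiece hw F n) ⊤ volume).toReal * ∫ r, ‖K r‖ := by
  have h2n : (0 : ℝ) < 2 ^ n := by positivity
  have hc : ((2 : ℝ) ^ n)⁻¹ ≠ 0 := by positivity
  have h := integral_dyadicPiece_mul hw hf n hK
    (((2 : ℝ) ^ n)⁻¹ • ContinuousLinearMap.id ℝ (Rn d)) (fun ξ hξ =>
      ⟨((2 : ℝ) ^ n)⁻¹ • ξ, by
        rw [norm_smul, norm_inv, Real.norm_of_nonneg h2n.le, inv_mul_le_iff₀ h2n]; simpa using hξ,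
        fun r => by simp [inner_smul_right, real_inner_comm]⟩) x
  rw [← h, ← integral_const_mul]
  refine norm_integral_le_of_norm_le (K.integrable.norm.const_mul _) ?_
  have hae : ∀ᵐ y, ‖dyadicPiece hw F n y‖ ≤ (eLpNorm (dyadicPiece hw F n) ⊤ volume).toReal := by
    filter_upwards [ae_le_eLpNormEssSup (f := dyadicPiece hw F n) (μ := volume)] with y hy
    rw [← eLpNorm_exponent_top] at hy
    have := ENNReal.toReal_mono hfin hy
    simpa using this
  filter_upwards [(quasiMeasurePreserving_sub_smul x hc).ae hae] with r hr
  rw [norm_mul]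
  exact mul_le_mul_of_nonneg_right hr (norm_nonneg _)

/-- Restricted to a line and rescaled by `2 ^ n`, a piece has frequencies in `[-1, 1]`; contraction
by `θ ≤ 1` only lowers them. -/
theorem isReproduced_dyadicPiece (hf : IsContinuousFunction F f) (n : ℤ) {K : 𝓢(ℝ, ℂ)}
    (hK : ∀ ξ, ‖ξ‖ ≤ 1 → (𝓕 K) ξ = 1) {M : ℝ} (hM : ∀ x, ‖dyadicPiece hw F n x‖ ≤ M)
    (e x : Rn d) (he : ‖e‖ ≤ 1) :
    IsReproduced K (fun s => dyadicPiece hw F n (x + (s / 2 ^ n) • e)) M where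
  measurable := (stronglyMeasurable_distConv hf _).measurable.comp (by fun_prop)
  bound s := hM _
  integral_eq θ hθ c s := by
    have h2n : (0 : ℝ) < 2 ^ n := by positivity
    have h := integral_dyadicPiece_mul hw hf n hK
      ((ContinuousLinearMap.id ℝ ℝ).smulRight ((θ / 2 ^ n) • e)) (fun ξ hξ =>
        ⟨(θ / 2 ^ n) * inner ℝ ξ e, by
          rw [norm_mul, norm_div, Real.norm_of_nonneg hθ.1, Real.norm_of_nonneg h2n.le,
            div_mul_eq_mul_div, div_le_iff₀ h2n, one_mul]
          have h1 : ‖inner ℝ ξ e‖ ≤ 2 ^ n :=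
            (norm_inner_le_norm ξ e).trans (by
              calc ‖ξ‖ * ‖e‖ ≤ 2 ^ n * 1 := by gcongr
                _ = 2 ^ n := mul_one _)
          calc θ * ‖inner ℝ ξ e‖ ≤ 1 * 2 ^ n :=
                mul_le_mul hθ.2 h1 (norm_nonneg _) zero_le_one
            _ = 2 ^ n := one_mul _,
          fun r => by simp [inner_smul_right]; ring⟩) (x + ((c + θ * s) / 2 ^ n) • e)
    rw [← h]
    congr 1; ext r
    congr 2
    simp only [ContinuousLinearMap.smulRight_apply, ContinuousLinearMap.id_apply, smul_smul]
    rw [add_sub_assoc, ← sub_smul]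
    congr 2
    field_simp
    ring

theorem vec_eq_add_smul_single_zero (x y : ℝ) :
    (!₂[x, y] : Rn 2) = !₂[0, y] + x • EuclideanSpace.single 0 1 := by
  ext i; fin_cases i <;> simp

theorem vec_eq_add_smul_single_one (x y : ℝ) :
    (!₂[x, y] : Rn 2) = !₂[x, 0] + y • EuclideanSpace.single 1 1 := by
  ext i; fin_cases i <;> simp

/-- The pieces of a function on the plane have factorable divided differences in each variable. -/
theorem exists_hasDividedFactor_dyadicPiece {w : ℝ → ℝ} (hw : IsDyadicWindow w) :
    ∃ C : ℝ, 0 ≤ C ∧ ∀ (F : 𝓢'(Rn 2, ℂ)) (f : Rn 2 → ℂ), IsContinuousFunction F f → ∀ n : ℤ,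
      eLpNorm (dyadicPiece hw F n) ⊤ volume ≠ ⊤ →
      HasDividedFactor (fun x y => dyadicPiece hw F n !₂[x, y])
        (C * (2 ^ n * (eLpNorm (dyadicPiece hw F n) ⊤ volume).toReal)) ∧
      HasDividedFactor (fun y x => dyadicPiece hw F n !₂[x, y])
        (C * (2 ^ n * (eLpNorm (dyadicPiece hw F n) ⊤ volume).toReal)) := by
  obtain ⟨K, hK⟩ := exists_kernel (E := ℝ)
  obtain ⟨V, hV⟩ := exists_kernel (E := Rn 2)
  obtain ⟨C, hC, h⟩ := exists_hasDividedFactor K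
  refine ⟨C * ∫ r, ‖V r‖, by positivity, fun F f hf n hfin => ?_⟩
  have hM := norm_dyadicPiece_le hw hf n hV hfin
  set e := (eLpNorm (dyadicPiece hw F n) ⊤ volume).toReal
  have hC' : C * (∫ r, ‖V r‖) * (2 ^ n * e) = C * (2 ^ n * (e * ∫ r, ‖V r‖)) := by ring
  rw [hC']
  refine ⟨h _ _ _ (by positivity) fun y => ?_, h _ _ _ (by positivity) fun x => ?_⟩
  · have h1 := isReproduced_dyadicPiece hw hf n hK hM (EuclideanSpace.single 0 1) !₂[0, y] (by simp)
    simpa only [← vec_eq_add_smul_single_zero] using h1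
  · have h1 := isReproduced_dyadicPiece hw hf n hK hM (EuclideanSpace.single 1 1) !₂[x, 0] (by simp)
    simpa only [← vec_eq_add_smul_single_one] using h1

end DyadicPiece

/-! ### Recovering a function from its Littlewood-Paley pieces up to a constant. -/

section Gradient

variable {d : ℕ}

open scoped Convolution in
/-- A continuous function with vanishing distributional gradient is constant. -/
theorem eq_of_integral_mul_lineDeriv_eq_zero {h : Rn d → ℂ} (hc : Continuous h)
    (h0 : ∀ (j : Fin d) (φ : 𝓢(Rn d, ℂ)),
      ∫ x, h x * (∂_{(EuclideanSpace.single j 1 : Rn d)} φ) x = 0) (x y : Rn d) : h x = h y := by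
  let b : ℕ → ContDiffBump (0 : Rn d) := fun n =>
    ⟨1 / ((n : ℝ) + 1), 2 * (1 / ((n : ℝ) + 1)), by positivity, by
      have : 0 < 1 / ((n : ℝ) + 1) := by positivity
      linarith⟩
  have hb : Filter.Tendsto (fun n => (b n).rOut) Filter.atTop (nhds 0) := by
    have := (tendsto_one_div_add_atTop_nhds_zero_nat (𝕜 := ℝ)).const_mul 2
    rwa [mul_zero] at this
  -- The mollifications of `h` are constant: their derivative at `z` pairs `h` with a derivative of
  -- the test function `u ↦ ρ (z - u)`.
  have hconst : ∀ n, ((b n).normed volume ⋆[ContinuousLinearMap.lsmul ℝ ℝ, volume] h) x =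
      ((b n).normed volume ⋆[ContinuousLinearMap.lsmul ℝ ℝ, volume] h) y := by
    intro n
    set ρ : Rn d → ℝ := (b n).normed volume with hρ
    have hρc : HasCompactSupport ρ := (b n).hasCompactSupport_normed
    have hρs : ContDiff ℝ ∞ ρ := (b n).contDiff_normed
    have hder := fun z => hρc.hasFDerivAt_convolution_left (ContinuousLinearMap.lsmul ℝ ℝ)
      (hρs.of_le (by exact_mod_cast le_top)) hc.locallyIntegrable (μ := volume) z
    refine is_const_of_fderiv_eq_zero (𝕜 := ℝ) (fun z => (hder z).differentiableAt)
      (fun z => ?_) x y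
    rw [(hder z).fderiv]
    have hint : ConvolutionExistsAt (fderiv ℝ ρ) h z
        ((ContinuousLinearMap.lsmul ℝ ℝ).precompL (Rn d)) volume :=
      (hρc.fderiv ℝ).convolutionExists_left _ (hρs.continuous_fderiv (by simp))
        hc.locallyIntegrable z
    have hφc : HasCompactSupport fun u => ((ρ (z - u) : ℝ) : ℂ) :=
      (hρc.comp_homeomorph (Homeomorph.subLeft z)).comp_left (g := Complex.ofReal)
        Complex.ofReal_zero
    have hφs : ContDiff ℝ ∞ fun u => ((ρ (z - u) : ℝ) : ℂ) :=
      Complex.ofRealCLM.contDiff.comp (hρs.comp (contDiff_const.sub contDiff_id))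
    let φ : 𝓢(Rn d, ℂ) := hφc.toSchwartzMap hφs
    have hφ' : ∀ (j : Fin d) u, (∂_{(EuclideanSpace.single j 1 : Rn d)} φ) u =
        -((fderiv ℝ ρ (z - u) (EuclideanSpace.single j 1) : ℝ) : ℂ) := by
      intro j u
      rw [SchwartzMap.lineDerivOp_apply_eq_fderiv]
      have h1 : HasFDerivAt ρ (fderiv ℝ ρ (z - u)) (z - u) :=
        (hρs.differentiable (by simp)).differentiableAt.hasFDerivAt
      have h2 : HasFDerivAt (fun u => z - u) (-ContinuousLinearMap.id ℝ (Rn d)) u :=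
        (hasFDerivAt_id u).const_sub z
      have h3 : HasFDerivAt (φ : Rn d → ℂ)
          (Complex.ofRealCLM.comp ((fderiv ℝ ρ (z - u)).comp (-ContinuousLinearMap.id ℝ (Rn d))))
          u :=
        Complex.ofRealCLM.hasFDerivAt.comp u (h1.comp u h2)
      rw [h3.fderiv]
      simp
    refine ContinuousLinearMap.coe_injective ((EuclideanSpace.basisFun (Fin d) ℝ).toBasis.ext
      fun j => ?_)
    simp only [OrthonormalBasis.coe_toBasis, EuclideanSpace.basisFun_apply]
    rw [ContinuousLinearMap.coe_coe, convolution_def, ContinuousLinearMap.integral_apply hint]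
    simp only [ContinuousLinearMap.precompL_apply, ContinuousLinearMap.lsmul_apply]
    have h4 := h0 j φ
    simp only [hφ'] at h4
    rw [← integral_sub_left_eq_self _ volume z]
    simp only [sub_sub_cancel]
    change _ = (0 : ℂ)
    rw [← neg_eq_zero, ← integral_neg]
    simpa [mul_comm] using h4
  refine tendsto_nhds_unique
    (ContDiffBump.convolution_tendsto_right_of_continuous (μ := volume) hb hc x) ?_
  simp only [hconst]
  exact ContDiffBump.convolution_tendsto_right_of_continuous (μ := volume) hb hc y

theorem integral_lineDerivOp_eq_zero (φ : 𝓢(Rn d, ℂ)) (v : Rn d) : ∫ x, (∂_{v} φ) x = 0 := by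
  have h1 : Integrable fun x => (∂_{v} φ : 𝓢(Rn d, ℂ)) x := (∂_{v} φ : 𝓢(Rn d, ℂ)).integrable
  have h := integral_bilinear_hasLineDerivAt_right_eq_neg_left_of_integrable (μ := volume)
    (f := fun _ : Rn d => (1 : ℂ)) (f' := fun _ => 0) (g := φ)
    (g' := fun x => (∂_{v} φ : 𝓢(Rn d, ℂ)) x) (v := v)
    (B := ContinuousLinearMap.mul ℝ ℂ) (by simp) (by simpa using h1)
    (by simpa using φ.integrable)
    (fun x _ => by simpa using (hasFDerivAt_const (𝕜 := ℝ) (1 : ℂ) x).hasLineDerivAt v)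
    (fun x _ => by
      rw [SchwartzMap.lineDerivOp_apply_eq_fderiv]
      exact (φ.hasFDerivAt x).hasLineDerivAt v)
  simpa using h

theorem vec_eta (x : Rn 2) : !₂[x 0, x 1] = x := by
  ext i; fin_cases i <;> rfl

theorem eLpNorm_dyadicPiece_ne_top {w : ℝ → ℝ} {hw : IsDyadicWindow w} {F : 𝓢'(Rn d, ℂ)}
    (hF : MemBesov hw F) (n : ℤ) : eLpNorm (dyadicPiece hw F n) ⊤ volume ≠ ⊤ := by
  intro h
  have h1 := ENNReal.ne_top_of_tsum_ne_top hF.norm_ne_top n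
  rw [h, ENNReal.mul_top] at h1
  · exact h1 rfl
  · exact (ENNReal.zpow_pos two_ne_zero (by simp) n).ne'

theorem hasSum_besovNorm_toReal {w : ℝ → ℝ} {hw : IsDyadicWindow w} {F : 𝓢'(Rn d, ℂ)}
    (hF : MemBesov hw F) :
    HasSum (fun n : ℤ => (2 : ℝ) ^ n * (eLpNorm (dyadicPiece hw F n) ⊤ volume).toReal)
      (besovNorm hw F).toReal := by
  have h := ENNReal.hasSum_toReal hF.norm_ne_top
  rw [besovNorm, ENNReal.tsum_toReal_eq fun n => ENNReal.ne_top_of_tsum_ne_top hF.norm_ne_top n]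
  have h2 : ∀ n : ℤ, ((2 : ℝ≥0∞) ^ n).toReal = (2 : ℝ) ^ n := fun n => by
    rw [← ENNReal.rpow_intCast, ← ENNReal.toReal_rpow, Real.rpow_intCast]
    simp
  simpa [ENNReal.toReal_mul, h2] using h

/-- The Littlewood-Paley expansion of a function in the Besov class, up to constants. -/
theorem hasSum_dyadicPiece_sub {w : ℝ → ℝ} {hw : IsDyadicWindow w} {F : 𝓢'(Rn 2, ℂ)}
    {f : Rn 2 → ℂ} (hF : MemBesov hw F) (hf : IsContinuousFunction F f) (x y : Rn 2) :
    HasSum (fun n : ℤ => dyadicPiece hw F n x - dyadicPiece hw F n y) (f x - f y) := by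
  obtain ⟨C, hC, hfac⟩ := exists_hasDividedFactor_dyadicPiece hw
  let m : ℤ → ℝ := fun n => C * (2 ^ n * (eLpNorm (dyadicPiece hw F n) ⊤ volume).toReal)
  have hm0 : ∀ n, 0 ≤ m n := fun n => by positivity
  have hm : Summable m := (hasSum_besovNorm_toReal hF).summable.mul_left C
  have hcoord : ∀ (z : Rn 2) i, |z i| ≤ ‖z‖ := fun z i => by
    simpa using PiLp.norm_apply_le z i
  have hlip : ∀ n x y, ‖dyadicPiece hw F n x - dyadicPiece hw F n y‖ ≤ m n * (2 * ‖x - y‖) := by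
    intro n x y
    obtain ⟨h1, h2⟩ := hfac F f hf n (eLpNorm_dyadicPiece_ne_top hF n)
    have h3 := h1.norm_sub_le (hm0 n) (x 0) (y 0) (x 1)
    have h4 := h2.norm_sub_le (hm0 n) (x 1) (y 1) (y 0)
    simp only [vec_eta] at h3 h4
    have h5 := hcoord (x - y) 0
    have h6 := hcoord (x - y) 1
    simp only [PiLp.sub_apply] at h5 h6
    have h7 : dyadicPiece hw F n x - dyadicPiece hw F n y =
        (dyadicPiece hw F n x - dyadicPiece hw F n !₂[y 0, x 1]) +
        (dyadicPiece hw F n !₂[y 0, x 1] - dyadicPiece hw F n y) := by ring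
    rw [h7]
    refine (norm_add_le _ _).trans ((add_le_add h3 h4).trans ?_)
    calc _ ≤ m n * ‖x - y‖ + m n * ‖x - y‖ :=
          add_le_add (mul_le_mul_of_nonneg_left h5 (hm0 n)) (mul_le_mul_of_nonneg_left h6 (hm0 n))
      _ = _ := by ring
  have hsummable : ∀ x y, Summable fun n => dyadicPiece hw F n x - dyadicPiece hw F n y :=
    fun x y => .of_norm_bounded (hm.mul_right _) fun n => hlip n x y
  -- The Lipschitz bounds give convergence of differences only, so the value at `0` is subtracted
  -- from each piece.
  let g : Rn 2 → ℂ := fun x => ∑' n, (dyadicPiece hw F n x - dyadicPiece hw F n 0)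
  have hg : ∀ x y, HasSum (fun n => dyadicPiece hw F n x - dyadicPiece hw F n y) (g x - g y) := by
    intro x y
    simpa using ((hsummable x 0).hasSum.sub (hsummable y 0).hasSum)
  have hgl : ∀ x y, ‖g x - g y‖ ≤ (∑' n, m n) * (2 * ‖x - y‖) := fun x y => by
    rw [← (hg x y).tsum_eq, ← tsum_mul_right]
    exact tsum_of_norm_bounded (hm.mul_right _).hasSum fun n => hlip n x y
  have hgc : Continuous g := by
    refine (LipschitzWith.of_dist_le_mul (K := ⟨(∑' n, m n) * 2, by positivity⟩)
      fun x y => ?_).continuous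
    rw [dist_eq_norm, dist_eq_norm]
    refine (hgl x y).trans_eq ?_
    rw [← mul_assoc]
    rfl
  have hg0 : g 0 = 0 := by simp [g]
  -- By `hasSum_deriv` the functions `f` and `g` have the same distributional gradient.
  have key : ∀ (j : Fin 2) (φ : 𝓢(Rn 2, ℂ)),
      ∫ x, (f x - g x) * (∂_{(EuclideanSpace.single j 1 : Rn 2)} φ) x = 0 := by
    intro j φ
    set ψ : 𝓢(Rn 2, ℂ) := ∂_{(EuclideanSpace.single j 1 : Rn 2)} φ with hψ
    have hψ0 : ∫ x, ψ x = 0 := integral_lineDerivOp_eq_zero φ _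
    have hdom : Integrable fun x : Rn 2 => 2 * ‖x‖ * ‖ψ x‖ := by
      have := (ψ.integrable_pow_mul volume 1).const_mul 2
      simpa [mul_assoc] using this
    have hpm : ∀ n, StronglyMeasurable (dyadicPiece hw F n) := fun n =>
      stronglyMeasurable_distConv hf _
    have hgb : ∀ x, ‖g x * ψ x‖ ≤ (∑' n, m n) * (2 * ‖x‖ * ‖ψ x‖) := fun x => by
      have := hgl x 0
      rw [hg0, sub_zero, sub_zero] at this
      rw [norm_mul, ← mul_assoc]
      exact mul_le_mul_of_nonneg_right this (norm_nonneg _)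
    have hgi : Integrable fun x => g x * ψ x :=
      (hdom.const_mul _).mono' (hgc.mul ψ.continuous).aestronglyMeasurable
        (Filter.Eventually.of_forall hgb)
    have hnb : ∀ n x, ‖(dyadicPiece hw F n x - dyadicPiece hw F n 0) * ψ x‖ ≤
        m n * (2 * ‖x‖ * ‖ψ x‖) := fun n x => by
      have := hlip n x 0
      rw [sub_zero] at this
      rw [norm_mul, ← mul_assoc]
      exact mul_le_mul_of_nonneg_right this (norm_nonneg _)
    have hni : ∀ n, Integrable fun x => (dyadicPiece hw F n x - dyadicPiece hw F n 0) * ψ x :=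
      fun n => (hdom.const_mul (m n)).mono'
        (((hpm n).aestronglyMeasurable.sub aestronglyMeasurable_const).mul
          ψ.continuous.aestronglyMeasurable) (Filter.Eventually.of_forall (hnb n))
    have h1 : HasSum (fun n => ∫ x, (dyadicPiece hw F n x - dyadicPiece hw F n 0) * ψ x)
        (∫ x, g x * ψ x) := by
      refine hasSum_integral_of_dominated_convergence (fun n x => m n * (2 * ‖x‖ * ‖ψ x‖))
        (fun n => (hni n).aestronglyMeasurable)
        (fun n => Filter.Eventually.of_forall (hnb n))
        (Filter.Eventually.of_forall fun x => hm.mul_right _) ?_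
        (Filter.Eventually.of_forall fun x => ?_)
      · simp only [tsum_mul_right]
        exact hdom.const_mul _
      · exact (hsummable x 0).hasSum.mul_right _
    -- The subtracted constants disappear because `ψ` is a derivative and has integral zero.
    have h2 : ∀ n, ∫ x, (dyadicPiece hw F n x - dyadicPiece hw F n 0) * ψ x =
        ∫ x, dyadicPiece hw F n x * ψ x := fun n => by
      have h3 : ∀ x, dyadicPiece hw F n x * ψ x =
          (dyadicPiece hw F n x - dyadicPiece hw F n 0) * ψ x + dyadicPiece hw F n 0 * ψ x :=
        fun x => by ring
      simp only [h3]
      rw [integral_add (hni n) (ψ.integrable.const_mul _), integral_const_mul, hψ0, mul_zero,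
        add_zero]
    simp only [h2] at h1
    have h4 := hF.hasSum_deriv j φ
    have h5 := h1.neg.unique h4
    rw [TemperedDistribution.lineDerivOp_apply_apply, map_neg, hf.apply_eq, neg_inj] at h5
    simp only [sub_mul]
    rw [integral_sub (hf.integrable ψ) hgi, h5, sub_self]
  have hconst := eq_of_integral_mul_lineDeriv_eq_zero (hf.continuous.sub hgc) key x y
  have : f x - f y = g x - g y := by
    simp only [Pi.sub_apply] at hconst
    linear_combination hconst
  rw [this]
  exact hg x y

end Gradient

/-! ### The upper bound: Hilbert-Schmidt estimates in each argument, then Hölder. -/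

section UpperBound

variable {H : Type*} [NormedAddCommGroup H] [InnerProductSpace ℂ H]
  {K : Submodule ℂ H}

theorem norm_sum_smul_coe_sq {ι : Type*} [Fintype ι] (g : OrthonormalBasis ι ℂ K) (c : ι → ℂ) :
    ‖∑ m, c m • (g m : H)‖ ^ 2 = ∑ m, ‖c m‖ ^ 2 := by
  classical
  have hg : Orthonormal ℂ (fun i => (g i : H)) := g.orthonormal.comp_linearIsometry K.subtypeₗᵢ
  have := norm_sum_smul_sq_of_orthogonal Finset.univ (fun i => (g i : H)) 1
    (fun i j => by rw [orthonormal_iff_ite.1 hg i j]; simp) c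
  simpa using this

theorem sum_coe_mem {ι : Type*} [Fintype ι] (g : OrthonormalBasis ι ℂ K) (c : ι → ℂ) :
    ∑ m, c m • (g m : H) ∈ K :=
  Submodule.sum_mem _ fun m _ => Submodule.smul_mem _ _ (g m).2

/-- Unitarity of the transition matrix of two orthonormal bases, in the form of the hypothesis `hG`
of the Schur estimates. -/
theorem sum_norm_sq_mul_inner_right {ι κ : Type*} [Fintype ι] [Fintype κ]
    (g : OrthonormalBasis ι ℂ K) (e : OrthonormalBasis κ ℂ K) (c : ι → ℂ) :
    ∑ k, ‖∑ m, c m * inner ℂ (e k : H) (g m : H)‖ ^ 2 = ∑ m, ‖c m‖ ^ 2 := by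
  rw [← norm_sum_smul_coe_sq g c, ← sum_norm_inner_sq_coe e (sum_coe_mem g c)]
  simp only [inner_sum, inner_smul_right]

theorem sum_norm_sq_mul_inner_left {ι κ : Type*} [Fintype ι] [Fintype κ]
    (g : OrthonormalBasis ι ℂ K) (h : OrthonormalBasis κ ℂ K) (c : ι → ℂ) :
    ∑ k, ‖∑ m, c m * inner ℂ (g m : H) (h k : H)‖ ^ 2 = ∑ m, ‖c m‖ ^ 2 := by
  have := sum_norm_sq_mul_inner_right g h (fun m => star (c m))
  simp only [norm_star] at this
  rw [← this]
  refine Finset.sum_congr rfl fun k _ => ?_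
  rw [← norm_star, star_sum]
  congr 2
  refine Finset.sum_congr rfl fun m _ => ?_
  rw [star_mul', RCLike.star_def, inner_conj_symm]

variable [CompleteSpace H]

theorem schattenNorm_two_eq_sum_inner [FiniteDimensional ℂ K] {T : H →L[ℂ] H}
    (hT : ∀ x ∈ Kᗮ, T x = 0) {ι κ : Type*} [Fintype ι] [Fintype κ] (b : OrthonormalBasis ι ℂ K)
    (e : OrthonormalBasis κ ℂ K) (hTK : ∀ k, T (b k) ∈ K) :
    schattenNorm 2 T = ENNReal.ofReal √(∑ k, ∑ i, ‖inner ℂ (e i : H) (T (b k))‖ ^ 2) := by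
  rw [schattenNorm_two_eq hT b]
  simp only [sum_norm_inner_sq_coe e (hTK _)]

theorem schattenNorm_two_add_le [FiniteDimensional ℂ K] {S T : H →L[ℂ] H} (hS : ∀ x ∈ Kᗮ, S x = 0)
    (hT : ∀ x ∈ Kᗮ, T x = 0) : schattenNorm 2 (S + T) ≤ schattenNorm 2 S + schattenNorm 2 T := by
  let b := stdOrthonormalBasis ℂ K
  have hST : ∀ x ∈ Kᗮ, (S + T) x = 0 := fun x hx => by simp [hS x hx, hT x hx]
  rw [schattenNorm_two_eq hS b, schattenNorm_two_eq hT b, schattenNorm_two_eq hST b,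
    ← ENNReal.ofReal_add (by positivity) (by positivity)]
  refine ENNReal.ofReal_le_ofReal ?_
  let v : (H →L[ℂ] H) → PiLp 2 fun _ : Fin (Module.finrank ℂ K) => H := fun T =>
    WithLp.toLp 2 fun i => T (b i)
  have hv : ∀ T, ‖v T‖ = √(∑ i, ‖T (b i)‖ ^ 2) := fun T => PiLp.norm_eq_of_L2 _
  have hadd : v (S + T) = v S + v T := by ext i; simp [v]
  rw [← hv, ← hv, ← hv, hadd]
  exact norm_add_le _ _

theorem inner_pairFunction_eq_sum_left (f : Rn 2 → ℂ) {A B : H →L[ℂ] H} {m n : ℕ}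
    (hA : RankLE A m) (hB : RankLE B n) (hA' : IsSelfAdjoint A) (hB' : IsSelfAdjoint B)
    {ι : Type*} [Fintype ι] (g : OrthonormalBasis ι ℂ K) {γ : ι → ℝ}
    (hg : ∀ i, A (g i) = (γ i : ℂ) • (g i : H)) {u v : H} (hu : u ∈ K) {b : ℝ}
    (hv : B v = (b : ℂ) • v) :
    inner ℂ u (pairFunction f A B v) =
      ∑ i, f !₂[γ i, b] * inner ℂ u (g i : H) * inner ℂ (g i : H) v := by
  rw [← sum_inner_mul_inner_coe g hu]
  refine Finset.sum_congr rfl fun i _ => ?_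
  rw [inner_pairFunction f hA hB hA' hB' (hg i) hv]
  ring

theorem inner_pairFunction_eq_sum_right (f : Rn 2 → ℂ) {A B : H →L[ℂ] H} {m n : ℕ}
    (hA : RankLE A m) (hB : RankLE B n) (hA' : IsSelfAdjoint A) (hB' : IsSelfAdjoint B)
    {ι : Type*} [Fintype ι] (g : OrthonormalBasis ι ℂ K) {γ : ι → ℝ}
    (hg : ∀ i, B (g i) = (γ i : ℂ) • (g i : H)) {u v : H} (hv : v ∈ K) {a : ℝ}
    (hu : A u = (a : ℂ) • u) :
    inner ℂ u (pairFunction f A B v) =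
      ∑ i, f !₂[a, γ i] * inner ℂ u (g i : H) * inner ℂ (g i : H) v := by
  have h : pairFunction f A B v = ∑ i, inner ℂ (g i : H) v • pairFunction f A B (g i) := by
    have h1 := congrArg (fun z : K => pairFunction f A B (z : H)) (g.sum_repr ⟨v, hv⟩)
    simp only [Submodule.coe_sum, Submodule.coe_smul, map_sum, map_smul, g.repr_apply_apply,
      Submodule.coe_inner] at h1
    exact h1.symm
  rw [h, inner_sum]
  refine Finset.sum_congr rfl fun i _ => ?_
  rw [inner_smul_right, inner_pairFunction f hA hB hA' hB' hu (hg i)]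
  ring

theorem inner_eigen_left {A : H →L[ℂ] H} (hA : IsSelfAdjoint A) {a : ℝ} {u : H}
    (hu : A u = (a : ℂ) • u) (v : H) : inner ℂ u (A v) = a * inner ℂ u v := by
  rw [← ContinuousLinearMap.adjoint_inner_left, hA.adjoint_eq, hu, inner_smul_left,
    Complex.conj_ofReal]

/-- The entries are taken between eigenvectors of `A₁` and `B`, and the eigenbasis `g` of `A₂` is
inserted in the middle. Then `X i m = (α i - γ m) ⟨e i, g m⟩` is the matrix of `A₁ - A₂`. -/
theorem schattenNorm_two_pairFunction_sub_left [FiniteDimensional ℂ K] {τ : Type*}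
    (f : Rn 2 → ℂ) (fn : τ → Rn 2 → ℂ) (Mn : τ → ℝ) (hM0 : ∀ n, 0 ≤ Mn n) (hM : Summable Mn)
    (hfn : ∀ n, HasDividedFactor (fun x y => fn n !₂[x, y]) (Mn n))
    (hf : ∀ x y, HasSum (fun n => fn n x - fn n y) (f x - f y)) {A₁ A₂ B : H →L[ℂ] H} {N : ℕ}
    (hA₁ : IsSelfAdjoint A₁) (hA₂ : IsSelfAdjoint A₂) (hB : IsSelfAdjoint B)
    (hA₁N : RankLE A₁ N) (hA₂N : RankLE A₂ N) (hBN : RankLE B N) (hA₁K : ∀ x, A₁ x ∈ K)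
    (hA₂K : ∀ x, A₂ x ∈ K) (hBK : ∀ x, B x ∈ K) :
    schattenNorm 2 (pairFunction f A₁ B - pairFunction f A₂ B) ≤
      ENNReal.ofReal (∑' n, Mn n) * schattenNorm 2 (A₁ - A₂) := by
  obtain ⟨e, α, he⟩ := exists_eigenbasis hA₁ hA₁K
  obtain ⟨g, γ, hg⟩ := exists_eigenbasis hA₂ hA₂K
  obtain ⟨h, β, hh⟩ := exists_eigenbasis hB hBK
  have hR : ∀ x ∈ Kᗮ, (pairFunction f A₁ B - pairFunction f A₂ B) x = 0 := fun x hx => by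
    rw [sub_apply, pairFunction_apply_of_mem_orthogonal f hA₁N hBN hA₁ hB hA₁K hBK hx,
      pairFunction_apply_of_mem_orthogonal f hA₂N hBN hA₂ hB hA₂K hBK hx, sub_self]
  have hT : ∀ x ∈ Kᗮ, (A₁ - A₂) x = 0 := fun x hx => by
    rw [sub_apply, apply_eq_zero_of_mem_orthogonal hA₁ hA₁K hx,
      apply_eq_zero_of_mem_orthogonal hA₂ hA₂K hx, sub_self]
  rw [schattenNorm_two_eq_sum_inner hR h e fun k => K.sub_mem
      (pairFunction_apply_mem f hA₁N hBN hA₁ hB hA₁K (hh k) (h k).2)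
      (pairFunction_apply_mem f hA₂N hBN hA₂ hB hA₂K (hh k) (h k).2),
    schattenNorm_two_eq_sum_inner hT g e fun k => K.sub_mem (hA₁K _) (hA₂K _),
    ← ENNReal.ofReal_mul (tsum_nonneg hM0)]
  refine ENNReal.ofReal_le_ofReal ?_
  rw [Finset.sum_comm, Finset.sum_comm (f := fun k i => ‖inner ℂ (e i : H) ((A₁ - A₂) (g k))‖ ^ 2)]
  refine le_of_eq_of_le ?_ (sqrt_sum_norm_sq_le_of_hasSum (F := fun x y => f !₂[x, y])
    (fun n x y => fn n !₂[x, y]) Mn hM0 hM hfn (fun _ _ _ => hf _ _) α γ β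
    (fun i m => inner ℂ (e i : H) ((A₁ - A₂) (g m))) (fun i m => inner ℂ (e i : H) (g m : H))
    (fun i m => ?_) (fun m k => inner ℂ (g m : H) (h k : H)) (sum_norm_sq_mul_inner_left g h))
  · congr 1
    refine Finset.sum_congr rfl fun i _ => Finset.sum_congr rfl fun k _ => ?_
    rw [sub_apply, inner_sub_right,
      inner_pairFunction_eq_sum_left f hA₂N hBN hA₂ hB g hg (e i).2 (hh k),
      inner_pairFunction f hA₁N hBN hA₁ hB (he i) (hh k),
      ← sum_inner_mul_inner_coe g (e i).2, Finset.mul_sum, ← Finset.sum_sub_distrib]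
    congr 2
    refine Finset.sum_congr rfl fun m _ => ?_
    ring
  · simp only [sub_apply, inner_sub_right]
    rw [inner_eigen_left hA₁ (he i), hg, inner_smul_right]
    ring

theorem schattenNorm_two_pairFunction_sub_right [FiniteDimensional ℂ K] {τ : Type*}
    (f : Rn 2 → ℂ) (fn : τ → Rn 2 → ℂ) (Mn : τ → ℝ) (hM0 : ∀ n, 0 ≤ Mn n) (hM : Summable Mn)
    (hfn : ∀ n, HasDividedFactor (fun y x => fn n !₂[x, y]) (Mn n))
    (hf : ∀ x y, HasSum (fun n => fn n x - fn n y) (f x - f y)) {A B₁ B₂ : H →L[ℂ] H} {N : ℕ}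
    (hA : IsSelfAdjoint A) (hB₁ : IsSelfAdjoint B₁) (hB₂ : IsSelfAdjoint B₂)
    (hAN : RankLE A N) (hB₁N : RankLE B₁ N) (hB₂N : RankLE B₂ N) (hAK : ∀ x, A x ∈ K)
    (hB₁K : ∀ x, B₁ x ∈ K) (hB₂K : ∀ x, B₂ x ∈ K) :
    schattenNorm 2 (pairFunction f A B₁ - pairFunction f A B₂) ≤
      ENNReal.ofReal (∑' n, Mn n) * schattenNorm 2 (B₁ - B₂) := by
  obtain ⟨e, α, he⟩ := exists_eigenbasis hA hAK
  obtain ⟨g, γ, hg⟩ := exists_eigenbasis hB₂ hB₂K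
  obtain ⟨h, β, hh⟩ := exists_eigenbasis hB₁ hB₁K
  have hR : ∀ x ∈ Kᗮ, (pairFunction f A B₁ - pairFunction f A B₂) x = 0 := fun x hx => by
    rw [sub_apply, pairFunction_apply_of_mem_orthogonal f hAN hB₁N hA hB₁ hAK hB₁K hx,
      pairFunction_apply_of_mem_orthogonal f hAN hB₂N hA hB₂ hAK hB₂K hx, sub_self]
  have hT : ∀ x ∈ Kᗮ, (B₁ - B₂) x = 0 := fun x hx => by
    rw [sub_apply, apply_eq_zero_of_mem_orthogonal hB₁ hB₁K hx,
      apply_eq_zero_of_mem_orthogonal hB₂ hB₂K hx, sub_self]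
  -- The basis `h` consists of eigenvectors of `B₁`, not of `B₂`, so invariance of `K` is obtained
  -- by expanding in the eigenbasis `g` of `B₂`.
  have hmem : ∀ x ∈ K, pairFunction f A B₂ x ∈ K := fun x hx => by
    have h1 := congrArg (fun z : K => pairFunction f A B₂ (z : H)) (g.sum_repr ⟨x, hx⟩)
    simp only [Submodule.coe_sum, Submodule.coe_smul, map_sum, map_smul] at h1
    rw [← h1]
    exact K.sum_mem fun i _ => K.smul_mem _
      (pairFunction_apply_mem f hAN hB₂N hA hB₂ hAK (hg i) (g i).2)
  rw [schattenNorm_two_eq_sum_inner hR h e fun k => K.sub_mem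
      (pairFunction_apply_mem f hAN hB₁N hA hB₁ hAK (hh k) (h k).2) (hmem _ (h k).2),
    schattenNorm_two_eq_sum_inner hT h g fun k => K.sub_mem (hB₁K _) (hB₂K _),
    ← ENNReal.ofReal_mul (tsum_nonneg hM0)]
  refine ENNReal.ofReal_le_ofReal ?_
  refine le_of_eq_of_le ?_ (sqrt_sum_norm_sq_le_of_hasSum (F := fun y x => f !₂[x, y])
    (fun n y x => fn n !₂[x, y]) Mn hM0 hM hfn (fun _ _ _ => hf _ _) β γ α
    (fun k m => inner ℂ (g m : H) ((B₁ - B₂) (h k))) (fun k m => inner ℂ (g m : H) (h k : H))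
    (fun k m => ?_) (fun m i => inner ℂ (e i : H) (g m : H)) (sum_norm_sq_mul_inner_right g e))
  · congr 1
    refine Finset.sum_congr rfl fun k _ => Finset.sum_congr rfl fun i _ => ?_
    rw [sub_apply, inner_sub_right,
      inner_pairFunction_eq_sum_right f hAN hB₂N hA hB₂ g hg (h k).2 (he i),
      inner_pairFunction f hAN hB₁N hA hB₁ (he i) (hh k),
      ← sum_inner_mul_inner_coe g (e i).2, Finset.mul_sum, ← Finset.sum_sub_distrib]
    congr 2
    refine Finset.sum_congr rfl fun m _ => ?_
    ring
  · simp only [sub_apply, inner_sub_right]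
    rw [inner_eigen_left hB₂ (hg m), hh, inner_smul_right]
    ring

/-- A finite dimensional subspace containing the ranges of four operators of finite rank. -/
theorem exists_finiteDimensional_range {H : Type*} [NormedAddCommGroup H] [InnerProductSpace ℂ H]
    {A₁ B₁ A₂ B₂ : H →L[ℂ] H} {N : ℕ} (hA₁ : RankLE A₁ N) (hB₁ : RankLE B₁ N)
    (hA₂ : RankLE A₂ N) (hB₂ : RankLE B₂ N) :
    ∃ K : Submodule ℂ H, FiniteDimensional ℂ K ∧ (∀ x, A₁ x ∈ K) ∧ (∀ x, B₁ x ∈ K) ∧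
      (∀ x, A₂ x ∈ K) ∧ ∀ x, B₂ x ∈ K := by
  have h1 := hA₁.finite_range
  have h2 := hB₁.finite_range
  have h3 := hA₂.finite_range
  have h4 := hB₂.finite_range
  refine ⟨(LinearMap.range (A₁ : H →ₗ[ℂ] H) ⊔ LinearMap.range (B₁ : H →ₗ[ℂ] H)) ⊔
    (LinearMap.range (A₂ : H →ₗ[ℂ] H) ⊔ LinearMap.range (B₂ : H →ₗ[ℂ] H)), inferInstance,
    fun x => ?_, fun x => ?_, fun x => ?_, fun x => ?_⟩
  · exact Submodule.mem_sup_left (Submodule.mem_sup_left (LinearMap.mem_range_self _ x))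
  · exact Submodule.mem_sup_left (Submodule.mem_sup_right (LinearMap.mem_range_self _ x))
  · exact Submodule.mem_sup_right (Submodule.mem_sup_left (LinearMap.mem_range_self _ x))
  · exact Submodule.mem_sup_right (Submodule.mem_sup_right (LinearMap.mem_range_self _ x))

theorem half_sub_inv_mem_Icc {p : ℝ≥0∞} (hp : 2 ≤ p) :
    (1 : ℝ) / 2 - 1 / p.toReal ∈ Set.Icc (0 : ℝ) 1 := by
  by_cases h : p = ⊤
  · simp [h]; norm_num
  · have h2 := two_le_toReal hp h
    have h3 : 1 / p.toReal ≤ 1 / 2 := one_div_le_one_div_of_le two_pos h2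
    have h4 : 0 ≤ 1 / p.toReal := by positivity
    constructor <;> linarith

theorem exists_schattenNorm_pairFunction_sub_le {w : ℝ → ℝ} (hw : IsDyadicWindow w) :
    ∃ C : ℝ≥0, ∀ (p : ℝ≥0∞) (_ : 2 ≤ p) (N : ℕ)
      (H : Type*) [NormedAddCommGroup H] [InnerProductSpace ℂ H] [CompleteSpace H]
      (A₁ B₁ A₂ B₂ : H →L[ℂ] H)
      (_ : IsSelfAdjoint A₁) (_ : IsSelfAdjoint B₁) (_ : IsSelfAdjoint A₂) (_ : IsSelfAdjoint B₂)
      (_ : RankLE A₁ N) (_ : RankLE B₁ N) (_ : RankLE A₂ N) (_ : RankLE B₂ N)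
      (F : 𝓢'(Rn 2, ℂ)) (f : Rn 2 → ℂ) (_ : MemBesov hw F) (_ : IsContinuousFunction F f),
      schattenNorm p (pairFunction f A₁ B₁ - pairFunction f A₂ B₂) ≤
        C * (N : ℝ≥0∞) ^ ((1 : ℝ) / 2 - 1 / p.toReal) * besovNorm hw F *
          max (schattenNorm p (A₁ - A₂)) (schattenNorm p (B₁ - B₂)) := by
  obtain ⟨C, hC, hfac⟩ := exists_hasDividedFactor_dyadicPiece hw
  -- A factor `2` for the two arguments, changed one after the other, and a factor `2` from `(2N)^q
  -- ≤ 2 N^q`.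
  refine ⟨4 * C.toNNReal, fun p hp N H _ _ _ A₁ B₁ A₂ B₂ hA₁ hB₁ hA₂ hB₂ hA₁N hB₁N hA₂N hB₂N F f
    hF hf => ?_⟩
  obtain ⟨K, hK, hA₁K, hB₁K, hA₂K, hB₂K⟩ := exists_finiteDimensional_range hA₁N hB₁N hA₂N hB₂N
  let m : ℤ → ℝ := fun n => C * (2 ^ n * (eLpNorm (dyadicPiece hw F n) ⊤ volume).toReal)
  have hm0 : ∀ n, 0 ≤ m n := fun n => by positivity
  have hms : HasSum m (C * (besovNorm hw F).toReal) := (hasSum_besovNorm_toReal hF).mul_left C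
  have hS : ENNReal.ofReal (∑' n, m n) = C.toNNReal * besovNorm hw F := by
    rw [hms.tsum_eq, ENNReal.ofReal_mul hC, ENNReal.ofReal_toReal hF.norm_ne_top]
    rfl
  have hfac' := fun n => hfac F f hf n (eLpNorm_dyadicPiece_ne_top hF n)
  have hsum := hasSum_dyadicPiece_sub hF hf
  have h1 := schattenNorm_two_pairFunction_sub_left f _ m hm0 hms.summable (fun n => (hfac' n).1)
    hsum hA₁ hA₂ hB₁ hA₁N hA₂N hB₁N hA₁K hA₂K hB₁K
  have h2 := schattenNorm_two_pairFunction_sub_right f _ m hm0 hms.summable (fun n => (hfac' n).2)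
    hsum hA₂ hB₁ hB₂ hA₂N hB₁N hB₂N hA₂K hB₁K hB₂K
  have hadd : pairFunction f A₁ B₁ - pairFunction f A₂ B₂ =
      (pairFunction f A₁ B₁ - pairFunction f A₂ B₁) +
        (pairFunction f A₂ B₁ - pairFunction f A₂ B₂) := by abel
  have hR₁ : ∀ x ∈ Kᗮ, (pairFunction f A₁ B₁ - pairFunction f A₂ B₁) x = 0 := fun x hx => by
    rw [sub_apply, pairFunction_apply_of_mem_orthogonal f hA₁N hB₁N hA₁ hB₁ hA₁K hB₁K hx,
      pairFunction_apply_of_mem_orthogonal f hA₂N hB₁N hA₂ hB₁ hA₂K hB₁K hx, sub_self]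
  have hR₂ : ∀ x ∈ Kᗮ, (pairFunction f A₂ B₁ - pairFunction f A₂ B₂) x = 0 := fun x hx => by
    rw [sub_apply, pairFunction_apply_of_mem_orthogonal f hA₂N hB₁N hA₂ hB₁ hA₂K hB₁K hx,
      pairFunction_apply_of_mem_orthogonal f hA₂N hB₂N hA₂ hB₂ hA₂K hB₂K hx, sub_self]
  rw [hS] at h1 h2
  set q := (1 : ℝ) / 2 - 1 / p.toReal with hq
  obtain ⟨hq0, hq1⟩ : q ∈ Set.Icc (0 : ℝ) 1 := half_sub_inv_mem_Icc hp
  have hrank : ((N + N : ℕ) : ℝ≥0∞) ^ q ≤ 2 * (N : ℝ≥0∞) ^ q := by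
    rw [← two_mul, Nat.cast_mul, ENNReal.mul_rpow_of_nonneg _ _ hq0]
    gcongr
    calc ((2 : ℕ) : ℝ≥0∞) ^ q ≤ ((2 : ℕ) : ℝ≥0∞) ^ (1 : ℝ) :=
          ENNReal.rpow_le_rpow_of_exponent_le (by norm_num) hq1
      _ = 2 := by simp
  have h3 : schattenNorm 2 (A₁ - A₂) ≤ 2 * (N : ℝ≥0∞) ^ q *
      max (schattenNorm p (A₁ - A₂)) (schattenNorm p (B₁ - B₂)) :=
    (schattenNorm_two_le_rank_mul hp (hA₁N.sub hA₂N)).trans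
      (mul_le_mul' hrank (le_max_left _ _))
  have h4 : schattenNorm 2 (B₁ - B₂) ≤ 2 * (N : ℝ≥0∞) ^ q *
      max (schattenNorm p (A₁ - A₂)) (schattenNorm p (B₁ - B₂)) :=
    (schattenNorm_two_le_rank_mul hp (hB₁N.sub hB₂N)).trans
      (mul_le_mul' hrank (le_max_right _ _))
  calc schattenNorm p (pairFunction f A₁ B₁ - pairFunction f A₂ B₂)
      ≤ schattenNorm 2 (pairFunction f A₁ B₁ - pairFunction f A₂ B₁) +
        schattenNorm 2 (pairFunction f A₂ B₁ - pairFunction f A₂ B₂) := by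
        rw [hadd]
        exact (schattenNorm_le_schattenNorm_two hp _).trans (schattenNorm_two_add_le hR₁ hR₂)
    _ ≤ C.toNNReal * besovNorm hw F * (2 * (N : ℝ≥0∞) ^ q *
          max (schattenNorm p (A₁ - A₂)) (schattenNorm p (B₁ - B₂))) +
        C.toNNReal * besovNorm hw F * (2 * (N : ℝ≥0∞) ^ q *
          max (schattenNorm p (A₁ - A₂)) (schattenNorm p (B₁ - B₂))) :=
        add_le_add (h1.trans (mul_le_mul_right h3 _)) (h2.trans (mul_le_mul_right h4 _))
    _ = _ := by push_cast; ring

end UpperBound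

/-! ### Superpositions of translates of `W_0` in the Besov class. -/

section LatticeFunction

variable {w : ℝ → ℝ}

theorem IsDyadicWindow.eq_zero_of_le (hw : IsDyadicWindow w) {s : ℝ} (hs : s ≤ 1 / 2) :
    w s = 0 := by
  have hcl : IsClosed {s | w s = 0} := isClosed_eq hw.smooth.continuous continuous_const
  have hsub : Set.Iio (1 / 2 : ℝ) ⊆ {s | w s = 0} := fun t ht => by
    by_contra h
    exact absurd (hw.support_subset h).1 (not_le.2 ht)
  have := hcl.closure_subset_iff.2 hsub
  rw [closure_Iio] at this
  exact this hs

theorem IsDyadicWindow.eq_zero_of_ge (hw : IsDyadicWindow w) {s : ℝ} (hs : 2 ≤ s) : w s = 0 := by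
  have hcl : IsClosed {s | w s = 0} := isClosed_eq hw.smooth.continuous continuous_const
  have hsub : Set.Ioi (2 : ℝ) ⊆ {s | w s = 0} := fun t ht => by
    by_contra h
    exact absurd (hw.support_subset h).2 (not_le.2 ht)
  have := hcl.closure_subset_iff.2 hsub
  rw [closure_Ioi] at this
  exact this hs

/-- On each side of `s = 1` one of the three terms vanishes and the other two are the partition
identity. Hence `W_0` is the sum of its own pieces with `n = -1, 0, 1`. -/
theorem IsDyadicWindow.sum_eq_one (hw : IsDyadicWindow w) {s : ℝ} (hs : w s ≠ 0) :
    w (2 * s) + w s + w (s / 2) = 1 := by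
  obtain ⟨h1, h2⟩ := hw.support_subset hs
  rcases le_total s 1 with h | h
  · have h3 := hw.partition (2 * s) ⟨by linarith, by linarith⟩
    rw [mul_div_cancel_left₀ s two_ne_zero] at h3
    rw [hw.eq_zero_of_le (show s / 2 ≤ 1 / 2 by linarith)]
    linarith
  · have h3 := hw.partition s ⟨h, h2⟩
    rw [hw.eq_zero_of_ge (show 2 ≤ 2 * s by linarith)]
    linarith

theorem IsDyadicWindow.apply_one (hw : IsDyadicWindow w) : w 1 = 1 := by
  rw [hw.partition 1 ⟨le_rfl, one_le_two⟩, hw.eq_zero_of_le le_rfl, sub_zero]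

theorem IsDyadicWindow.mul_eq_zero (hw : IsDyadicWindow w) {n : ℤ}
    (hn : n ∉ ({-1, 0, 1} : Finset ℤ)) (s : ℝ) : w s * w (s / 2 ^ n) = 0 := by
  by_cases h : w s = 0
  · rw [h, zero_mul]
  have h1 : 1 / 2 < s := not_le.1 fun h' => h (hw.eq_zero_of_le h')
  have h2 : s < 2 := not_le.1 fun h' => h (hw.eq_zero_of_ge h')
  have h0 : (0 : ℝ) < 2 ^ n := by positivity
  have h3 : n ≤ -2 ∨ 2 ≤ n := by
    simp only [Finset.mem_insert, Finset.mem_singleton] at hn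
    omega
  rcases h3 with h3 | h3
  · have h4 : (2 : ℝ) ^ n ≤ 2 ^ (-2 : ℤ) := zpow_le_zpow_right₀ one_le_two h3
    rw [hw.eq_zero_of_ge (s := s / 2 ^ n), mul_zero]
    rw [le_div_iff₀ h0]
    norm_num at h4
    linarith
  · have h4 : (2 : ℝ) ^ (2 : ℤ) ≤ 2 ^ n := zpow_le_zpow_right₀ one_le_two h3
    rw [hw.eq_zero_of_le (s := s / 2 ^ n), mul_zero]
    rw [div_le_iff₀ h0]
    norm_num at h4
    linarith

/-- The Littlewood-Paley pieces of `W_0`. -/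
def kernelPiece (hw : IsDyadicWindow w) (n : ℤ) : 𝓢(Rn 2, ℂ) :=
  SchwartzMap.convolution (ContinuousLinearMap.mul ℂ ℂ) (dyadicKernel 2 hw 0) (dyadicKernel 2 hw n)

theorem fourier_dyadicKernel (hw : IsDyadicWindow w) (n : ℤ) (ξ : Rn 2) :
    (𝓕 (dyadicKernel 2 hw n)) ξ = dyadicSymbol 2 w n ξ := by
  rw [dyadicKernel, FourierTransform.fourier_fourierInv_eq]
  rfl

theorem fourier_kernelPiece (hw : IsDyadicWindow w) (n : ℤ) (ξ : Rn 2) :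
    (𝓕 (kernelPiece hw n)) ξ = dyadicSymbol 2 w 0 ξ * dyadicSymbol 2 w n ξ := by
  rw [kernelPiece, SchwartzMap.fourier_convolution, SchwartzMap.pairing_apply_apply,
    fourier_dyadicKernel, fourier_dyadicKernel]
  rfl

theorem schwartz_ext_of_fourier {φ ψ : 𝓢(Rn 2, ℂ)} (h : ∀ ξ, (𝓕 φ) ξ = (𝓕 ψ) ξ) : φ = ψ := by
  have h1 : 𝓕 φ = 𝓕 ψ := DFunLike.ext _ _ h
  have h2 := congrArg (fun χ : 𝓢(Rn 2, ℂ) => 𝓕⁻ χ) h1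
  simpa only [FourierTransform.fourierInv_fourier_eq] using h2

theorem kernelPiece_eq_zero (hw : IsDyadicWindow w) {n : ℤ} (hn : n ∉ ({-1, 0, 1} : Finset ℤ)) :
    kernelPiece hw n = 0 := by
  refine schwartz_ext_of_fourier fun ξ => ?_
  have h0 : 𝓕 (0 : 𝓢(Rn 2, ℂ)) = 0 := FourierTransform.fourier_zero
  rw [fourier_kernelPiece, h0, zero_apply]
  have := hw.mul_eq_zero hn (2 * Real.pi * ‖ξ‖)
  simp only [dyadicSymbol, zpow_zero, div_one]
  exact_mod_cast this

theorem sum_kernelPiece (hw : IsDyadicWindow w) :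
    ∑ n ∈ ({-1, 0, 1} : Finset ℤ), kernelPiece hw n = dyadicKernel 2 hw 0 := by
  refine schwartz_ext_of_fourier fun ξ => ?_
  have h1 : 𝓕 (∑ n ∈ ({-1, 0, 1} : Finset ℤ), kernelPiece hw n) =
      ∑ n ∈ ({-1, 0, 1} : Finset ℤ), 𝓕 (kernelPiece hw n) :=
    map_sum (FourierTransform.fourierCLE ℂ 𝓢(Rn 2, ℂ)) _ _
  rw [h1, sum_apply]
  simp only [fourier_kernelPiece, fourier_dyadicKernel]
  rw [← Finset.mul_sum]
  by_cases h : w (2 * Real.pi * ‖ξ‖) = 0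
  · simp [dyadicSymbol, h]
  have h2 := hw.sum_eq_one h
  have h3 : ∑ n ∈ ({-1, 0, 1} : Finset ℤ), dyadicSymbol 2 w n ξ = 1 := by
    rw [Finset.sum_insert (by decide), Finset.sum_insert (by decide), Finset.sum_singleton]
    simp only [dyadicSymbol, zpow_zero, div_one, zpow_one, zpow_neg, div_inv_eq_mul]
    rw [mul_comm _ (2 : ℝ)]
    rw [← add_assoc]
    exact_mod_cast h2
  rw [h3, mul_one]

theorem dyadicKernel_zero_ne_zero (hw : IsDyadicWindow w) : ∃ u, dyadicKernel 2 hw 0 u ≠ 0 := by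
  by_contra! h
  have h0 : dyadicKernel 2 hw 0 = 0 := DFunLike.ext _ _ h
  have h1 := fourier_dyadicKernel hw 0 (EuclideanSpace.single 0 (1 / (2 * Real.pi)))
  have h2 : 𝓕 (0 : 𝓢(Rn 2, ℂ)) = 0 := FourierTransform.fourier_zero
  rw [h0, h2, dyadicSymbol] at h1
  have h3 : 2 * Real.pi * ‖(EuclideanSpace.single 0 (1 / (2 * Real.pi)) : Rn 2)‖ / 2 ^ (0 : ℤ) =
      1 := by
    rw [PiLp.norm_single, Real.norm_of_nonneg (by positivity)]
    field_simp
  rw [h3, hw.apply_one] at h1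
  simp at h1

/-- A superposition of translates of `W_0` and its Littlewood-Paley pieces. -/
theorem exists_translates (hw : IsDyadicWindow w) {ι : Type*} [Fintype ι] (c : ι → ℂ)
    (p : ι → Rn 2) : ∃ F : 𝓢'(Rn 2, ℂ),
      IsContinuousFunction F (fun x => ∑ q, c q * dyadicKernel 2 hw 0 (x - p q)) ∧
      ∀ n x, dyadicPiece hw F n x = ∑ q, c q * kernelPiece hw n (x - p q) := by
  let g : 𝓢(Rn 2, ℂ) := ∑ q, c q • (dyadicKernel 2 hw 0).compSubConstCLM ℂ (p q)
  have hg : ∀ x, g x = ∑ q, c q * dyadicKernel 2 hw 0 (x - p q) := fun x => by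
    simp [g]
  have hF : IsContinuousFunction (SchwartzMap.toTemperedDistributionCLM (Rn 2) ℂ volume g)
      (fun x => ∑ q, c q * dyadicKernel 2 hw 0 (x - p q)) := by
    simp only [← hg]
    refine ⟨g.continuous, fun φ => ?_, fun φ => ?_⟩
    · exact (SchwartzMap.pairing (ContinuousLinearMap.mul ℂ ℂ) g φ).integrable
    · refine (SchwartzMap.toTemperedDistributionCLM_apply_apply (μ := volume) g φ).trans ?_
      simp only [smul_eq_mul, mul_comm]
  refine ⟨_, hF, fun n x => ?_⟩
  rw [dyadicPiece, distConv_eq_integral hF]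
  have hint : ∀ y : Rn 2, Integrable fun z =>
      dyadicKernel 2 hw 0 z * dyadicKernel 2 hw n (y - z) := by
    intro y
    refine (dyadicKernel 2 hw 0).integrable.mul_bdd
      (c := SchwartzMap.seminorm ℂ 0 0 (dyadicKernel 2 hw n)) ?_
      (Filter.Eventually.of_forall fun z => SchwartzMap.norm_le_seminorm ℂ _ _)
    exact ((dyadicKernel 2 hw n).continuous.comp (by fun_prop)).aestronglyMeasurable
  simp only [Finset.sum_mul]
  have hx : ∀ q z, x - z = (x - p q) - (z - p q) := fun q z => by abel
  rw [integral_finsetSum]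
  · refine Finset.sum_congr rfl fun q _ => ?_
    simp only [mul_assoc]
    rw [integral_const_mul, kernelPiece, SchwartzMap.convolution_apply, convolution_def]
    congr 1
    refine (integral_add_right_eq_self _ (p q)).symm.trans ?_
    simp only [add_sub_cancel_right, sub_add_eq_sub_sub_swap]
    rfl
  · intro q _
    simp only [mul_assoc]
    refine Integrable.const_mul ?_ _
    simpa only [← hx q] using (hint (x - p q)).comp_sub_right (p q)

/-- Only the pieces with `n = -1, 0, 1` survive, and `7 / 2` is `2⁻¹ + 1 + 2`. The series of
derivatives is a finite sum. -/
theorem memBesov_of_translates (hw : IsDyadicWindow w) {ι : Type*} [Fintype ι] {c : ι → ℂ}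
    {p : ι → Rn 2} (M : ℝ)
    (hM : ∀ n ∈ ({-1, 0, 1} : Finset ℤ), ∀ x, ‖∑ q, c q * kernelPiece hw n (x - p q)‖ ≤ M)
    {F : 𝓢'(Rn 2, ℂ)}
    (hF : IsContinuousFunction F fun x => ∑ q, c q * dyadicKernel 2 hw 0 (x - p q))
    (hFn : ∀ n x, dyadicPiece hw F n x = ∑ q, c q * kernelPiece hw n (x - p q)) :
    MemBesov hw F ∧ besovNorm hw F ≤ ENNReal.ofReal (7 / 2 * M) := by
  have hM0 : 0 ≤ M := (norm_nonneg _).trans (hM 0 (by decide) 0)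
  have hzero : ∀ n ∉ ({-1, 0, 1} : Finset ℤ), dyadicPiece hw F n = 0 := fun n hn => by
    ext x
    simp [hFn, kernelPiece_eq_zero hw hn]
  have hle : ∀ n ∈ ({-1, 0, 1} : Finset ℤ), eLpNorm (dyadicPiece hw F n) ⊤ volume ≤
      ENNReal.ofReal M := fun n hn => by
    rw [eLpNorm_exponent_top]
    refine eLpNormEssSup_le_of_ae_bound (Filter.Eventually.of_forall fun x => ?_)
    rw [hFn]
    exact hM n hn x
  have hnorm : besovNorm hw F ≤ ENNReal.ofReal (7 / 2 * M) := by
    rw [besovNorm, tsum_eq_sum (s := ({-1, 0, 1} : Finset ℤ)) fun n hn => by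
      rw [hzero n hn]; simp]
    refine (Finset.sum_le_sum fun n hn => mul_le_mul_right (hle n hn) _).trans ?_
    rw [← Finset.sum_mul, ENNReal.ofReal_mul (by norm_num)]
    refine mul_le_mul_left ?_ _
    rw [Finset.sum_insert (by decide), Finset.sum_insert (by decide), Finset.sum_singleton]
    rw [zpow_zero, zpow_one, ENNReal.zpow_neg, zpow_one]
    have h2 : (2 : ℝ≥0∞) = ENNReal.ofReal 2 := by simp
    rw [h2, ← ENNReal.ofReal_inv_of_pos two_pos, ← ENNReal.ofReal_one,
      ← ENNReal.ofReal_add one_pos.le two_pos.le,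
      ← ENNReal.ofReal_add (by norm_num) (by norm_num)]
    exact ENNReal.ofReal_le_ofReal (by norm_num)
  refine ⟨⟨ne_top_of_le_ne_top ENNReal.ofReal_ne_top hnorm, fun j φ => ?_⟩, hnorm⟩
  rw [TemperedDistribution.lineDerivOp_apply_apply, map_neg, hF.apply_eq]
  set χ : 𝓢(Rn 2, ℂ) := ∂_{(EuclideanSpace.single j 1 : Rn 2)} φ
  have hint : ∀ n ∈ ({-1, 0, 1} : Finset ℤ), Integrable fun x => dyadicPiece hw F n x * χ x := by
    intro n hn
    refine χ.integrable.bdd_mul (c := M) (stronglyMeasurable_distConv hF _).aestronglyMeasurable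
      (Filter.Eventually.of_forall fun x => ?_)
    rw [hFn]
    exact hM n hn x
  have hsum : ∫ x, (∑ q, c q * dyadicKernel 2 hw 0 (x - p q)) * χ x =
      ∑ n ∈ ({-1, 0, 1} : Finset ℤ), ∫ x, dyadicPiece hw F n x * χ x := by
    rw [← integral_finsetSum _ hint]
    refine integral_congr_ae (Filter.Eventually.of_forall fun x => ?_)
    simp only [hFn]
    rw [← Finset.sum_mul, Finset.sum_comm]
    simp only [← Finset.mul_sum, ← sum_apply, sum_kernelPiece]
  rw [hsum, ← Finset.sum_neg_distrib]
  refine hasSum_sum_of_ne_finset_zero fun n hn => ?_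
  simp [hzero n hn]

end LatticeFunction

/-! ### Prescribing increments on a sparse grid. -/

section Interpolation

/-- Within `ℓ / 2` of one centre all other centres are at distance at least `ℓ / 2`, so their terms
are tails. -/
theorem norm_sum_translates_sub_le {ι V : Type*} [Fintype ι] [NormedAddCommGroup V] {p : ι → V}
    {ℓ : ℝ} (hp : ∀ q q', q ≠ q' → ℓ ≤ ‖p q - p q'‖) {c : ι → ℂ} {κ η : ℝ} (hc : ∀ q, ‖c q‖ ≤ κ)
    {g : V → ℂ} (hη : 0 ≤ η) (hg : ∀ u, ℓ / 2 ≤ ‖u‖ → ‖g u‖ ≤ η) {x : V} {q₀ : ι}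
    (hx : ‖x - p q₀‖ ≤ ℓ / 2) :
    ‖∑ q, c q * g (x - p q) - c q₀ * g (x - p q₀)‖ ≤ κ * (Fintype.card ι * η) := by
  classical
  have hκ : 0 ≤ κ := (norm_nonneg _).trans (hc q₀)
  rw [← Finset.sum_erase_eq_sub (Finset.mem_univ q₀)]
  calc ‖∑ q ∈ Finset.univ.erase q₀, c q * g (x - p q)‖
      ≤ ∑ q ∈ Finset.univ.erase q₀, κ * η := norm_sum_le_of_le _ fun q hq => by
        rw [norm_mul]
        refine mul_le_mul (hc q) (hg _ ?_) (norm_nonneg _) hκ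
        have h1 := hp q₀ q (Finset.ne_of_mem_erase hq).symm
        have h2 : p q₀ - p q = (x - p q) - (x - p q₀) := by abel
        have h3 := norm_sub_le (x - p q) (x - p q₀)
        rw [← h2] at h3
        linarith
    _ ≤ ∑ q : ι, κ * η := Finset.sum_le_sum_of_subset_of_nonneg (Finset.erase_subset _ _)
        fun _ _ _ => mul_nonneg hκ hη
    _ = κ * (Fintype.card ι * η) := by
        rw [Finset.sum_const, Finset.card_univ, nsmul_eq_mul]; ring

theorem norm_sum_translates_le {ι V : Type*} [Fintype ι] [NormedAddCommGroup V] {p : ι → V}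
    {ℓ : ℝ} (hp : ∀ q q', q ≠ q' → ℓ ≤ ‖p q - p q'‖) {c : ι → ℂ} {κ η M : ℝ} (hκ : 0 ≤ κ)
    (hc : ∀ q, ‖c q‖ ≤ κ) {g : V → ℂ} (hη : 0 ≤ η) (hg : ∀ u, ℓ / 2 ≤ ‖u‖ → ‖g u‖ ≤ η)
    (hM : ∀ u, ‖g u‖ ≤ M) (x : V) :
    ‖∑ q, c q * g (x - p q)‖ ≤ κ * (M + Fintype.card ι * η) := by
  have hM0 : 0 ≤ M := (norm_nonneg _).trans (hM 0)
  by_cases h : ∃ q₀, ‖x - p q₀‖ ≤ ℓ / 2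
  · obtain ⟨q₀, h⟩ := h
    have h1 := norm_sum_translates_sub_le hp hc hη hg h
    have h2 : ‖c q₀ * g (x - p q₀)‖ ≤ κ * M := by
      rw [norm_mul]
      exact mul_le_mul (hc _) (hM _) (norm_nonneg _) hκ
    have h3 := norm_le_norm_sub_add (∑ q, c q * g (x - p q)) (c q₀ * g (x - p q₀))
    linarith
  · push Not at h
    have h1 : ‖∑ q, c q * g (x - p q)‖ ≤ ∑ q : ι, κ * η := norm_sum_le_of_le _ fun q _ => by
      rw [norm_mul]
      exact mul_le_mul (hc q) (hg _ (h q).le) (norm_nonneg _) hκ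
    rw [Finset.sum_const, Finset.card_univ, nsmul_eq_mul] at h1
    have h2 := mul_nonneg hκ hM0
    linarith

theorem exists_norm_le_of_tendsto_cocompact {g : Rn 2 → ℝ}
    (hg : Filter.Tendsto g (Filter.cocompact (Rn 2)) (nhds 0)) {ε : ℝ} (hε : 0 < ε) :
    ∃ R : ℝ, ∀ u, R ≤ ‖u‖ → g u < ε := by
  have h := hg.eventually_lt_const hε
  rw [← Metric.cobounded_eq_cocompact, Filter.hasBasis_cobounded_norm.eventually_iff] at h
  obtain ⟨R, -, h⟩ := h
  exact ⟨R, fun u hu => h hu⟩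

theorem le_norm_lattice_sub {N : ℕ} {ℓ : ℝ} (hℓ : 0 ≤ ℓ) {q q' : Fin N × Fin N} (h : q ≠ q') :
    ℓ ≤ ‖(!₂[(q.1 : ℝ) * ℓ, (q.2 : ℝ) * ℓ] : Rn 2) - !₂[(q'.1 : ℝ) * ℓ, (q'.2 : ℝ) * ℓ]‖ := by
  have key : ∀ m n : Fin N, m ≠ n → ℓ ≤ |(m : ℝ) * ℓ - n * ℓ| := fun m n hmn => by
    rw [← sub_mul, abs_mul, abs_of_nonneg hℓ]
    refine le_mul_of_one_le_left hℓ ?_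
    have h1 : ((m : ℤ) - n) ≠ 0 := fun h0 => hmn (Fin.ext (by omega))
    exact_mod_cast Int.one_le_abs h1
  set v := (!₂[(q.1 : ℝ) * ℓ, (q.2 : ℝ) * ℓ] : Rn 2) - !₂[(q'.1 : ℝ) * ℓ, (q'.2 : ℝ) * ℓ]
  by_cases h1 : q.1 = q'.1
  · have h2 : q.2 ≠ q'.2 := fun h2 => h (Prod.ext h1 h2)
    refine (key _ _ h2).trans ?_
    simpa [v] using PiLp.norm_apply_le v 1
  · refine (key _ _ h1).trans ?_
    simpa [v] using PiLp.norm_apply_le v 0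

/-- Functions in the unit ball of the Besov class whose increments along the first coordinate are
prescribed, up to a small error, on a grid of arbitrary size. -/
theorem exists_besov_increments {w : ℝ → ℝ} (hw : IsDyadicWindow w) :
    ∃ (δ : ℝ) (z : ℂ), 0 < δ ∧ z ≠ 0 ∧ ∀ N : ℕ, ∃ a b : Fin N → ℝ, ∀ θ : Fin N → Fin N → ℂ,
      (∀ i k, ‖θ i k‖ ≤ 1) → ∃ (F : 𝓢'(Rn 2, ℂ)) (f : Rn 2 → ℂ),
        MemBesov hw F ∧ IsContinuousFunction F f ∧ besovNorm hw F ≤ 1 ∧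
        ∀ i k, ‖f !₂[a i, b k] - f !₂[a i + δ, b k] - θ i k * z‖ ≤ ‖z‖ / 2 := by
  set ψ := dyadicKernel 2 hw 0 with hψ
  let S : Finset ℤ := {-1, 0, 1}
  let G : Rn 2 → ℝ := fun u => ∑ n ∈ S, ‖kernelPiece hw n u‖
  have hGt : Filter.Tendsto G (Filter.cocompact (Rn 2)) (nhds 0) := by
    have := tendsto_finsetSum S fun n _ => (kernelPiece hw n).tendsto_cocompact.norm
    simpa using this
  have hGn : ∀ n ∈ S, ∀ u, ‖kernelPiece hw n u‖ ≤ G u := fun n hn u =>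
    Finset.single_le_sum (f := fun n => ‖kernelPiece hw n u‖) (fun _ _ => norm_nonneg _) hn
  have hGψ : ∀ u, ‖ψ u‖ ≤ G u := fun u => by
    rw [hψ, ← sum_kernelPiece hw, sum_apply]
    exact norm_sum_le _ _
  obtain ⟨M, hM0, hM⟩ : ∃ M : ℝ, 0 ≤ M ∧ ∀ u, G u ≤ M :=
    ⟨∑ n ∈ S, SchwartzMap.seminorm ℂ 0 0 (kernelPiece hw n),
      Finset.sum_nonneg fun n _ => apply_nonneg _ _,
      fun u => Finset.sum_le_sum fun n _ => SchwartzMap.norm_le_seminorm ℂ _ _⟩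
  obtain ⟨u₀, hu₀⟩ := dyadicKernel_zero_ne_zero hw
  -- Since `ψ` vanishes at infinity, a long enough step makes its modulus smaller than `‖ψ u₀‖`.
  obtain ⟨δ, hδ, hδu⟩ : ∃ δ : ℝ, 0 < δ ∧ ψ u₀ - ψ (u₀ + EuclideanSpace.single 0 δ) ≠ 0 := by
    have ht : Filter.Tendsto (fun u => ‖ψ u‖) (Filter.cocompact (Rn 2)) (nhds 0) := by
      simpa using ψ.tendsto_cocompact.norm
    obtain ⟨R, hR⟩ := exists_norm_le_of_tendsto_cocompact ht (norm_pos_iff.2 hu₀)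
    refine ⟨|R| + ‖u₀‖ + 1, by positivity, fun h => ?_⟩
    refine (hR _ ?_).ne (by rw [← sub_eq_zero.1 h])
    have h1 := norm_sub_le (u₀ + EuclideanSpace.single 0 (|R| + ‖u₀‖ + 1)) u₀
    rw [add_sub_cancel_left, PiLp.norm_single, Real.norm_of_nonneg (by positivity)] at h1
    linarith [le_abs_self R]
  set D := ψ u₀ - ψ (u₀ + EuclideanSpace.single 0 δ) with hD
  -- Chosen so that `7 / 2 * (κ * (M + 1)) = 1`, the bound for the Besov norm. It does not depend on
  -- `N`.
  let κ : ℝ := 2 / (7 * (M + 1))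
  have hκ : 0 < κ := by positivity
  refine ⟨δ, κ * D, hδ, mul_ne_zero (by exact_mod_cast hκ.ne') hδu, fun N => ?_⟩
  -- With `N ^ 2` centres the tails add up to at most `1`, for the norm, and at most `‖D‖ / 4`, for
  -- each of the two values in an increment.
  let η : ℝ := min 1 (‖D‖ / 4) / (N ^ 2 + 1)
  have hD0 : 0 < ‖D‖ := norm_pos_iff.2 hδu
  have hm : 0 < min 1 (‖D‖ / 4) := lt_min one_pos (by positivity)
  have hη : 0 < η := by positivity
  have hcard : (Fintype.card (Fin N × Fin N) : ℝ) * η ≤ min 1 (‖D‖ / 4) := by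
    rw [Fintype.card_prod, Fintype.card_fin, ← mul_div_assoc, div_le_iff₀ (by positivity)]
    push_cast
    nlinarith
  obtain ⟨R, hR⟩ := exists_norm_le_of_tendsto_cocompact hGt hη
  -- The spacing makes `G` smaller than `η` beyond `ℓ / 2` and keeps both sample points of a cell
  -- within `ℓ / 2` of its centre.
  let ℓ : ℝ := 2 * max R (‖u₀‖ + δ)
  have hℓ1 : R ≤ ℓ / 2 := by simp [ℓ]
  have hℓ2 : ‖u₀‖ + δ ≤ ℓ / 2 := by simp [ℓ]
  have hℓ : 0 ≤ ℓ := by linarith [norm_nonneg u₀]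
  refine ⟨fun i => i * ℓ + u₀ 0, fun k => k * ℓ + u₀ 1, fun θ hθ => ?_⟩
  let p : Fin N × Fin N → Rn 2 := fun q => !₂[(q.1 : ℝ) * ℓ, (q.2 : ℝ) * ℓ]
  have hp : ∀ q q', q ≠ q' → ℓ ≤ ‖p q - p q'‖ := fun q q' h => le_norm_lattice_sub hℓ h
  let c : Fin N × Fin N → ℂ := fun q => κ * θ q.1 q.2
  have hc : ∀ q, ‖c q‖ ≤ κ := fun q => by
    rw [norm_mul, Complex.norm_real, Real.norm_of_nonneg hκ.le]
    exact mul_le_of_le_one_right hκ.le (hθ _ _)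
  obtain ⟨F, hF, hFn⟩ := exists_translates hw c p
  obtain ⟨hB, hBn⟩ := memBesov_of_translates hw (2 / 7) (fun n hn x => by
    refine (norm_sum_translates_le hp hκ.le hc hη.le
      (fun u hu => (hGn n hn u).trans (hR u (hℓ1.trans hu)).le)
      (fun u => (hGn n hn u).trans (hM u)) x).trans ?_
    calc κ * (M + Fintype.card (Fin N × Fin N) * η) ≤ κ * (M + 1) :=
          mul_le_mul_of_nonneg_left (by linarith [min_le_left 1 (‖D‖ / 4)]) hκ.le
      _ = 2 / 7 := by simp only [κ]; field_simp) hF hFn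
  refine ⟨F, _, hB, hF, by simpa using hBn, fun i k => ?_⟩
  have happ : ∀ v : Rn 2, ‖v‖ ≤ ℓ / 2 →
      ‖∑ q, c q * ψ (p (i, k) + v - p q) - c (i, k) * ψ v‖ ≤ κ * (‖D‖ / 4) := fun v hv => by
    have h1 := norm_sum_translates_sub_le (x := p (i, k) + v) (q₀ := (i, k)) hp hc hη.le
      (fun u hu => (hGψ u).trans (hR u (hℓ1.trans hu)).le) (by rwa [add_sub_cancel_left])
    rw [add_sub_cancel_left] at h1
    exact h1.trans (mul_le_mul_of_nonneg_left (hcard.trans (min_le_right _ _)) hκ.le)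
  have h1 := happ u₀ (by linarith)
  have h2 := happ (u₀ + EuclideanSpace.single 0 δ) (by
    refine (norm_add_le _ _).trans ?_
    rw [PiLp.norm_single, Real.norm_of_nonneg hδ.le]
    exact hℓ2)
  have e1 : (!₂[(i : ℝ) * ℓ + u₀ 0, (k : ℝ) * ℓ + u₀ 1] : Rn 2) = p (i, k) + u₀ := by
    ext j; fin_cases j <;> simp [p]
  have e2 : (!₂[(i : ℝ) * ℓ + u₀ 0 + δ, (k : ℝ) * ℓ + u₀ 1] : Rn 2) =
      p (i, k) + (u₀ + EuclideanSpace.single 0 δ) := by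
    ext j; fin_cases j <;> simp [p, add_assoc]
  have h3 := norm_sub_le_of_le h1 h2
  rw [norm_mul, Complex.norm_real, Real.norm_of_nonneg hκ.le]
  refine le_of_eq_of_le ?_ (h3.trans_eq (by ring))
  simp only [e1, e2]
  congr 1
  simp only [c, hD]
  ring

end Interpolation

/-! ### The lower bound: a diagonal operator, its shift, and the discrete Fourier basis. -/

section LowerBound

/-- The operator with eigenvectors `v i` and eigenvalues `a i`. -/
def diagonalOperator {N : ℕ} (v : Fin N → EuclideanSpace ℂ (Fin N)) (a : Fin N → ℝ) :
    EuclideanSpace ℂ (Fin N) →L[ℂ] EuclideanSpace ℂ (Fin N) :=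
  ∑ i, (a i : ℂ) • (innerSL ℂ (v i)).smulRight (v i)

theorem diagonalOperator_apply {N : ℕ} (v : Fin N → EuclideanSpace ℂ (Fin N)) (a : Fin N → ℝ)
    (x : EuclideanSpace ℂ (Fin N)) :
    diagonalOperator v a x = ∑ i, (a i : ℂ) • inner ℂ (v i) x • v i := by
  simp [diagonalOperator, sum_apply]

theorem isSelfAdjoint_diagonalOperator {N : ℕ} (v : Fin N → EuclideanSpace ℂ (Fin N))
    (a : Fin N → ℝ) : IsSelfAdjoint (diagonalOperator v a) := by
  rw [ContinuousLinearMap.isSelfAdjoint_iff_isSymmetric]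
  intro x y
  simp only [ContinuousLinearMap.coe_coe, diagonalOperator_apply, sum_inner, inner_sum,
    inner_smul_left, inner_smul_right, Complex.conj_ofReal, inner_conj_symm]
  refine Finset.sum_congr rfl fun i _ => ?_
  ring

theorem diagonalOperator_apply_self {N : ℕ} {v : Fin N → EuclideanSpace ℂ (Fin N)}
    (hv : Orthonormal ℂ v) (a : Fin N → ℝ) (i : Fin N) :
    diagonalOperator v a (v i) = (a i : ℂ) • v i := by
  rw [diagonalOperator_apply, Finset.sum_eq_single i]
  · rw [inner_self_eq_norm_sq_to_K, hv.norm_eq_one]; simp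
  · intro j _ hj
    rw [hv.inner_eq_zero hj]; simp
  · simp

theorem rankLE_euclideanSpace {N : ℕ}
    (T : EuclideanSpace ℂ (Fin N) →L[ℂ] EuclideanSpace ℂ (Fin N)) : RankLE T N := by
  refine (LinearMap.rank_le_range _).trans ?_
  rw [← Module.finrank_eq_rank]
  simp

/-- The vectors of the discrete Fourier transform. -/
def dftVector (N : ℕ) (k : Fin N) : EuclideanSpace ℂ (Fin N) :=
  WithLp.toLp 2 fun j =>
    ((√N : ℝ) : ℂ)⁻¹ * (Complex.exp (2 * Real.pi * Complex.I / N) ^ (k : ℕ)) ^ (j : ℕ)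

theorem orthonormal_dftVector (N : ℕ) : Orthonormal ℂ (dftVector N) := by
  rcases Nat.eq_zero_or_pos N with rfl | hN
  · exact ⟨fun i => i.elim0, fun i => i.elim0⟩
  have hζ := Complex.isPrimitiveRoot_exp N hN.ne'
  set ζ := Complex.exp (2 * Real.pi * Complex.I / N) with hζd
  have hn : ‖ζ‖ = 1 := hζ.norm'_eq_one hN.ne'
  have hN' : (0 : ℝ) < N := by exact_mod_cast hN
  have hs : (((√N : ℝ) : ℂ)⁻¹) * ((√N : ℝ) : ℂ)⁻¹ = (N : ℂ)⁻¹ := by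
    rw [← mul_inv, ← Complex.ofReal_mul, Real.mul_self_sqrt hN'.le, Complex.ofReal_natCast]
  have h0 : ζ ≠ 0 := hζ.ne_zero hN.ne'
  have hconj : (starRingEnd ℂ) ζ = ζ⁻¹ := (Complex.inv_eq_conj hn).symm
  rw [orthonormal_iff_ite]
  intro k l
  have h1 : inner ℂ (dftVector N k) (dftVector N l) =
      (N : ℂ)⁻¹ * ∑ j ∈ Finset.range N, (ζ ^ (l : ℕ) * (ζ ^ (k : ℕ))⁻¹) ^ j := by
    rw [Finset.sum_range, Finset.mul_sum, PiLp.inner_apply]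
    refine Finset.sum_congr rfl fun j _ => ?_
    simp only [dftVector, RCLike.inner_apply, map_mul, map_pow, map_inv₀, Complex.conj_ofReal,
      ← hζd, hconj]
    rw [← hs, mul_pow, inv_pow]
    ring
  rw [h1]
  split_ifs with h
  · subst h
    have : (N : ℂ) ≠ 0 := by exact_mod_cast hN.ne'
    simp [h0, this]
  · have h2 : ζ ^ (l : ℕ) * (ζ ^ (k : ℕ))⁻¹ ≠ 1 := fun h3 => by
      rw [mul_inv_eq_one₀ (pow_ne_zero _ h0)] at h3
      exact h (Fin.ext (hζ.pow_inj l.2 k.2 h3).symm)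
    have h3 : (ζ ^ (l : ℕ) * (ζ ^ (k : ℕ))⁻¹) ^ N = 1 := by
      rw [mul_pow, inv_pow, ← pow_mul, ← pow_mul, mul_comm (l : ℕ), mul_comm (k : ℕ), pow_mul,
        pow_mul, hζ.pow_eq_one]
      simp
    rw [geom_sum_eq h2, h3]
    simp

theorem norm_inner_single_dftVector {N : ℕ} (i k : Fin N) :
    ‖inner ℂ (EuclideanSpace.single i (1 : ℂ)) (dftVector N k)‖ = (√N)⁻¹ := by
  have hN : N ≠ 0 := fun h => (h ▸ i).elim0
  have hn := (Complex.isPrimitiveRoot_exp N hN).norm'_eq_one hN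
  rw [EuclideanSpace.inner_single_left]
  simp [dftVector, hn]

theorem norm_sum_of_orthonormal {N : ℕ} {v : Fin N → EuclideanSpace ℂ (Fin N)}
    (hv : Orthonormal ℂ v) : ‖∑ i, v i‖ = √N := by
  have := norm_sum_smul_sq_of_orthogonal Finset.univ v 1
    (fun i j => by rw [orthonormal_iff_ite.1 hv i j]; simp) 1
  rw [eq_comm, Real.sqrt_eq_iff_mul_self_eq (by positivity) (by positivity)]
  simpa [sq] using this.symm

/-- The lower bound for the operator norm. -/
theorem le_norm_of_norm_inner_sub_le {N : ℕ} (hN : 1 ≤ N)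
    {e h : Fin N → EuclideanSpace ℂ (Fin N)} (he : Orthonormal ℂ e) (hh : Orthonormal ℂ h)
    (heh : ∀ i k, ‖inner ℂ (e i) (h k)‖ = (√N)⁻¹) (g : Fin N → Fin N → ℂ) (z : ℂ)
    (hg : ∀ i k, ‖g i k - √N * (starRingEnd ℂ) (inner ℂ (e i) (h k)) * z‖ ≤ ‖z‖ / 2)
    {R : EuclideanSpace ℂ (Fin N) →L[ℂ] EuclideanSpace ℂ (Fin N)}
    (hR : ∀ i k, inner ℂ (e i) (R (h k)) = g i k * inner ℂ (e i) (h k)) :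
    √N * (‖z‖ / 2) ≤ ‖R‖ := by
  have hN0 : (0 : ℝ) < N := by exact_mod_cast hN
  set s := √(N : ℝ) with hs
  have hs0 : 0 < s := Real.sqrt_pos.2 hN0
  have hss : s * s = N := Real.mul_self_sqrt hN0.le
  -- The test vectors have norm `√N` each, and the `N ^ 2` terms are close to `z / √N`, so they add
  -- up without cancellation.
  have h1 : inner ℂ (∑ i, e i) (R (∑ k, h k)) = ∑ i, ∑ k, g i k * inner ℂ (e i) (h k) := by
    simp only [map_sum, sum_inner, inner_sum, hR]
    exact Finset.sum_comm
  have h2 : ‖inner ℂ (∑ i, e i) (R (∑ k, h k))‖ ≤ ‖R‖ * N := by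
    refine (norm_inner_le_norm _ _).trans ?_
    rw [norm_sum_of_orthonormal he]
    refine (mul_le_mul_of_nonneg_left (R.le_opNorm _) hs0.le).trans_eq ?_
    rw [norm_sum_of_orthonormal hh, ← hs, ← hss]
    ring
  have h3 : ∀ i k, ‖g i k * inner ℂ (e i) (h k) - (s⁻¹ : ℝ) * z‖ ≤ ‖z‖ / 2 * s⁻¹ := fun i k => by
    have h4 : (starRingEnd ℂ) (inner ℂ (e i) (h k)) * inner ℂ (e i) (h k) =
        (s⁻¹ * s⁻¹ : ℝ) := by
      rw [Complex.conj_mul', heh]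
      push_cast
      ring
    have h5 : (s : ℂ) * (s⁻¹ * s⁻¹ : ℝ) = (s⁻¹ : ℝ) := by
      rw [← Complex.ofReal_mul, mul_inv_cancel_left₀ hs0.ne']
    have h6 : g i k * inner ℂ (e i) (h k) - (s⁻¹ : ℝ) * z =
        (g i k - s * (starRingEnd ℂ) (inner ℂ (e i) (h k)) * z) * inner ℂ (e i) (h k) := by
      rw [← h5, ← h4]
      ring
    rw [h6, norm_mul, heh]
    exact mul_le_mul_of_nonneg_right (hg i k) (by positivity)
  have h4 : ‖∑ i, ∑ k, (g i k * inner ℂ (e i) (h k) - (s⁻¹ : ℝ) * z)‖ ≤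
      ∑ i : Fin N, ∑ k : Fin N, ‖z‖ / 2 * s⁻¹ :=
    norm_sum_le_of_le _ fun i _ => norm_sum_le_of_le _ fun k _ => h3 i k
  simp only [Finset.sum_sub_distrib, ← h1, Finset.sum_const, Finset.card_univ, Fintype.card_fin,
    nsmul_eq_mul] at h4
  have h5 : ‖(N : ℂ) * ((N : ℂ) * ((s⁻¹ : ℝ) * z))‖ = N * (N * (s⁻¹ * ‖z‖)) := by
    simp only [norm_mul, Complex.norm_real, RCLike.norm_natCast, norm_inv,
      Real.norm_of_nonneg hs0.le]
  have h6 := norm_sub_norm_le ((N : ℂ) * ((N : ℂ) * ((s⁻¹ : ℝ) * z)))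
    (inner ℂ (∑ i, e i) (R (∑ k, h k)))
  rw [norm_sub_rev, h5] at h6
  have h7 : N * (s * (‖z‖ / 2)) ≤ N * ‖R‖ := by
    have h8 : (N : ℝ) * s⁻¹ = s := by rw [← hss, mul_assoc, mul_inv_cancel₀ hs0.ne', mul_one]
    have h9 : N * (N * (s⁻¹ * ‖z‖)) = N * (N * s⁻¹) * ‖z‖ := by ring
    have h10 : N * (N * (‖z‖ / 2 * s⁻¹)) = N * (N * s⁻¹) * ‖z‖ / 2 := by ring
    rw [h9, h8] at h6
    rw [h10, h8] at h4
    linarith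
  exact le_of_mul_le_mul_left h7 hN0

/-- Sharpness of the estimate, with the same extremal function and operators for all `p`. -/
theorem exists_le_schattenNorm_pairFunction_sub {w : ℝ → ℝ} (hw : IsDyadicWindow w) :
    ∃ c : ℝ≥0, 0 < c ∧ ∀ (p : ℝ≥0∞) (_ : 2 ≤ p) (N : ℕ) (_ : 1 ≤ N),
      ∃ (F : 𝓢'(Rn 2, ℂ)) (f : Rn 2 → ℂ)
        (A₁ A₂ B : EuclideanSpace ℂ (Fin N) →L[ℂ] EuclideanSpace ℂ (Fin N)),
        MemBesov hw F ∧ IsContinuousFunction F f ∧ besovNorm hw F ≤ 1 ∧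
        IsSelfAdjoint A₁ ∧ IsSelfAdjoint A₂ ∧ IsSelfAdjoint B ∧
        RankLE A₁ N ∧ RankLE A₂ N ∧ RankLE B N ∧ A₁ ≠ A₂ ∧
        c * (N : ℝ≥0∞) ^ ((1 : ℝ) / 2 - 1 / p.toReal) * schattenNorm p (A₁ - A₂) ≤
          schattenNorm p (pairFunction f A₁ B - pairFunction f A₂ B) := by
  obtain ⟨δ, z, hδ, hz, hN⟩ := exists_besov_increments hw
  have hz0 : 0 < ‖z‖ := norm_pos_iff.2 hz
  have hc : 0 < ‖z‖ / (2 * δ) := by positivity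
  -- The quotient of the lower bound `√N * (‖z‖ / 2)` for the difference and the upper bound `N ^ (1
  -- / p) * δ` for `A - A'`, up to the power of `N`.
  refine ⟨(‖z‖ / (2 * δ)).toNNReal, Real.toNNReal_pos.2 hc, fun p hp N hN1 => ?_⟩
  obtain ⟨a, b, hab⟩ := hN N
  have hN0 : (0 : ℝ) < N := by exact_mod_cast hN1
  let e : Fin N → EuclideanSpace ℂ (Fin N) := fun i => EuclideanSpace.single i 1
  have he : Orthonormal ℂ e := EuclideanSpace.orthonormal_single
  have hh := orthonormal_dftVector N
  have heh : ∀ i k, ‖inner ℂ (e i) (dftVector N k)‖ = (√N)⁻¹ := norm_inner_single_dftVector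
  obtain ⟨F, f, hF, hf, hF1, hinc⟩ := hab
    -- All entries of the Fourier matrix have modulus `1 / √N`, so these are the unimodular numbers
    -- that cancel their phases.
    (fun i k => √N * (starRingEnd ℂ) (inner ℂ (e i) (dftVector N k))) fun i k => by
      rw [norm_mul, RCLike.norm_conj, heh, Complex.norm_real,
        Real.norm_of_nonneg (Real.sqrt_nonneg _), mul_inv_cancel₀ (Real.sqrt_pos.2 hN0).ne']
  let A : EuclideanSpace ℂ (Fin N) →L[ℂ] EuclideanSpace ℂ (Fin N) := diagonalOperator e a
  -- A scalar shift keeps the eigenvectors `e`, so the entries of the difference involve only the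
  -- increments of `f` along the first coordinate.
  let A' : EuclideanSpace ℂ (Fin N) →L[ℂ] EuclideanSpace ℂ (Fin N) := A + (δ : ℂ) • 1
  let B := diagonalOperator (dftVector N) b
  have hA : IsSelfAdjoint A := isSelfAdjoint_diagonalOperator e a
  have hA' : IsSelfAdjoint A' := by
    refine ContinuousLinearMap.isSelfAdjoint_iff_isSymmetric.2 fun x y => ?_
    have h1 := ContinuousLinearMap.isSelfAdjoint_iff_isSymmetric.1 hA x y
    simp only [ContinuousLinearMap.coe_coe] at h1
    simp only [A', ContinuousLinearMap.coe_coe, add_apply, smul_apply, one_apply_eq_self,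
      inner_add_left, inner_add_right, inner_smul_left, inner_smul_right, h1, Complex.conj_ofReal]
  have hB : IsSelfAdjoint B := isSelfAdjoint_diagonalOperator _ b
  have hAe : ∀ i, A (e i) = (a i : ℂ) • e i := diagonalOperator_apply_self he a
  have hAe' : ∀ i, A' (e i) = ((a i + δ : ℝ) : ℂ) • e i := fun i => by
    simp only [A', add_apply, smul_apply, hAe, one_apply_eq_self,
      Complex.ofReal_add, add_smul]
  have hBe : ∀ k, B (dftVector N k) = (b k : ℂ) • dftVector N k := diagonalOperator_apply_self hh b
  have hsub : A - A' = -((δ : ℂ) • 1) := by simp [A']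
  refine ⟨F, f, A, A', B, hF, hf, hF1, hA, hA', hB, rankLE_euclideanSpace _,
    rankLE_euclideanSpace _, rankLE_euclideanSpace _, fun h => ?_, ?_⟩
  · have h1 := hsub
    rw [sub_eq_zero.2 h, eq_comm, neg_eq_zero] at h1
    have h2 := congrArg (fun T => T (e ⟨0, hN1⟩)) h1
    have h3 := he.ne_zero ⟨0, hN1⟩
    simp [hδ.ne', h3] at h2
  have hlow : √N * (‖z‖ / 2) ≤ ‖pairFunction f A B - pairFunction f A' B‖ := by
    refine le_norm_of_norm_inner_sub_le hN1 he hh heh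
      (fun i k => f !₂[a i, b k] - f !₂[a i + δ, b k]) z hinc fun i k => ?_
    rw [sub_apply, inner_sub_right,
      inner_pairFunction f (rankLE_euclideanSpace A) (rankLE_euclideanSpace B) hA hB (hAe i)
        (hBe k),
      inner_pairFunction f (rankLE_euclideanSpace A') (rankLE_euclideanSpace B) hA' hB (hAe' i)
        (hBe k)]
    ring
  have hup : schattenNorm p (A - A') ≤ (N : ℝ≥0∞) ^ (1 / p.toReal) * ENNReal.ofReal δ := by
    refine (schattenNorm_le_rank_mul_enorm hp (rankLE_euclideanSpace _)).trans
      (mul_le_mul_right ?_ _)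
    rw [← ofReal_norm, hsub, norm_neg]
    refine ENNReal.ofReal_le_ofReal ((norm_smul_le _ _).trans ?_)
    rw [Complex.norm_real, Real.norm_of_nonneg hδ.le]
    exact mul_le_of_le_one_right hδ.le ContinuousLinearMap.norm_id_le
  have hpow : (N : ℝ≥0∞) ^ ((1 : ℝ) / 2 - 1 / p.toReal) * (N : ℝ≥0∞) ^ (1 / p.toReal) =
      ENNReal.ofReal √N := by
    rw [← ENNReal.rpow_add _ _ (by exact_mod_cast hN0.ne') (by simp), sub_add_cancel,
      Real.sqrt_eq_rpow, ← ENNReal.ofReal_rpow_of_pos hN0, ENNReal.ofReal_natCast]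
  calc ((‖z‖ / (2 * δ)).toNNReal : ℝ≥0∞) * (N : ℝ≥0∞) ^ ((1 : ℝ) / 2 - 1 / p.toReal) *
        schattenNorm p (A - A')
      ≤ ENNReal.ofReal (‖z‖ / (2 * δ)) * (N : ℝ≥0∞) ^ ((1 : ℝ) / 2 - 1 / p.toReal) *
        ((N : ℝ≥0∞) ^ (1 / p.toReal) * ENNReal.ofReal δ) := mul_le_mul_right hup _
    _ = ENNReal.ofReal (√N * (‖z‖ / 2)) := by
        rw [mul_assoc, ← mul_assoc (_ ^ _), hpow, ← ENNReal.ofReal_mul (by positivity),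
          ← ENNReal.ofReal_mul hc.le]
        congr 1
        field_simp
    _ ≤ ENNReal.ofReal ‖pairFunction f A B - pairFunction f A' B‖ := ENNReal.ofReal_le_ofReal hlow
    _ = ‖pairFunction f A B - pairFunction f A' B‖ₑ := ofReal_norm _
    _ ≤ _ := enorm_le_schattenNorm hp _

end LowerBound

end

theorem theorem5p1 (w : ℝ → ℝ) (hw : IsDyadicWindow w) :
    (∃ C : ℝ≥0, ∀ (p : ℝ≥0∞) (_ : 2 ≤ p) (N : ℕ)
      (H : Type*) [NormedAddCommGroup H] [InnerProductSpace ℂ H] [CompleteSpace H]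
      (A₁ B₁ A₂ B₂ : H →L[ℂ] H)
      (_ : IsSelfAdjoint A₁) (_ : IsSelfAdjoint B₁) (_ : IsSelfAdjoint A₂) (_ : IsSelfAdjoint B₂)
      (_ : RankLE A₁ N) (_ : RankLE B₁ N) (_ : RankLE A₂ N) (_ : RankLE B₂ N)
      (F : 𝓢'(Rn 2, ℂ)) (f : Rn 2 → ℂ) (_ : MemBesov hw F) (_ : IsContinuousFunction F f),
      schattenNorm p (pairFunction f A₁ B₁ - pairFunction f A₂ B₂) ≤
        C * (N : ℝ≥0∞) ^ ((1 : ℝ) / 2 - 1 / p.toReal) * besovNorm hw F *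
          max (schattenNorm p (A₁ - A₂)) (schattenNorm p (B₁ - B₂))) ∧
    (∃ c : ℝ≥0, 0 < c ∧ ∀ (p : ℝ≥0∞) (_ : 2 ≤ p) (N : ℕ) (_ : 1 ≤ N),
      ∃ (F : 𝓢'(Rn 2, ℂ)) (f : Rn 2 → ℂ)
        (A₁ A₂ B : EuclideanSpace ℂ (Fin N) →L[ℂ] EuclideanSpace ℂ (Fin N)),
        MemBesov hw F ∧ IsContinuousFunction F f ∧ besovNorm hw F ≤ 1 ∧
        IsSelfAdjoint A₁ ∧ IsSelfAdjoint A₂ ∧ IsSelfAdjoint B ∧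
        RankLE A₁ N ∧ RankLE A₂ N ∧ RankLE B N ∧ A₁ ≠ A₂ ∧
        c * (N : ℝ≥0∞) ^ ((1 : ℝ) / 2 - 1 / p.toReal) * schattenNorm p (A₁ - A₂) ≤
          schattenNorm p (pairFunction f A₁ B - pairFunction f A₂ B)) := by
  exact ⟨exists_schattenNorm_pairFunction_sub_le hw, exists_le_schattenNorm_pairFunction_sub hw⟩
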